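/- Let $q$ be an indeterminate, $[k]=\frac{q^k-q^{-k}}{q-q^{-1}}$, $[k]!=[k]\cdots[1]$ and $\left[{n\atop k}\right]=\frac{[n]!}{[k]!\,[n-k]!}$. **$\mathsf{Rep}$.** Let $U_q=U_q(\mathfrak{gl}(1|1))$ be the superalgebra over $\mathbb{C}(q)$ with odd generators $E,F$ and even generators $\mathbf q^h$ ($h\in\mathbb{Z}h_1\oplus\mathbb{Z}h_2$), with relations $\mathbf q^0=1$, $\mathbf q^h\mathbf q^{h'}=\mathbf q^{h+h'}$, $\mathbf q^hE=q^{\langle h,\alpha\rangle}E\mathbf q^h$, $\mathbf q^hF=q^{-\langle h,\alpha\rangle}F\mathbf q^h$, $E^2=F^2=0$, $EF+FE=\frac{K-K^{-1}}{q-q^{-1}}$, where $K=\mathbf q^{h_1+h_2}$, $\alpha=\epsilon_1-\epsilon_2$ and $\langle h_i,\epsilon_j\rangle=\delta_{ij}$. Its (super)representations form a monoidal category, with even $U_q$-linear maps as morphisms, through the comultiplication $\Delta(E)=E\otimes K^{-1}+1\otimes E$, $\Delta(F)=F\otimes1+K\otimes F$, $\Delta(\mathbf q^h)=\mathbf q^h\otimes\mathbf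 q^h$ and the usual sign rule; the unit is the trivial representation $V(0)=\mathbb{C}(q)$ given by the counit $E,F\mapsto0$, $\mathbf q^h\mapsto1$. For $a>0$ let $V(a)$ have basis $v^a_0$ (even), $v^a_1$ (odd) with $Ev^a_0=0$, $Fv^a_0=v^a_1$, $Ev^a_1=[a]v^a_0$, $Fv^a_1=0$, $\mathbf q^hv^a_0=q^{\langle h,a\epsilon_1\rangle}v^a_0$, $\mathbf q^hv^a_1=q^{\langle h,a\epsilon_1-\alpha\rangle}v^a_1$. For a sequence $\boldsymbol a=(a_1,\dots,a_\ell)$ of positive integers put $V(\boldsymbol a)=V(a_1)\otimes\cdots\otimes V(a_\ell)$ (and $V(())=V(0)$). Let $\mathsf{Rep}$ be the full monoidal subcategory of the category of $U_q$-representations generated by the $V(a)$, $a\ge0$. For $a,b>0$ define $\Phi_{a,b}:V(a)\otimes V(b)\to V(a+b)$ and $\Phi^{a,b}:V(a+b)\to V(a)\otimes V(b)$ by $$\Phi_{a,b}:\quad v^a_1\otimes v^b_1\mapsto0,\quad v^a_1\otimes v^b_0\mapsto q^{-b}\left[{a+b-1\atop b}\right]v^{a+b}_1,\quad v^a_0\otimes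 v^b_1\mapsto\left[{a+b-1\atop a}\right]v^{a+b}_1,\quad v^a_0\otimes v^b_0\mapsto\left[{a+b\atop a}\right]v^{a+b}_0,$$ $$\Phi^{a,b}:\quad v^{a+b}_1\mapsto v^a_1\otimes v^b_0+q^av^a_0\otimes v^b_1,\quad v^{a+b}_0\mapsto v^a_0\otimes v^b_0.$$ **$\mathsf{Web}$.** Let $\mathsf{Web}$ be the $\mathbb{C}(q)$-linear strict monoidal category whose objects are the finite sequences of positive integers (with concatenation as tensor product) and whose morphisms are linear combinations of web diagrams (upward oriented plane diagrams, without maxima or minima, built from labelled vertical strands, merges $m_{a,b}:(a,b)\to(a+b)$ and splits $s_{a,b}:(a+b)\to(a,b)$ by vertical and horizontal composition), up to isotopy and modulo the relations $$m_{a,b}\,s_{a,b}=\left[{a+b\atop a}\right]\mathrm{id}_{(a+b)},$$ $$m_{a+b,c}(m_{a,b}\otimes\mathrm{id}_c)=m_{a,b+c}(\mathrm{id}_a\otimes m_{b,c}),\qquad (s_{a,b}\otimes\mathrm{id}_c)s_{a+b,c}=(\mathrm{id}_a\otimes s_{b,c})s_{a,b+c},$$ $$C_1C_2C_1+C_2=C_2C_1C_2+C_1\quad\text{on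 }(1,1,1),$$ where $C_1=s_{1,1}m_{1,1}\otimes\mathrm{id}_1$ and $C_2=\mathrm{id}_1\otimes s_{1,1}m_{1,1}$. **Proposition.** The assignment $\boldsymbol a\mapsto V(\boldsymbol a)$, $m_{a,b}\mapsto\Phi_{a,b}$, $s_{a,b}\mapsto\Phi^{a,b}$ extends to one and only one $\mathbb{C}(q)$-linear monoidal functor $\mathscr{T}:\mathsf{Web}\to\mathsf{Rep}$ whose monoidal structure is given by the canonical identifications $V(\boldsymbol a)\otimes V(\boldsymbol b)\cong V(\boldsymbol a\boldsymbol b)$, where $\boldsymbol a\boldsymbol b$ is the concatenation. This functor is dense (essentially surjective on objects) and full. -/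

import Mathlib

open CategoryTheory MonoidalCategory
open scoped TensorProduct

namespace GL11

noncomputable section

/-! ### Quantum numbers -/

/-- The ground field `ℂ(q)`. -/
abbrev Kq : Type := RatFunc ℂ

/-- The quantum parameter, the indeterminate of `ℂ(q)`. -/
def q : Kq := RatFunc.X

/-- The quantum number `[k] = (q ^ k - q ^ (-k)) / (q - q⁻¹)`. -/
def qInt (k : ℕ) : Kq := (q ^ (k : ℤ) - q ^ (-(k : ℤ))) / (q - q⁻¹)

/-- The quantum factorial `[k]! = [k] [k-1] ⋯ [1]`. -/
def qFact (k : ℕ) : Kq := ∏ i ∈ Finset.range k, qInt (i + 1)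

/-- The quantum binomial coefficient `[n]! / ([k]! [n-k]!)`, used for `k ≤ n` only. -/
def qBinom (n k : ℕ) : Kq := qFact n / (qFact k * qFact (n - k))

/-! ### The quantum enveloping superalgebra `U_q(gl(1|1))` -/

/-- The generators `E`, `F` and `𝐪^h`, for `h = (h.1) h₁ + (h.2) h₂` in the dual weight lattice. -/
inductive UqGen : Type
  | E : UqGen
  | F : UqGen
  | qh (h : ℤ × ℤ) : UqGen

/-- The pairing `⟨h, α⟩` with the simple root `α = ε₁ - ε₂`. -/
def pairAlpha (h : ℤ × ℤ) : ℤ := h.1 - h.2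

/-- The defining relations. The element `K = 𝐪^{h₁ + h₂}` is `𝐪^(1,1)`, and its inverse is `𝐪^(-1,-1)`. -/
inductive UqRel : FreeAlgebra Kq UqGen → FreeAlgebra Kq UqGen → Prop
  | qh_zero : UqRel (FreeAlgebra.ι Kq (UqGen.qh 0)) 1
  | qh_mul (h h' : ℤ × ℤ) :
      UqRel (FreeAlgebra.ι Kq (UqGen.qh h) * FreeAlgebra.ι Kq (UqGen.qh h'))
        (FreeAlgebra.ι Kq (UqGen.qh (h + h')))
  | qh_E (h : ℤ × ℤ) :
      UqRel (FreeAlgebra.ι Kq (UqGen.qh h) * FreeAlgebra.ι Kq UqGen.E)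
        (q ^ pairAlpha h • (FreeAlgebra.ι Kq UqGen.E * FreeAlgebra.ι Kq (UqGen.qh h)))
  | qh_F (h : ℤ × ℤ) :
      UqRel (FreeAlgebra.ι Kq (UqGen.qh h) * FreeAlgebra.ι Kq UqGen.F)
        (q ^ (-pairAlpha h) • (FreeAlgebra.ι Kq UqGen.F * FreeAlgebra.ι Kq (UqGen.qh h)))
  | E_sq : UqRel (FreeAlgebra.ι Kq UqGen.E * FreeAlgebra.ι Kq UqGen.E) 0
  | F_sq : UqRel (FreeAlgebra.ι Kq UqGen.F * FreeAlgebra.ι Kq UqGen.F) 0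
  | EF : UqRel
      (FreeAlgebra.ι Kq UqGen.E * FreeAlgebra.ι Kq UqGen.F +
        FreeAlgebra.ι Kq UqGen.F * FreeAlgebra.ι Kq UqGen.E)
      ((q - q⁻¹)⁻¹ • (FreeAlgebra.ι Kq (UqGen.qh (1, 1)) -
        FreeAlgebra.ι Kq (UqGen.qh (-1, -1))))

/-- The algebra `U_q = U_q(gl(1|1))` over `ℂ(q)`. -/
abbrev Uq : Type := RingQuot UqRel

/-- The image in `U_q` of a generator. -/
def Uq.of (g : UqGen) : Uq := RingQuot.mkAlgHom Kq UqRel (FreeAlgebra.ι Kq g)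

/-- A subalgebra that contains the generators is all of `U_q`. -/
theorem Uq.mem_of_gens (S : Subalgebra Kq Uq) (h : ∀ g, Uq.of g ∈ S) (x : Uq) : x ∈ S := by
  obtain ⟨y, rfl⟩ := RingQuot.mkAlgHom_surjective Kq UqRel x
  induction y using FreeAlgebra.induction with
  | grade0 r => simp
  | grade1 g => exact h g
  | mul a b ha hb => simpa using S.mul_mem ha hb
  | add a b ha hb => simpa using S.add_mem ha hb

/-- The universal property of `U_q`, for a family `t` of elements that satisfies the relations. -/
def Uq.lift {A : Type*} [Ring A] [Algebra Kq A] (t : UqGen → A)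
    (h : ∀ x y, UqRel x y → FreeAlgebra.lift Kq t x = FreeAlgebra.lift Kq t y) : Uq →ₐ[Kq] A :=
  RingQuot.liftAlgHom Kq ⟨FreeAlgebra.lift Kq t, fun x y hxy => h x y hxy⟩

@[simp] theorem Uq.lift_of {A : Type*} [Ring A] [Algebra Kq A] (t : UqGen → A)
    (h : ∀ x y, UqRel x y → FreeAlgebra.lift Kq t x = FreeAlgebra.lift Kq t y) (g : UqGen) :
    Uq.lift t h (Uq.of g) = t g := by
  simp [Uq.lift, Uq.of]

/-! ### Super representations of `U_q` -/

/-- A `U_q`-supermodule over `ℂ(q)`. The `ℤ/2`-grading is recorded by its parity operator `σ`,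
`σ v = (-1) ^ |v| v`, so that the even part is `ker (σ - 1)` and the odd part is `ker (σ + 1)`.
The generators `E`, `F` are odd and the `𝐪^h` are even. -/
structure SuperRep where
  carrier : Type
  [addCommGroup : AddCommGroup carrier]
  [module : Module Kq carrier]
  σ : Module.End Kq carrier
  σ_sq : σ * σ = 1
  ρ : Uq →ₐ[Kq] Module.End Kq carrier
  E_odd : σ * ρ (Uq.of UqGen.E) = -(ρ (Uq.of UqGen.E) * σ)
  F_odd : σ * ρ (Uq.of UqGen.F) = -(ρ (Uq.of UqGen.F) * σ)
  qh_even : ∀ h, σ * ρ (Uq.of (UqGen.qh h)) = ρ (Uq.of (UqGen.qh h)) * σ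

attribute [instance] SuperRep.addCommGroup SuperRep.module

namespace SuperRep

/-- A morphism of `U_q`-supermodules: a linear map that preserves the grading and commutes with
the action of `U_q`. Between tensor products of the `V(a)` below, the first condition follows from
the second: the parity of a weight vector is the parity of its weight on `h₂`. -/
@[ext] structure Hom (M N : SuperRep) where
  lin : M.carrier →ₗ[Kq] N.carrier
  comm_σ : lin ∘ₗ M.σ = N.σ ∘ₗ lin
  comm_ρ : ∀ x : Uq, lin ∘ₗ M.ρ x = N.ρ x ∘ₗ lin

theorem comm_of_gens {M N : SuperRep} (f : M.carrier →ₗ[Kq] N.carrier)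
    (h : ∀ g, f ∘ₗ M.ρ (Uq.of g) = N.ρ (Uq.of g) ∘ₗ f) (x : Uq) :
    f ∘ₗ M.ρ x = N.ρ x ∘ₗ f := by
  let S : Subalgebra Kq Uq :=
    { carrier := {x | f ∘ₗ M.ρ x = N.ρ x ∘ₗ f}
      mul_mem' := by
        intro a b ha hb
        simp only [Set.mem_ofPred_eq, map_mul, Module.End.mul_eq_comp] at *
        rw [← LinearMap.comp_assoc, ha, LinearMap.comp_assoc, hb, LinearMap.comp_assoc]
      add_mem' := by
        intro a b ha hb
        simp only [Set.mem_ofPred_eq, map_add] at *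
        rw [LinearMap.comp_add, LinearMap.add_comp, ha, hb]
      algebraMap_mem' := by
        intro r
        simp only [Set.mem_ofPred_eq, AlgHom.commutes]
        ext v
        simp }
  exact Uq.mem_of_gens S h x

instance : Category SuperRep where
  Hom := Hom
  id M := ⟨LinearMap.id, rfl, fun _ => rfl⟩
  comp f g := ⟨g.lin ∘ₗ f.lin,
    by rw [LinearMap.comp_assoc, f.comm_σ, ← LinearMap.comp_assoc, g.comm_σ,
      LinearMap.comp_assoc],
    fun x => by rw [LinearMap.comp_assoc, f.comm_ρ, ← LinearMap.comp_assoc, g.comm_ρ,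
      LinearMap.comp_assoc]⟩

/-- The linear map underlying a morphism. -/
def toLin {M N : SuperRep} (f : M ⟶ N) : M.carrier →ₗ[Kq] N.carrier := Hom.lin f

@[ext] theorem hom_ext {M N : SuperRep} {f g : M ⟶ N} (h : toLin f = toLin g) : f = g :=
  Hom.ext h

@[simp] theorem toLin_id (M : SuperRep) : toLin (𝟙 M) = LinearMap.id := rfl

@[simp] theorem toLin_comp {M N P : SuperRep} (f : M ⟶ N) (g : N ⟶ P) :
    toLin (f ≫ g) = toLin g ∘ₗ toLin f := rfl

/-- The morphisms from `M` to `N`, as a subspace of the space of linear maps. -/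
def homSub (M N : SuperRep) : Submodule Kq (M.carrier →ₗ[Kq] N.carrier) where
  carrier := {f | f ∘ₗ M.σ = N.σ ∘ₗ f ∧ ∀ x : Uq, f ∘ₗ M.ρ x = N.ρ x ∘ₗ f}
  add_mem' := by
    rintro f g ⟨h1, h2⟩ ⟨h3, h4⟩
    refine ⟨by rw [LinearMap.add_comp, LinearMap.comp_add, h1, h3], fun x => ?_⟩
    rw [LinearMap.add_comp, LinearMap.comp_add, h2, h4]
  zero_mem' := by simp
  smul_mem' := by
    rintro c f ⟨h1, h2⟩
    refine ⟨by rw [LinearMap.smul_comp, LinearMap.comp_smul, h1], fun x => ?_⟩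
    rw [LinearMap.smul_comp, LinearMap.comp_smul, h2]

/-- Morphisms are the elements of `homSub`. -/
def homEquiv (M N : SuperRep) : (M ⟶ N) ≃ homSub M N where
  toFun f := ⟨Hom.lin f, Hom.comm_σ f, Hom.comm_ρ f⟩
  invFun f := (⟨f.1, f.2.1, f.2.2⟩ : Hom M N)
  left_inv _ := rfl
  right_inv _ := rfl

instance (M N : SuperRep) : AddCommGroup (M ⟶ N) := (homEquiv M N).addCommGroup

instance (M N : SuperRep) : Module Kq (M ⟶ N) := (homEquiv M N).module Kq

@[simp] theorem toLin_add {M N : SuperRep} (f g : M ⟶ N) :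
    toLin (f + g) = toLin f + toLin g := rfl

@[simp] theorem toLin_smul {M N : SuperRep} (c : Kq) (f : M ⟶ N) :
    toLin (c • f) = c • toLin f := rfl

instance : Preadditive SuperRep where
  add_comp _ _ _ f g h := by ext1; simp [LinearMap.comp_add]
  comp_add _ _ _ f g h := by ext1; simp [LinearMap.add_comp]

instance : Linear Kq SuperRep where
  smul_comp _ _ _ c f g := by ext1; simp [LinearMap.comp_smul]
  comp_smul _ _ _ f c g := by ext1; simp [LinearMap.smul_comp]


/-- The operators by which the generators act. -/
abbrev opE (M : SuperRep) : Module.End Kq M.carrier := M.ρ (Uq.of UqGen.E)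
abbrev opF (M : SuperRep) : Module.End Kq M.carrier := M.ρ (Uq.of UqGen.F)
abbrev opQ (M : SuperRep) (h : ℤ × ℤ) : Module.End Kq M.carrier := M.ρ (Uq.of (UqGen.qh h))

theorem op_zero (M : SuperRep) : M.opQ 0 = 1 := by
  have := congrArg M.ρ (RingQuot.mkAlgHom_rel Kq UqRel.qh_zero)
  simpa [opQ, opE, opF, Uq.of] using this

theorem opQ_mul (M : SuperRep) (h h' : ℤ × ℤ) : M.opQ h * M.opQ h' = M.opQ (h + h') := by
  have := congrArg M.ρ (RingQuot.mkAlgHom_rel Kq (UqRel.qh_mul h h'))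
  simpa [opQ, opE, opF, Uq.of] using this

theorem opQ_E (M : SuperRep) (h : ℤ × ℤ) :
    M.opQ h * M.opE = q ^ pairAlpha h • (M.opE * M.opQ h) := by
  have := congrArg M.ρ (RingQuot.mkAlgHom_rel Kq (UqRel.qh_E h))
  simpa [opQ, opE, opF, Uq.of] using this

theorem opQ_F (M : SuperRep) (h : ℤ × ℤ) :
    M.opQ h * M.opF = q ^ (-pairAlpha h) • (M.opF * M.opQ h) := by
  have := congrArg M.ρ (RingQuot.mkAlgHom_rel Kq (UqRel.qh_F h))
  simpa [opQ, opE, opF, Uq.of] using this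

theorem opE_sq (M : SuperRep) : M.opE * M.opE = 0 := by
  have := congrArg M.ρ (RingQuot.mkAlgHom_rel Kq UqRel.E_sq)
  simpa [opQ, opE, opF, Uq.of] using this

theorem opF_sq (M : SuperRep) : M.opF * M.opF = 0 := by
  have := congrArg M.ρ (RingQuot.mkAlgHom_rel Kq UqRel.F_sq)
  simpa [opQ, opE, opF, Uq.of] using this

theorem op_EF (M : SuperRep) :
    M.opE * M.opF + M.opF * M.opE = (q - q⁻¹)⁻¹ • (M.opQ (1, 1) - M.opQ (-1, -1)) := by
  have := congrArg M.ρ (RingQuot.mkAlgHom_rel Kq UqRel.EF)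
  simpa [opQ, opE, opF, Uq.of] using this

/-- The action of the generators on `M ⊗ N` through the comultiplication
`Δ E = E ⊗ K⁻¹ + 1 ⊗ E`, `Δ F = F ⊗ 1 + K ⊗ F`, `Δ 𝐪^h = 𝐪^h ⊗ 𝐪^h` and the sign rule
`(x ⊗ y) (v ⊗ w) = (-1) ^ (|y| |v|) x v ⊗ y w`. -/
def tensorOp (M N : SuperRep) : UqGen → Module.End Kq (M.carrier ⊗[Kq] N.carrier)
  | UqGen.E => TensorProduct.map M.opE (N.opQ (-1, -1)) + TensorProduct.map M.σ N.opE
  | UqGen.F => TensorProduct.map M.opF 1 + TensorProduct.map (M.opQ (1, 1) * M.σ) N.opF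
  | UqGen.qh h => TensorProduct.map (M.opQ h) (N.opQ h)

theorem map_neg_left {A B A' B' : Type} [AddCommGroup A] [AddCommGroup B] [AddCommGroup A']
    [AddCommGroup B'] [Module Kq A] [Module Kq B] [Module Kq A'] [Module Kq B']
    (f : A →ₗ[Kq] A') (g : B →ₗ[Kq] B') :
    TensorProduct.map (-f) g = -TensorProduct.map f g := by
  ext; simp [TensorProduct.neg_tmul]

theorem map_neg_right {A B A' B' : Type} [AddCommGroup A] [AddCommGroup B] [AddCommGroup A']
    [AddCommGroup B'] [Module Kq A] [Module Kq B] [Module Kq A'] [Module Kq B']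
    (f : A →ₗ[Kq] A') (g : B →ₗ[Kq] B') :
    TensorProduct.map f (-g) = -TensorProduct.map f g := by
  ext; simp [TensorProduct.tmul_neg]

theorem tensorOp_rel (M N : SuperRep) (x y : FreeAlgebra Kq UqGen) (hxy : UqRel x y) :
    FreeAlgebra.lift Kq (tensorOp M N) x = FreeAlgebra.lift Kq (tensorOp M N) y := by
  have hK : ∀ (L : SuperRep), L.opQ (1, 1) * L.opE = L.opE * L.opQ (1, 1) := fun L => by
    simpa [pairAlpha] using L.opQ_E (1, 1)
  have hK' : ∀ (L : SuperRep), L.opQ (-1, -1) * L.opE = L.opE * L.opQ (-1, -1) := fun L => by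
    simpa [pairAlpha] using L.opQ_E (-1, -1)
  have hL : ∀ (L : SuperRep), L.opQ (1, 1) * L.opF = L.opF * L.opQ (1, 1) := fun L => by
    simpa [pairAlpha] using L.opQ_F (1, 1)
  have hL' : ∀ (L : SuperRep), L.opQ (-1, -1) * L.opF = L.opF * L.opQ (-1, -1) := fun L => by
    simpa [pairAlpha] using L.opQ_F (-1, -1)
  have hσF : ∀ (L : SuperRep), L.σ * L.opF = -(L.opF * L.σ) := fun L => L.F_odd
  have hσE : ∀ (L : SuperRep), L.σ * L.opE = -(L.opE * L.σ) := fun L => L.E_odd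
  have hσK : ∀ (L : SuperRep) h, L.σ * L.opQ h = L.opQ h * L.σ := fun L h => L.qh_even h
  have sub_map : ∀ (a a' : Module.End Kq M.carrier) (b : Module.End Kq N.carrier),
      TensorProduct.map (a - a') b = TensorProduct.map a b - TensorProduct.map a' b :=
    fun a a' b => by
      rw [sub_eq_add_neg, TensorProduct.map_add_left, map_neg_left, sub_eq_add_neg]
  have map_sub' : ∀ (a : Module.End Kq M.carrier) (b b' : Module.End Kq N.carrier),
      TensorProduct.map a (b - b') = TensorProduct.map a b - TensorProduct.map a b' :=
    fun a b b' => by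
      rw [sub_eq_add_neg, TensorProduct.map_add_right, map_neg_right, sub_eq_add_neg]
  cases hxy with
  | qh_zero => simp [tensorOp, op_zero]
  | qh_mul h h' => simp [tensorOp, ← TensorProduct.map_mul, opQ_mul]
  | qh_E h =>
    simp only [map_mul, map_smul, FreeAlgebra.lift_ι_apply, tensorOp, mul_add, add_mul,
      ← TensorProduct.map_mul, opQ_E, opQ_mul, TensorProduct.map_smul_left,
      TensorProduct.map_smul_right, smul_add, hσK, add_comm h]
  | qh_F h =>
    simp only [map_mul, map_smul, FreeAlgebra.lift_ι_apply, tensorOp, mul_add, add_mul,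
      ← TensorProduct.map_mul, opQ_F, TensorProduct.map_smul_left,
      TensorProduct.map_smul_right, smul_add, mul_one, one_mul, ← mul_assoc, opQ_mul]
    simp only [mul_assoc, hσK]
    simp only [← mul_assoc, opQ_mul, add_comm h]
  | E_sq =>
    simp only [map_mul, map_zero, FreeAlgebra.lift_ι_apply, tensorOp, mul_add, add_mul,
      ← TensorProduct.map_mul, opE_sq, hσE, hK', map_neg_left, TensorProduct.map_zero_left,
      TensorProduct.map_zero_right]
    abel
  | F_sq =>
    have h1 : M.opQ (1, 1) * M.σ * M.opF = -(M.opF * (M.opQ (1, 1) * M.σ)) := by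
      rw [mul_assoc, hσF, mul_neg, ← mul_assoc, hL, mul_assoc]
    simp only [map_mul, map_zero, FreeAlgebra.lift_ι_apply, tensorOp, mul_add, add_mul,
      ← TensorProduct.map_mul, opF_sq, h1, map_neg_left, TensorProduct.map_zero_left,
      TensorProduct.map_zero_right, mul_one, one_mul]
    abel
  | EF =>
    have h1 : M.σ * (M.opQ (1, 1) * M.σ) = M.opQ (1, 1) := by
      rw [← mul_assoc, hσK, mul_assoc, M.σ_sq, mul_one]
    have h2 : M.opQ (1, 1) * M.σ * M.σ = M.opQ (1, 1) := by
      rw [mul_assoc, M.σ_sq, mul_one]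
    have h3 : M.opQ (1, 1) * M.σ * M.opE = -(M.opE * (M.opQ (1, 1) * M.σ)) := by
      rw [mul_assoc, hσE, mul_neg, ← mul_assoc, hK, mul_assoc]
    have e1 := M.op_EF
    have e2 := N.op_EF
    have e3 : TensorProduct.map (M.opE * M.opF) (N.opQ (-1, -1)) +
        TensorProduct.map (M.opF * M.opE) (N.opQ (-1, -1)) =
        (q - q⁻¹)⁻¹ • (TensorProduct.map (M.opQ (1, 1)) (N.opQ (-1, -1)) -
          TensorProduct.map (M.opQ (-1, -1)) (N.opQ (-1, -1))) := by
      rw [← TensorProduct.map_add_left, e1, TensorProduct.map_smul_left, sub_map]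
    have e4 : TensorProduct.map (M.opQ (1, 1)) (N.opE * N.opF) +
        TensorProduct.map (M.opQ (1, 1)) (N.opF * N.opE) =
        (q - q⁻¹)⁻¹ • (TensorProduct.map (M.opQ (1, 1)) (N.opQ (1, 1)) -
          TensorProduct.map (M.opQ (1, 1)) (N.opQ (-1, -1))) := by
      rw [← TensorProduct.map_add_right, e2, TensorProduct.map_smul_right, map_sub']
    simp only [map_mul, map_add, map_sub, map_smul, FreeAlgebra.lift_ι_apply, tensorOp, mul_add,
      add_mul, ← TensorProduct.map_mul, h1, h2, h3, hσF, hL', map_neg_left, mul_one, one_mul]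
    rw [smul_sub] at e3 e4 ⊢
    have e5 := congrArg₂ (fun u v => u + v) e3 e4
    simp only [sub_add_sub_cancel'] at e5
    rw [← e5]
    abel

/-- The tensor product of two `U_q`-supermodules. -/
def tensor (M N : SuperRep) : SuperRep where
  carrier := M.carrier ⊗[Kq] N.carrier
  σ := TensorProduct.map M.σ N.σ
  σ_sq := by rw [← TensorProduct.map_mul, M.σ_sq, N.σ_sq, TensorProduct.map_one]
  ρ := Uq.lift (tensorOp M N) (tensorOp_rel M N)
  E_odd := by
    have h1 : M.σ * M.opE = -(M.opE * M.σ) := M.E_odd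
    have h2 : N.σ * N.opE = -(N.opE * N.σ) := N.E_odd
    have h3 : N.σ * N.opQ (-1, -1) = N.opQ (-1, -1) * N.σ := N.qh_even _
    rw [Uq.lift_of, tensorOp, mul_add, add_mul]
    simp only [← TensorProduct.map_mul, h1, h2, h3, map_neg_left, map_neg_right, neg_add]
  F_odd := by
    have h1 : M.σ * M.opF = -(M.opF * M.σ) := M.F_odd
    have h2 : N.σ * N.opF = -(N.opF * N.σ) := N.F_odd
    have h3 : M.σ * M.opQ (1, 1) = M.opQ (1, 1) * M.σ := M.qh_even _
    rw [Uq.lift_of, tensorOp, mul_add, add_mul]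
    simp only [← TensorProduct.map_mul, h1, h2, h3, map_neg_left, map_neg_right, neg_add,
      ← mul_assoc, mul_one, one_mul]
  qh_even h := by
    have h1 : M.σ * M.opQ h = M.opQ h * M.σ := M.qh_even _
    have h2 : N.σ * N.opQ h = N.opQ h * N.σ := N.qh_even _
    rw [Uq.lift_of, tensorOp]
    simp only [← TensorProduct.map_mul, h1, h2]

/-- The trivial representation, with `U_q` acting through the counit. -/
def unit : SuperRep where
  carrier := Kq
  σ := 1
  σ_sq := one_mul 1
  ρ := Uq.lift (fun g => match g with
    | UqGen.E => 0
    | UqGen.F => 0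
    | UqGen.qh _ => 1) (by
      intro x y hxy
      cases hxy <;> simp [pairAlpha])
  E_odd := by simp
  F_odd := by simp
  qh_even h := by simp

theorem tensor_σ (M N : SuperRep) : (tensor M N).σ = TensorProduct.map M.σ N.σ := rfl

theorem tensor_ρ (M N : SuperRep) (g : UqGen) :
    (tensor M N).ρ (Uq.of g) = tensorOp M N g := Uq.lift_of _ _ g

theorem unit_ρ (g : UqGen) : unit.ρ (Uq.of g) =
    (match g with | UqGen.E => 0 | UqGen.F => 0 | UqGen.qh _ => 1) := Uq.lift_of _ _ g

theorem lin_σ {M N : SuperRep} (f : M ⟶ N) (v : M.carrier) :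
    toLin f (M.σ v) = N.σ (toLin f v) := LinearMap.congr_fun (Hom.comm_σ f) v

theorem lin_ρ {M N : SuperRep} (f : M ⟶ N) (x : Uq) (v : M.carrier) :
    toLin f (M.ρ x v) = N.ρ x (toLin f v) := LinearMap.congr_fun (Hom.comm_ρ f x) v

theorem tensorOp_natural {M N M' N' : SuperRep} (f : M ⟶ N) (g : M' ⟶ N') (t : UqGen) :
    TensorProduct.map (toLin f) (toLin g) ∘ₗ tensorOp M M' t =
      tensorOp N N' t ∘ₗ TensorProduct.map (toLin f) (toLin g) :=
  TensorProduct.ext' fun v w => by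
    cases t <;> simp [tensorOp, lin_σ, lin_ρ]

/-- The tensor product of two (even) morphisms. -/
def tensorMap {M N M' N' : SuperRep} (f : M ⟶ N) (g : M' ⟶ N') : tensor M M' ⟶ tensor N N' :=
  Hom.mk (M := tensor M M') (N := tensor N N') (TensorProduct.map (toLin f) (toLin g))
    (by
      have h : TensorProduct.map (toLin f) (toLin g) ∘ₗ TensorProduct.map M.σ M'.σ =
          TensorProduct.map N.σ N'.σ ∘ₗ TensorProduct.map (toLin f) (toLin g) :=
        TensorProduct.ext' fun v w => by simp [lin_σ]
      exact h)
    (comm_of_gens (M := tensor M M') (N := tensor N N') _ fun t => by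
      rw [tensor_ρ, tensor_ρ]
      exact tensorOp_natural f g t)

/-- A linear isomorphism that intertwines the actions gives an isomorphism of supermodules. -/
def mkIso {M N : SuperRep} (e : M.carrier ≃ₗ[Kq] N.carrier)
    (hσ : e.toLinearMap ∘ₗ M.σ = N.σ ∘ₗ e.toLinearMap)
    (hρ : ∀ g, e.toLinearMap ∘ₗ M.ρ (Uq.of g) = N.ρ (Uq.of g) ∘ₗ e.toLinearMap) : M ≅ N where
  hom := ⟨e.toLinearMap, hσ, comm_of_gens _ hρ⟩
  inv := ⟨e.symm.toLinearMap,
    LinearMap.ext fun v => e.injective (by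
      have := LinearMap.congr_fun hσ (e.symm v)
      simpa using this.symm),
    fun x => LinearMap.ext fun v => e.injective (by
      have := LinearMap.congr_fun (comm_of_gens _ hρ x) (e.symm v)
      simpa using this.symm)⟩
  hom_inv_id := Hom.ext (LinearMap.ext fun v => e.symm_apply_apply v)
  inv_hom_id := Hom.ext (LinearMap.ext fun v => e.apply_symm_apply v)

/-- The associativity isomorphism `(u ⊗ v) ⊗ w ↦ u ⊗ (v ⊗ w)`. -/
def assocIso (M N P : SuperRep) : tensor (tensor M N) P ≅ tensor M (tensor N P) :=
  mkIso (M := tensor (tensor M N) P) (N := tensor M (tensor N P))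
    (TensorProduct.assoc Kq M.carrier N.carrier P.carrier)
    (by
      have h : (TensorProduct.assoc Kq M.carrier N.carrier P.carrier).toLinearMap ∘ₗ
          TensorProduct.map (TensorProduct.map M.σ N.σ) P.σ =
          TensorProduct.map M.σ (TensorProduct.map N.σ P.σ) ∘ₗ
          (TensorProduct.assoc Kq M.carrier N.carrier P.carrier).toLinearMap :=
        TensorProduct.ext_threefold fun a b c => by simp
      exact h)
    (by
      have hE : (TensorProduct.assoc Kq M.carrier N.carrier P.carrier).toLinearMap ∘ₗ
          (TensorProduct.map (tensorOp M N UqGen.E) (P.opQ (-1, -1)) +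
            TensorProduct.map (TensorProduct.map M.σ N.σ) P.opE) =
          (TensorProduct.map M.opE (tensorOp N P (UqGen.qh (-1, -1))) +
            TensorProduct.map M.σ (tensorOp N P UqGen.E)) ∘ₗ
          (TensorProduct.assoc Kq M.carrier N.carrier P.carrier).toLinearMap :=
        TensorProduct.ext_threefold fun a b c => by
          simp [tensorOp, TensorProduct.add_tmul, TensorProduct.tmul_add, add_assoc]
      have hF : (TensorProduct.assoc Kq M.carrier N.carrier P.carrier).toLinearMap ∘ₗ
          (TensorProduct.map (tensorOp M N UqGen.F) 1 +
            TensorProduct.map (tensorOp M N (UqGen.qh (1, 1)) * TensorProduct.map M.σ N.σ)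
              P.opF) =
          (TensorProduct.map M.opF 1 +
            TensorProduct.map (M.opQ (1, 1) * M.σ) (tensorOp N P UqGen.F)) ∘ₗ
          (TensorProduct.assoc Kq M.carrier N.carrier P.carrier).toLinearMap :=
        TensorProduct.ext_threefold fun a b c => by
          simp [tensorOp, TensorProduct.add_tmul, TensorProduct.tmul_add, add_assoc]
      have hq : ∀ h, (TensorProduct.assoc Kq M.carrier N.carrier P.carrier).toLinearMap ∘ₗ
          TensorProduct.map (tensorOp M N (UqGen.qh h)) (P.opQ h) =
          TensorProduct.map (M.opQ h) (tensorOp N P (UqGen.qh h)) ∘ₗ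
          (TensorProduct.assoc Kq M.carrier N.carrier P.carrier).toLinearMap := fun h =>
        TensorProduct.ext_threefold fun a b c => by simp [tensorOp]
      simp only [← tensor_ρ] at hE hF hq
      intro t
      rw [tensor_ρ, tensor_ρ]
      cases t with
      | E => exact hE
      | F => exact hF
      | qh h => exact hq h)

/-- The left unit isomorphism `c ⊗ v ↦ c v`. -/
def leftIso (M : SuperRep) : tensor unit M ≅ M :=
  mkIso (M := tensor unit M) (TensorProduct.lid Kq M.carrier)
    (by
      have h : (TensorProduct.lid Kq M.carrier).toLinearMap ∘ₗ
          TensorProduct.map (1 : Module.End Kq Kq) M.σ =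
          M.σ ∘ₗ (TensorProduct.lid Kq M.carrier).toLinearMap :=
        TensorProduct.ext' fun a b => by simp
      exact h)
    (by
      intro t
      rw [tensor_ρ]
      cases t with
      | E =>
        have h : (TensorProduct.lid Kq M.carrier).toLinearMap ∘ₗ
            (TensorProduct.map (0 : Module.End Kq Kq) (M.opQ (-1, -1)) +
              TensorProduct.map (1 : Module.End Kq Kq) M.opE) =
            M.opE ∘ₗ (TensorProduct.lid Kq M.carrier).toLinearMap :=
          TensorProduct.ext' fun a b => by simp
        rw [tensorOp, show unit.opE = 0 from unit_ρ UqGen.E]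
        exact h
      | F =>
        have h : (TensorProduct.lid Kq M.carrier).toLinearMap ∘ₗ
            (TensorProduct.map (0 : Module.End Kq Kq) (1 : Module.End Kq M.carrier) +
              TensorProduct.map ((1 : Module.End Kq Kq) * 1) M.opF) =
            M.opF ∘ₗ (TensorProduct.lid Kq M.carrier).toLinearMap :=
          TensorProduct.ext' fun a b => by simp
        rw [tensorOp, show unit.opF = 0 from unit_ρ UqGen.F,
          show unit.opQ (1, 1) = 1 from unit_ρ (UqGen.qh (1, 1))]
        exact h
      | qh k =>
        have h : (TensorProduct.lid Kq M.carrier).toLinearMap ∘ₗ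
            TensorProduct.map (1 : Module.End Kq Kq) (M.opQ k) =
            M.opQ k ∘ₗ (TensorProduct.lid Kq M.carrier).toLinearMap :=
          TensorProduct.ext' fun a b => by simp
        rw [tensorOp, show unit.opQ k = 1 from unit_ρ (UqGen.qh k)]
        exact h)

/-- The right unit isomorphism `v ⊗ c ↦ c v`. -/
def rightIso (M : SuperRep) : tensor M unit ≅ M :=
  mkIso (M := tensor M unit) (TensorProduct.rid Kq M.carrier)
    (by
      have h : (TensorProduct.rid Kq M.carrier).toLinearMap ∘ₗ
          TensorProduct.map M.σ (1 : Module.End Kq Kq) =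
          M.σ ∘ₗ (TensorProduct.rid Kq M.carrier).toLinearMap :=
        TensorProduct.ext' fun a b => by simp
      exact h)
    (by
      intro t
      rw [tensor_ρ]
      cases t with
      | E =>
        have h : (TensorProduct.rid Kq M.carrier).toLinearMap ∘ₗ
            (TensorProduct.map M.opE (1 : Module.End Kq Kq) +
              TensorProduct.map M.σ (0 : Module.End Kq Kq)) =
            M.opE ∘ₗ (TensorProduct.rid Kq M.carrier).toLinearMap :=
          TensorProduct.ext' fun a b => by simp
        rw [tensorOp, show unit.opE = 0 from unit_ρ UqGen.E,
          show unit.opQ (-1, -1) = 1 from unit_ρ (UqGen.qh (-1, -1))]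
        exact h
      | F =>
        have h : (TensorProduct.rid Kq M.carrier).toLinearMap ∘ₗ
            (TensorProduct.map M.opF (1 : Module.End Kq Kq) +
              TensorProduct.map (M.opQ (1, 1) * M.σ) (0 : Module.End Kq Kq)) =
            M.opF ∘ₗ (TensorProduct.rid Kq M.carrier).toLinearMap :=
          TensorProduct.ext' fun a b => by simp
        rw [tensorOp, show unit.opF = 0 from unit_ρ UqGen.F]
        exact h
      | qh k =>
        have h : (TensorProduct.rid Kq M.carrier).toLinearMap ∘ₗ
            TensorProduct.map (M.opQ k) (1 : Module.End Kq Kq) =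
            M.opQ k ∘ₗ (TensorProduct.rid Kq M.carrier).toLinearMap :=
          TensorProduct.ext' fun a b => by simp
        rw [tensorOp, show unit.opQ k = 1 from unit_ρ (UqGen.qh k)]
        exact h)

instance : MonoidalCategoryStruct SuperRep where
  tensorObj := tensor
  tensorHom := tensorMap
  whiskerLeft M _ _ f := tensorMap (𝟙 M) f
  whiskerRight f M := tensorMap f (𝟙 M)
  tensorUnit := unit
  associator := assocIso
  leftUnitor := leftIso
  rightUnitor := rightIso

instance : MonoidalCategory SuperRep := MonoidalCategory.ofTensorHom
  (id_tensorHom_id := fun M N =>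
    hom_ext (TensorProduct.map_id (R := Kq) (M := M.carrier) (N := N.carrier)))
  (tensorHom_comp_tensorHom := fun f g h k =>
    hom_ext (TensorProduct.map_comp (toLin h) (toLin k) (toLin f) (toLin g)).symm)
  (associator_naturality := fun {X₁ X₂ X₃ Y₁ Y₂ Y₃} f g h =>
    hom_ext (TensorProduct.ext_threefold (R := Kq) (M := X₁.carrier) (N := X₂.carrier)
      (P := X₃.carrier) fun a b c => rfl))
  (leftUnitor_naturality := fun {X Y} f =>
    hom_ext (TensorProduct.ext' (R := Kq) (M := Kq) (N := X.carrier) fun a b =>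
      ((toLin f).map_smul a b).symm))
  (rightUnitor_naturality := fun {X Y} f =>
    hom_ext (TensorProduct.ext' (R := Kq) (M := X.carrier) (N := Kq) fun a b =>
      ((toLin f).map_smul b a).symm))
  (pentagon := fun M N P Q =>
    hom_ext (TensorProduct.ext_fourfold (R := Kq) (M := M.carrier) (N := N.carrier)
      (P := P.carrier) (Q := Q.carrier) fun a b c d => rfl))
  (triangle := fun M N =>
    hom_ext (TensorProduct.ext_threefold (R := Kq) (M := M.carrier) (N := Kq)
      (P := N.carrier) fun a b c => (TensorProduct.smul_tmul b a c).symm))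

end SuperRep

/-! ### The representations `V(a)` and the category `Rep` -/

theorem q_ne_zero : q ≠ 0 := RatFunc.X_ne_zero

/-- The basis `v₀`, `v₁` of the underlying space of `V(a)`. -/
def vBasis : Module.Basis (Fin 2) Kq (Fin 2 → Kq) := Pi.basisFun Kq (Fin 2)

/-- The linear map out of `V(a)` with the values `x` on `v₀` and `y` on `v₁`. -/
def vMap {W : Type} [AddCommGroup W] [Module Kq W] (x y : W) : (Fin 2 → Kq) →ₗ[Kq] W :=
  vBasis.constr Kq ![x, y]

@[simp] theorem vMap_zero {W : Type} [AddCommGroup W] [Module Kq W] (x y : W) :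
    vMap x y (vBasis 0) = x := by simp [vMap]

@[simp] theorem vMap_one {W : Type} [AddCommGroup W] [Module Kq W] (x y : W) :
    vMap x y (vBasis 1) = y := by simp [vMap]

theorem vMap_ext {W : Type} [AddCommGroup W] [Module Kq W] {f g : (Fin 2 → Kq) →ₗ[Kq] W}
    (h0 : f (vBasis 0) = g (vBasis 0)) (h1 : f (vBasis 1) = g (vBasis 1)) : f = g :=
  vBasis.ext fun i => by fin_cases i <;> assumption

/-- The action of the generators on `V(a)`: `E v₀ = 0`, `E v₁ = [a] v₀`, `F v₀ = v₁`, `F v₁ = 0`,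
and `𝐪^h` acts on `v₀`, `v₁` through the weights `a ε₁` and `a ε₁ - α`. -/
def vOp (a : ℕ) : UqGen → Module.End Kq (Fin 2 → Kq)
  | UqGen.E => vMap 0 (qInt a • vBasis 0)
  | UqGen.F => vMap (vBasis 1) 0
  | UqGen.qh h =>
      vMap (q ^ (a * h.1) • vBasis 0) (q ^ (a * h.1 - pairAlpha h) • vBasis 1)

theorem vOp_rel (a : ℕ) (x y : FreeAlgebra Kq UqGen) (hxy : UqRel x y) :
    FreeAlgebra.lift Kq (vOp a) x = FreeAlgebra.lift Kq (vOp a) y := by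
  have hq := q_ne_zero
  cases hxy with
  | qh_zero => exact vMap_ext (by simp [vOp]) (by simp [vOp, pairAlpha])
  | qh_mul h h' =>
    refine vMap_ext ?_ ?_
    · simp [vOp, smul_smul, ← zpow_add₀ hq, mul_add, add_comm]
    · simp only [map_mul, FreeAlgebra.lift_ι_apply, vOp, Module.End.mul_apply, vMap_one, map_smul,
        smul_smul, ← zpow_add₀ hq, pairAlpha, Prod.fst_add, Prod.snd_add]
      congr 2
      ring
  | qh_E h =>
    refine vMap_ext (by simp [vOp]) ?_
    simp only [map_mul, map_smul, FreeAlgebra.lift_ι_apply, vOp, Module.End.mul_apply, vMap_one,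
      vMap_zero, LinearMap.smul_apply, smul_smul]
    rw [← mul_assoc, ← zpow_add₀ hq, mul_comm]
    congr 3
    ring
  | qh_F h =>
    refine vMap_ext ?_ (by simp [vOp])
    simp only [map_mul, map_smul, FreeAlgebra.lift_ι_apply, vOp, Module.End.mul_apply, vMap_one,
      vMap_zero, LinearMap.smul_apply, smul_smul]
    rw [← zpow_add₀ hq]
    congr 2
    ring
  | E_sq => exact vMap_ext (by simp [vOp]) (by simp [vOp])
  | F_sq => exact vMap_ext (by simp [vOp]) (by simp [vOp])
  | EF =>
    refine vMap_ext ?_ ?_ <;>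
    · simp [vOp, pairAlpha, qInt, ← sub_smul, smul_smul, div_eq_inv_mul]

/-- The representation `V(a)` with highest weight `a ε₁`, for `a > 0`, with basis `v₀` in
degree `0` and `v₁` in degree `1`. -/
def V (a : ℕ+) : SuperRep where
  carrier := Fin 2 → Kq
  σ := vMap (vBasis 0) (-vBasis 1)
  σ_sq := vMap_ext (by simp) (by simp)
  ρ := Uq.lift (vOp a) (vOp_rel a)
  E_odd := by
    rw [Uq.lift_of]
    exact vMap_ext (by simp [vOp]) (by simp [vOp])
  F_odd := by
    rw [Uq.lift_of]
    exact vMap_ext (by simp [vOp]) (by simp [vOp])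
  qh_even h := by
    rw [Uq.lift_of]
    exact vMap_ext (by simp [vOp]) (by simp [vOp])

/-- The objects of the monoidal subcategory generated by the `V(a)`, `a ∈ ℕ`; here `V(0)` is the
trivial representation, the unit object. -/
inductive IsRepObj : ObjectProperty SuperRep
  | unit : IsRepObj (𝟙_ SuperRep)
  | V (a : ℕ+) : IsRepObj (V a)
  | tensor (M N : SuperRep) : IsRepObj M → IsRepObj N → IsRepObj (M ⊗ N)

instance : IsRepObj.IsMonoidal where
  prop_unit := IsRepObj.unit
  prop_tensor M N hM hN := IsRepObj.tensor M N hM hN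

/-- The category `Rep`: the full monoidal subcategory of the category of `U_q`-supermodules that
is generated by the `V(a)`. -/
abbrev Rep : Type 1 := IsRepObj.FullSubcategory

namespace Rep

/-- The linear map underlying a morphism of `Rep`. -/
def toLin {M N : Rep} (f : M ⟶ N) : M.obj.carrier →ₗ[Kq] N.obj.carrier := SuperRep.toLin f.hom

/-- `V(a)` as an object of `Rep`. -/
def ofLabel (a : ℕ+) : Rep := ⟨V a, IsRepObj.V a⟩

/-- `V(𝐚) = V(a₁) ⊗ ⋯ ⊗ V(a_ℓ)`, the trivial representation for the empty sequence. -/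
def ofSeq : List ℕ+ → Rep
  | [] => 𝟙_ Rep
  | [a] => ofLabel a
  | a :: b :: l => ofLabel a ⊗ ofSeq (b :: l)

/-- The canonical identification `V(𝐚) ⊗ V(𝐛) ≅ V(𝐚𝐛)`, with `𝐚𝐛` the concatenation, which is
`(u₁ ⊗ ⋯ ⊗ u_ℓ) ⊗ (w₁ ⊗ ⋯ ⊗ w_m) ↦ u₁ ⊗ ⋯ ⊗ u_ℓ ⊗ w₁ ⊗ ⋯ ⊗ w_m`. -/
def concatIso : ∀ l m : List ℕ+, ofSeq l ⊗ ofSeq m ≅ ofSeq (l ++ m)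
  | [], m => λ_ (ofSeq m)
  | [a], [] => ρ_ (ofLabel a)
  | [a], b :: m => Iso.refl (ofLabel a ⊗ ofSeq (b :: m))
  | a :: b :: l, m =>
      α_ (ofLabel a) (ofSeq (b :: l)) (ofSeq m) ≪≫
        whiskerLeftIso (ofLabel a) (concatIso (b :: l) m)

end Rep

/-- The projection `Φ_{a,b} : V(a) ⊗ V(b) → V(a+b)`. -/
def phiMerge (a b : ℕ) : (Fin 2 → Kq) ⊗[Kq] (Fin 2 → Kq) →ₗ[Kq] (Fin 2 → Kq) :=
  (vBasis.tensorProduct vBasis).constr Kq fun i => match i with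
    | (1, 1) => 0
    | (1, 0) => (q ^ (-(b : ℤ)) * qBinom (a + b - 1) b) • vBasis 1
    | (0, 1) => qBinom (a + b - 1) a • vBasis 1
    | (0, 0) => qBinom (a + b) a • vBasis 0

/-- The embedding `Φ^{a,b} : V(a+b) → V(a) ⊗ V(b)`. -/
def phiSplit (a : ℕ) : (Fin 2 → Kq) →ₗ[Kq] (Fin 2 → Kq) ⊗[Kq] (Fin 2 → Kq) :=
  vMap (vBasis 0 ⊗ₜ vBasis 0) (vBasis 1 ⊗ₜ vBasis 0 + q ^ (a : ℤ) • (vBasis 0 ⊗ₜ vBasis 1))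

/-! ### The category `Web` -/

/-- Linear combinations of web diagrams, read from bottom to top, as expressions. The source and
the target are the sequences of labels on the bottom and on the top line. A web diagram is built
from vertical strands and the two kinds of trivalent vertices by vertical composition (`comp f g`
puts `g` on top of `f`) and by horizontal juxtaposition (`tensor f g` puts `g` to the right
of `f`). -/
inductive WebExpr : List ℕ+ → List ℕ+ → Type
  | id (a : List ℕ+) : WebExpr a a
  | comp {a b c : List ℕ+} : WebExpr a b → WebExpr b c → WebExpr a c
  | tensor {a b c d : List ℕ+} : WebExpr a b → WebExpr c d → WebExpr (a ++ c) (b ++ d)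
  | merge (x y : ℕ+) : WebExpr [x, y] [x + y]
  | split (x y : ℕ+) : WebExpr [x + y] [x, y]
  | zero (a b : List ℕ+) : WebExpr a b
  | add {a b : List ℕ+} : WebExpr a b → WebExpr a b → WebExpr a b
  | smul {a b : List ℕ+} : Kq → WebExpr a b → WebExpr a b

namespace WebExpr

/-- Vertical strands between two descriptions of the same sequence. -/
def strands {a b : List ℕ+} (h : a = b) : WebExpr a b := h ▸ WebExpr.id a

/-- The web from `(1,1)` to `(1,1)` in which two strands merge and then split again. -/
def dumbbell : WebExpr [1, 1] [1, 1] := comp (merge 1 1) (split 1 1)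

/-- The `dumbbell` on the first two, respectively the last two, of three strands. -/
def dumbbell₁ : WebExpr [1, 1, 1] [1, 1, 1] := tensor dumbbell (id [1])
def dumbbell₂ : WebExpr [1, 1, 1] [1, 1, 1] := tensor (id [1]) dumbbell

/-- A vertex next to a vertical strand. -/
def mergeLeft (x y z : ℕ+) : WebExpr [x, y, z] [x + y, z] := tensor (merge x y) (id [z])
def mergeRight (x y z : ℕ+) : WebExpr [x, y, z] [x, y + z] := tensor (id [x]) (merge y z)
def splitLeft (x y z : ℕ+) : WebExpr [x + y, z] [x, y, z] := tensor (split x y) (id [z])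
def splitRight (x y z : ℕ+) : WebExpr [x, y + z] [x, y, z] := tensor (id [x]) (split y z)

/-- The two descriptions of the sequence `(x+y+z)`. -/
theorem assoc_label (x y z : ℕ+) : [x + y + z] = [x + (y + z)] := by rw [add_assoc]

/-- Equality of linear combinations of web diagrams in `Web`: the least congruence for which
hom-sets are vector spaces, both compositions are bilinear, diagrams are considered up to isotopy
(the rules of a strict monoidal category), and the web relations hold. -/
inductive Rel : ∀ {a b : List ℕ+}, WebExpr a b → WebExpr a b → Prop
  | refl {a b} (f : WebExpr a b) : Rel f f
  | symm {a b} {f g : WebExpr a b} : Rel f g → Rel g f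
  | trans {a b} {f g h : WebExpr a b} : Rel f g → Rel g h → Rel f h
  | comp_congr {a b c} {f f' : WebExpr a b} {g g' : WebExpr b c} :
      Rel f f' → Rel g g' → Rel (comp f g) (comp f' g')
  | tensor_congr {a b c d} {f f' : WebExpr a b} {g g' : WebExpr c d} :
      Rel f f' → Rel g g' → Rel (tensor f g) (tensor f' g')
  | add_congr {a b} {f f' g g' : WebExpr a b} :
      Rel f f' → Rel g g' → Rel (add f g) (add f' g')
  | smul_congr {a b} (r : Kq) {f f' : WebExpr a b} : Rel f f' → Rel (smul r f) (smul r f')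
  -- vector space structure
  | add_assoc {a b} (f g h : WebExpr a b) : Rel (add (add f g) h) (add f (add g h))
  | add_comm {a b} (f g : WebExpr a b) : Rel (add f g) (add g f)
  | zero_add {a b} (f : WebExpr a b) : Rel (add (zero a b) f) f
  | zero_smul {a b} (f : WebExpr a b) : Rel (smul 0 f) (zero a b)
  | one_smul {a b} (f : WebExpr a b) : Rel (smul 1 f) f
  | mul_smul {a b} (r s : Kq) (f : WebExpr a b) : Rel (smul (r * s) f) (smul r (smul s f))
  | add_smul {a b} (r s : Kq) (f : WebExpr a b) :
      Rel (smul (r + s) f) (add (smul r f) (smul s f))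
  | smul_add {a b} (r : Kq) (f g : WebExpr a b) :
      Rel (smul r (add f g)) (add (smul r f) (smul r g))
  -- bilinearity of the two compositions
  | add_comp {a b c} (f f' : WebExpr a b) (g : WebExpr b c) :
      Rel (comp (add f f') g) (add (comp f g) (comp f' g))
  | comp_add {a b c} (f : WebExpr a b) (g g' : WebExpr b c) :
      Rel (comp f (add g g')) (add (comp f g) (comp f g'))
  | smul_comp {a b c} (r : Kq) (f : WebExpr a b) (g : WebExpr b c) :
      Rel (comp (smul r f) g) (smul r (comp f g))
  | comp_smul {a b c} (r : Kq) (f : WebExpr a b) (g : WebExpr b c) :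
      Rel (comp f (smul r g)) (smul r (comp f g))
  | add_tensor {a b c d} (f f' : WebExpr a b) (g : WebExpr c d) :
      Rel (tensor (add f f') g) (add (tensor f g) (tensor f' g))
  | tensor_add {a b c d} (f : WebExpr a b) (g g' : WebExpr c d) :
      Rel (tensor f (add g g')) (add (tensor f g) (tensor f g'))
  | smul_tensor {a b c d} (r : Kq) (f : WebExpr a b) (g : WebExpr c d) :
      Rel (tensor (smul r f) g) (smul r (tensor f g))
  | tensor_smul {a b c d} (r : Kq) (f : WebExpr a b) (g : WebExpr c d) :
      Rel (tensor f (smul r g)) (smul r (tensor f g))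
  -- isotopy
  | id_comp {a b} (f : WebExpr a b) : Rel (comp (id a) f) f
  | comp_id {a b} (f : WebExpr a b) : Rel (comp f (id b)) f
  | comp_assoc {a b c d} (f : WebExpr a b) (g : WebExpr b c) (h : WebExpr c d) :
      Rel (comp (comp f g) h) (comp f (comp g h))
  | id_tensor_id (a b : List ℕ+) : Rel (tensor (id a) (id b)) (id (a ++ b))
  | interchange {a b c a' b' c'} (f : WebExpr a b) (g : WebExpr b c) (f' : WebExpr a' b')
      (g' : WebExpr b' c') :
      Rel (tensor (comp f g) (comp f' g')) (comp (tensor f f') (tensor g g'))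
  | tensor_assoc {a b c a' b' c'} (f : WebExpr a a') (g : WebExpr b b') (h : WebExpr c c') :
      Rel (comp (tensor (tensor f g) h) (strands (List.append_assoc a' b' c')))
        (comp (strands (List.append_assoc a b c)) (tensor f (tensor g h)))
  | nil_tensor {a b} (f : WebExpr a b) :
      Rel (comp (tensor (id []) f) (strands (List.nil_append b)))
        (comp (strands (List.nil_append a)) f)
  | tensor_nil {a b} (f : WebExpr a b) :
      Rel (comp (tensor f (id [])) (strands (List.append_nil b)))
        (comp (strands (List.append_nil a)) f)
  -- the web relations
  | digon (x y : ℕ+) :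
      Rel (comp (split x y) (merge x y)) (smul (qBinom (x + y) x) (id [x + y]))
  | merge_assoc (x y z : ℕ+) :
      Rel (comp (comp (mergeLeft x y z) (merge (x + y) z)) (strands (assoc_label x y z)))
        (comp (mergeRight x y z) (merge x (y + z)))
  | split_assoc (x y z : ℕ+) :
      Rel (comp (split (x + y) z) (splitLeft x y z))
        (comp (strands (assoc_label x y z)) (comp (split x (y + z)) (splitRight x y z)))
  | braid :
      Rel (add (comp (comp dumbbell₁ dumbbell₂) dumbbell₁) dumbbell₂)
        (add (comp (comp dumbbell₂ dumbbell₁) dumbbell₂) dumbbell₁)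

/-- The equivalence relation `Rel` on the expressions from `a` to `b`. -/
instance setoid (a b : List ℕ+) : Setoid (WebExpr a b) where
  r := Rel
  iseqv := ⟨Rel.refl, Rel.symm, Rel.trans⟩

theorem strands_comp {a b c : List ℕ+} (h : a = b) (h' : b = c) :
    Rel (comp (strands h) (strands h')) (strands (h.trans h')) := by
  subst h h'; exact Rel.id_comp _

theorem strands_tensor {a b c d : List ℕ+} (h : a = b) (h' : c = d) :
    Rel (tensor (strands h) (strands h')) (strands (congrArg₂ (· ++ ·) h h')) := by
  subst h h'; exact Rel.id_tensor_id _ _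

end WebExpr

/-- The objects of `Web` are the finite sequences of positive integers. -/
@[ext] structure Web : Type where
  labels : List ℕ+

namespace Web

/-- Morphisms of `Web`: linear combinations of web diagrams modulo the relations. -/
def Hom (a b : Web) : Type := Quotient (WebExpr.setoid a.labels b.labels)

instance : Category Web where
  Hom := Hom
  id a := ⟦WebExpr.id a.labels⟧
  comp := Quotient.map₂ WebExpr.comp fun _ _ h _ _ h' => WebExpr.Rel.comp_congr h h'
  id_comp := by rintro a b ⟨f⟩; exact Quotient.sound (WebExpr.Rel.id_comp f)
  comp_id := by rintro a b ⟨f⟩; exact Quotient.sound (WebExpr.Rel.comp_id f)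
  assoc := by rintro a b c d ⟨f⟩ ⟨g⟩ ⟨h⟩; exact Quotient.sound (WebExpr.Rel.comp_assoc f g h)

/-- The morphism of `Web` represented by an expression. -/
def ofExpr {a b : List ℕ+} (f : WebExpr a b) : (⟨a⟩ : Web) ⟶ ⟨b⟩ :=
  (Quotient.mk (WebExpr.setoid a b) f : Hom ⟨a⟩ ⟨b⟩)

theorem ofExpr_eq {a b : List ℕ+} {f g : WebExpr a b} (h : WebExpr.Rel f g) : ofExpr f = ofExpr g :=
  Quotient.sound (s := WebExpr.setoid a b) h

theorem ofExpr_surjective {a b : Web} (f : a ⟶ b) : ∃ e : WebExpr a.labels b.labels, ofExpr e = f :=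
  Quotient.exists_rep (s := WebExpr.setoid a.labels b.labels) f

instance (a b : Web) : Zero (a ⟶ b) := ⟨ofExpr (WebExpr.zero a.labels b.labels)⟩

instance (a b : Web) : Add (a ⟶ b) :=
  ⟨Quotient.map₂ WebExpr.add fun _ _ h _ _ h' => WebExpr.Rel.add_congr h h'⟩

instance (a b : Web) : Neg (a ⟶ b) :=
  ⟨Quotient.map (WebExpr.smul (-1)) fun _ _ h => WebExpr.Rel.smul_congr (-1) h⟩

instance (a b : Web) : SMul Kq (a ⟶ b) :=
  ⟨fun r => Quotient.map (WebExpr.smul r) fun _ _ h => WebExpr.Rel.smul_congr r h⟩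

theorem hom_zero_add {a b : Web} (f : a ⟶ b) : 0 + f = f := by
  obtain ⟨f, rfl⟩ := ofExpr_surjective f; exact ofExpr_eq (.zero_add f)

theorem hom_add_comm {a b : Web} (f g : a ⟶ b) : f + g = g + f := by
  obtain ⟨f, rfl⟩ := ofExpr_surjective f
  obtain ⟨g, rfl⟩ := ofExpr_surjective g
  exact ofExpr_eq (.add_comm f g)

theorem hom_zero_smul {a b : Web} (f : a ⟶ b) : (0 : Kq) • f = 0 := by
  obtain ⟨f, rfl⟩ := ofExpr_surjective f; exact ofExpr_eq (.zero_smul f)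

theorem hom_one_smul {a b : Web} (f : a ⟶ b) : (1 : Kq) • f = f := by
  obtain ⟨f, rfl⟩ := ofExpr_surjective f; exact ofExpr_eq (.one_smul f)

theorem hom_add_smul {a b : Web} (r s : Kq) (f : a ⟶ b) : (r + s) • f = r • f + s • f := by
  obtain ⟨f, rfl⟩ := ofExpr_surjective f; exact ofExpr_eq (.add_smul r s f)

theorem hom_mul_smul {a b : Web} (r s : Kq) (f : a ⟶ b) : (r * s) • f = r • s • f := by
  obtain ⟨f, rfl⟩ := ofExpr_surjective f; exact ofExpr_eq (.mul_smul r s f)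

theorem hom_smul_add {a b : Web} (r : Kq) (f g : a ⟶ b) : r • (f + g) = r • f + r • g := by
  obtain ⟨f, rfl⟩ := ofExpr_surjective f
  obtain ⟨g, rfl⟩ := ofExpr_surjective g
  exact ofExpr_eq (.smul_add r f g)

instance (a b : Web) : AddCommGroup (a ⟶ b) where
  add_assoc f g h := by
    obtain ⟨f, rfl⟩ := ofExpr_surjective f
    obtain ⟨g, rfl⟩ := ofExpr_surjective g
    obtain ⟨h, rfl⟩ := ofExpr_surjective h
    exact ofExpr_eq (.add_assoc f g h)
  zero_add := hom_zero_add
  add_zero f := by rw [hom_add_comm, hom_zero_add]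
  add_comm := hom_add_comm
  nsmul := nsmulRec
  zsmul := zsmulRec
  neg_add_cancel f := by
    have h := hom_add_smul (-1) 1 f
    rw [neg_add_cancel, hom_zero_smul, hom_one_smul] at h
    exact h.symm

instance (a b : Web) : Module Kq (a ⟶ b) where
  one_smul := hom_one_smul
  mul_smul := hom_mul_smul
  smul_zero r := by
    have h := hom_mul_smul r 0 (0 : a ⟶ b)
    rw [mul_zero, hom_zero_smul] at h
    exact h.symm
  smul_add := hom_smul_add
  add_smul := hom_add_smul
  zero_smul := hom_zero_smul

instance : Preadditive Web where
  add_comp a b c f g h := by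
    obtain ⟨f, rfl⟩ := ofExpr_surjective f
    obtain ⟨g, rfl⟩ := ofExpr_surjective g
    obtain ⟨h, rfl⟩ := ofExpr_surjective h
    exact ofExpr_eq (.add_comp f g h)
  comp_add a b c f g h := by
    obtain ⟨f, rfl⟩ := ofExpr_surjective f
    obtain ⟨g, rfl⟩ := ofExpr_surjective g
    obtain ⟨h, rfl⟩ := ofExpr_surjective h
    exact ofExpr_eq (.comp_add f g h)

instance : Linear Kq Web where
  smul_comp a b c r f g := by
    obtain ⟨f, rfl⟩ := ofExpr_surjective f
    obtain ⟨g, rfl⟩ := ofExpr_surjective g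
    exact ofExpr_eq (.smul_comp r f g)
  comp_smul a b c f r g := by
    obtain ⟨f, rfl⟩ := ofExpr_surjective f
    obtain ⟨g, rfl⟩ := ofExpr_surjective g
    exact ofExpr_eq (.comp_smul r f g)

/-- Horizontal juxtaposition of webs. -/
def tensorMap {a b c d : Web} (f : a ⟶ b) (g : c ⟶ d) :
    (⟨a.labels ++ c.labels⟩ : Web) ⟶ ⟨b.labels ++ d.labels⟩ :=
  Quotient.map₂ WebExpr.tensor (fun _ _ h _ _ h' => WebExpr.Rel.tensor_congr h h') f g

/-- Equal sequences are isomorphic through vertical strands. -/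
def strandsIso {a b : List ℕ+} (h : a = b) : (⟨a⟩ : Web) ≅ ⟨b⟩ where
  hom := ofExpr (WebExpr.strands h)
  inv := ofExpr (WebExpr.strands h.symm)
  hom_inv_id := ofExpr_eq (WebExpr.strands_comp h h.symm)
  inv_hom_id := ofExpr_eq (WebExpr.strands_comp h.symm h)

instance : MonoidalCategoryStruct Web where
  tensorObj a b := ⟨a.labels ++ b.labels⟩
  tensorHom := tensorMap
  whiskerLeft a _ _ f := tensorMap (𝟙 a) f
  whiskerRight f a := tensorMap f (𝟙 a)
  tensorUnit := ⟨[]⟩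
  associator a b c := strandsIso (List.append_assoc a.labels b.labels c.labels)
  leftUnitor a := strandsIso (List.nil_append a.labels)
  rightUnitor a := strandsIso (List.append_nil a.labels)

open WebExpr in
instance : MonoidalCategory Web := MonoidalCategory.ofTensorHom
  (id_tensorHom_id := fun a b => ofExpr_eq (.id_tensor_id a.labels b.labels))
  (tensorHom_comp_tensorHom := fun f g h k => by
    obtain ⟨f, rfl⟩ := ofExpr_surjective f
    obtain ⟨g, rfl⟩ := ofExpr_surjective g
    obtain ⟨h, rfl⟩ := ofExpr_surjective h
    obtain ⟨k, rfl⟩ := ofExpr_surjective k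
    exact ofExpr_eq (.symm (.interchange f h g k)))
  (associator_naturality := fun f g h => by
    obtain ⟨f, rfl⟩ := ofExpr_surjective f
    obtain ⟨g, rfl⟩ := ofExpr_surjective g
    obtain ⟨h, rfl⟩ := ofExpr_surjective h
    exact ofExpr_eq (.tensor_assoc f g h))
  (leftUnitor_naturality := fun f => by
    obtain ⟨f, rfl⟩ := ofExpr_surjective f
    exact ofExpr_eq (.nil_tensor f))
  (rightUnitor_naturality := fun f => by
    obtain ⟨f, rfl⟩ := ofExpr_surjective f
    exact ofExpr_eq (.tensor_nil f))
  (pentagon := fun a b c d => ofExpr_eq <|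
    .trans (.comp_congr (strands_tensor _ rfl)
      (.trans (.comp_congr (.refl _) (strands_tensor rfl _)) (strands_comp _ _)))
      (.trans (strands_comp _ _) (.symm (strands_comp _ _))))
  (triangle := fun a b => ofExpr_eq <|
    .trans (.comp_congr (.refl _) (strands_tensor rfl _))
      (.trans (strands_comp _ _) (.symm (strands_tensor _ rfl))))

/-- The two trivalent vertices, as morphisms of `Web`. -/
def merge (x y : ℕ+) : (⟨[x, y]⟩ : Web) ⟶ ⟨[x + y]⟩ := ofExpr (WebExpr.merge x y)
def split (x y : ℕ+) : (⟨[x + y]⟩ : Web) ⟶ ⟨[x, y]⟩ := ofExpr (WebExpr.split x y)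

end Web

/-- `T` is a `ℂ(q)`-linear monoidal functor that extends the assignment `𝐚 ↦ V(𝐚)`,
`merge x y ↦ Φ_{x,y}`, `split x y ↦ Φ^{x,y}`. Its monoidal structure is the canonical
identification `V(𝐚) ⊗ V(𝐛) ≅ V(𝐚𝐛)`. -/
structure ExtendsAssignment (T : Web ⥤ Rep) [T.Monoidal] : Prop where
  map_add : ∀ {a b : Web} (f g : a ⟶ b), T.map (f + g) = T.map f + T.map g
  map_smul : ∀ {a b : Web} (r : Kq) (f : a ⟶ b), T.map (r • f) = r • T.map f
  obj_eq : ∀ a : Web, T.obj a = Rep.ofSeq a.labels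
  ε_eq : Functor.LaxMonoidal.ε T ≫ eqToHom (obj_eq (𝟙_ Web)) = 𝟙 (𝟙_ Rep)
  μ_eq : ∀ a b : Web, Functor.LaxMonoidal.μ T a b ≫ eqToHom (obj_eq (a ⊗ b)) =
    (eqToHom (obj_eq a) ⊗ₘ eqToHom (obj_eq b)) ≫ (Rep.concatIso a.labels b.labels).hom
  map_merge : ∀ x y : ℕ+,
    Rep.toLin (M := Rep.ofSeq [x, y]) (N := Rep.ofSeq [x + y])
      (eqToHom (obj_eq ⟨[x, y]⟩).symm ≫ T.map (Web.merge x y) ≫ eqToHom (obj_eq ⟨[x + y]⟩)) =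
        phiMerge x y
  map_split : ∀ x y : ℕ+,
    Rep.toLin (M := Rep.ofSeq [x + y]) (N := Rep.ofSeq [x, y])
      (eqToHom (obj_eq ⟨[x + y]⟩).symm ≫ T.map (Web.split x y) ≫ eqToHom (obj_eq ⟨[x, y]⟩)) =
        phiSplit x

end

end GL11

namespace GL11

noncomputable section

set_option linter.unusedSimpArgs false

/-! ### Quantum numbers -/

/-! Existence. `WebExpr.eval` sends an expression for a web to a morphism of representations, a
juxtaposition being conjugated by the identifications `Rep.concatIso`. It descends to `Web`
(`WebExpr.eval_eq_of_rel`) because these identifications are coherent (`Rep.concatIso_assoc`,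
`Rep.concatIso_nil_right`) and because the maps Φ satisfy the web relations, which is a computation
on basis vectors. Uniqueness is an induction on expressions, and density holds because every object
of `Rep` is an iterated tensor product of objects V(a).

Fullness. Splitting a strand into strands labelled 1 and merging them again is a nonzero scalar, so
it suffices to treat sequences of ones. K acts on V(1)^{⊗n} by q^n, hence there are no nonzero maps
between different powers, and what remains is the endomorphism algebra of a single power.

With n+1 factors, V(1)^{⊗(n+1)} is a Fock space. Jordan–Wigner operators c_i, d_i (F or E in factor
i, signs to its left) satisfy the canonical anticommutation relations and generate all linear
endomorphisms; moreover F = ∑ q^i c_i and E = q^{-n} ∑ q^i d_i. The differences x_i = q c_i -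
c_{i+1} and y_i = q d_i - d_{i+1} anticommute with E and F, and together with E and F they still
generate everything. Hence an operator that commutes with E, F and 𝐪^{h₂} is a polynomial in the
products x_i y_j (`mem_bilinears_of_commute`). The commutators of these products involve only the
tridiagonal matrix of the scalars {x_i, y_j}, so the diagonal products x_i y_i already generate them
(`CAR.bilinear_mem_adjoin`). Finally x_i y_i = (q²+1) - q C_i, where C_i is the dumbbell on the
factors i and i+1 (`weightedDiff_mul_eq_phiDumbbell`), so every endomorphism is the image of a web.
-/

theorem q_pow_ne_one {m : ℕ} (hm : m ≠ 0) : q ^ m ≠ 1 := by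
  intro h
  have h1 : algebraMap (Polynomial ℂ) Kq (Polynomial.X ^ m) =
      algebraMap (Polynomial ℂ) Kq 1 := by
    simpa [q, RatFunc.algebraMap_X] using h
  have h2 := RatFunc.algebraMap_injective ℂ h1
  have h3 := congrArg Polynomial.natDegree h2
  simp [hm] at h3

/-- This tells the tensor powers of V(1) apart: K acts on the n-th one by q^n. -/
theorem q_pow_injective : Function.Injective fun m : ℕ => q ^ m := by
  intro a b h
  wlog hab : a ≤ b generalizing a b
  · exact (this h.symm (by omega)).symm
  obtain ⟨c, rfl⟩ := Nat.exists_eq_add_of_le hab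
  simp only [pow_add] at h
  by_contra hc
  exact q_pow_ne_one (m := c) (by omega) (mul_left_cancel₀ (pow_ne_zero a q_ne_zero)
    (by rw [← h, mul_one]))

theorem q_sq_sub_one_ne_zero : q ^ 2 - 1 ≠ 0 := sub_ne_zero.2 (q_pow_ne_one two_ne_zero)

theorem q_sub_inv_ne_zero : q - q⁻¹ ≠ 0 := by
  intro h
  apply q_sq_sub_one_ne_zero
  have := q_ne_zero
  field_simp at h
  simpa using h

theorem qInt_ne_zero {k : ℕ} (hk : k ≠ 0) : qInt k ≠ 0 := by
  refine div_ne_zero (fun h => q_pow_ne_one (m := k + k) (by omega) ?_) q_sub_inv_ne_zero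
  rw [sub_eq_zero] at h
  have hq := q_ne_zero
  rw [pow_add, ← zpow_natCast]
  nth_rewrite 1 [h]
  rw [← zpow_add₀ hq]
  simp

/-- The one arithmetic identity behind the equivariance of Φ and the digon relation: q^{-b} and q^a
are the powers of q that occur in Φ_{a,b} and Φ^{a,b}. -/
theorem qInt_add (a b : ℕ) :
    qInt (a + b) = q ^ (-(b : ℤ)) * qInt a + q ^ (a : ℤ) * qInt b := by
  have hq := q_ne_zero
  have h := q_sub_inv_ne_zero
  unfold qInt
  rw [mul_div_assoc', mul_div_assoc', ← add_div]
  congr 1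
  simp only [mul_sub, ← zpow_add₀ hq]
  push_cast
  ring_nf

@[simp] theorem qInt_one : qInt 1 = 1 := by
  simp [qInt, div_self q_sub_inv_ne_zero]

theorem qInt_two : qInt 2 = q + q⁻¹ := by
  rw [show 2 = 1 + 1 from rfl, qInt_add]
  simp [add_comm]

theorem qFact_ne_zero (k : ℕ) : qFact k ≠ 0 :=
  Finset.prod_ne_zero_iff.2 fun i _ => qInt_ne_zero (Nat.succ_ne_zero i)

theorem qFact_succ (k : ℕ) : qFact (k + 1) = qFact k * qInt (k + 1) :=
  Finset.prod_range_succ _ _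

@[simp] theorem qFact_zero : qFact 0 = 1 := rfl

@[simp] theorem qFact_one : qFact 1 = 1 := by simp [qFact]

theorem qFact_eq_pred {k : ℕ} (hk : 0 < k) : qFact k = qFact (k - 1) * qInt k := by
  obtain ⟨j, rfl⟩ := Nat.exists_eq_succ_of_ne_zero hk.ne'
  exact qFact_succ j

theorem qBinom_add (a b : ℕ) : qBinom (a + b) a = qFact (a + b) / (qFact a * qFact b) := by
  rw [qBinom, Nat.add_sub_cancel_left]

theorem qBinom_ne_zero (n k : ℕ) : qBinom n k ≠ 0 :=
  div_ne_zero (qFact_ne_zero _) (mul_ne_zero (qFact_ne_zero _) (qFact_ne_zero _))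

/-- `[a+b-1 choose a] = [a+b-1]! / ([a]! [b-1]!)`, expressed through `[a+b choose a]`. -/
theorem qBinom_pred_left (a : ℕ) {b : ℕ} (hb : 0 < b) :
    qBinom (a + b - 1) a = qFact (a + b) / (qFact a * qFact b) * qInt b / qInt (a + b) := by
  have h1 := qFact_eq_pred (k := a + b) (by omega)
  have h2 := qFact_eq_pred hb
  have h3 := qInt_ne_zero (k := a + b) (by omega)
  have h4 := qInt_ne_zero hb.ne'
  have h5 := qFact_ne_zero a
  have h6 := qFact_ne_zero (b - 1)
  rw [qBinom, show a + b - 1 - a = b - 1 by omega, h1, h2]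
  field_simp

theorem qBinom_pred_right {a : ℕ} (ha : 0 < a) (b : ℕ) :
    qBinom (a + b - 1) b = qFact (a + b) / (qFact a * qFact b) * qInt a / qInt (a + b) := by
  rw [add_comm a b, qBinom_pred_left b ha, mul_comm (qFact b)]

/-! ### Linear maps out of tensor products of the `V(a)` -/

section
variable {W : Type} [AddCommGroup W] [Module Kq W]

theorem vv_ext {f g : (Fin 2 → Kq) ⊗[Kq] (Fin 2 → Kq) →ₗ[Kq] W}
    (h : ∀ i j, f (vBasis i ⊗ₜ vBasis j) = g (vBasis i ⊗ₜ vBasis j)) : f = g :=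
  (vBasis.tensorProduct vBasis).ext fun ij => by
    rw [Module.Basis.tensorProduct_apply]; exact h ij.1 ij.2

theorem vw_ext {U : Type} [AddCommGroup U] [Module Kq U] {f g : (Fin 2 → Kq) ⊗[Kq] U →ₗ[Kq] W}
    (h : ∀ i w, f (vBasis i ⊗ₜ w) = g (vBasis i ⊗ₜ w)) : f = g :=
  TensorProduct.ext (vBasis.ext fun i => LinearMap.ext (h i))

theorem vvv_ext {f g : (Fin 2 → Kq) ⊗[Kq] ((Fin 2 → Kq) ⊗[Kq] (Fin 2 → Kq)) →ₗ[Kq] W}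
    (h : ∀ i j k, f (vBasis i ⊗ₜ (vBasis j ⊗ₜ vBasis k)) =
      g (vBasis i ⊗ₜ (vBasis j ⊗ₜ vBasis k))) : f = g :=
  (vBasis.tensorProduct (vBasis.tensorProduct vBasis)).ext fun ij => by
    rw [Module.Basis.tensorProduct_apply, Module.Basis.tensorProduct_apply]
    exact h ij.1 ij.2.1 ij.2.2

end

@[simp] theorem phiMerge_zero_zero (a b : ℕ) :
    phiMerge a b (vBasis 0 ⊗ₜ vBasis 0) = qBinom (a + b) a • vBasis 0 := by
  rw [← Module.Basis.tensorProduct_apply, phiMerge, Module.Basis.constr_basis]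

@[simp] theorem phiMerge_one_zero (a b : ℕ) : phiMerge a b (vBasis 1 ⊗ₜ vBasis 0) =
    (q ^ (-(b : ℤ)) * qBinom (a + b - 1) b) • vBasis 1 := by
  rw [← Module.Basis.tensorProduct_apply, phiMerge, Module.Basis.constr_basis]

@[simp] theorem phiMerge_zero_one (a b : ℕ) : phiMerge a b (vBasis 0 ⊗ₜ vBasis 1) =
    qBinom (a + b - 1) a • vBasis 1 := by
  rw [← Module.Basis.tensorProduct_apply, phiMerge, Module.Basis.constr_basis]

@[simp] theorem phiMerge_one_one (a b : ℕ) : phiMerge a b (vBasis 1 ⊗ₜ vBasis 1) = 0 := by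
  rw [← Module.Basis.tensorProduct_apply, phiMerge, Module.Basis.constr_basis]

@[simp] theorem phiSplit_zero (a : ℕ) : phiSplit a (vBasis 0) = vBasis 0 ⊗ₜ vBasis 0 :=
  vMap_zero _ _

@[simp] theorem phiSplit_one (a : ℕ) : phiSplit a (vBasis 1) =
    vBasis 1 ⊗ₜ vBasis 0 + q ^ (a : ℤ) • (vBasis 0 ⊗ₜ vBasis 1) := vMap_one _ _

/-! ### Equivariance of the maps Φ -/

theorem V_ρ (a : ℕ+) (g : UqGen) : (V a).ρ (Uq.of g) = vOp a g := Uq.lift_of _ _ g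

/-- The parity operator of every `V(a)`. -/
abbrev vSgn : Module.End Kq (Fin 2 → Kq) := vMap (vBasis 0) (-vBasis 1)

/-- The action of the generators on `V(a) ⊗ V(b)`. -/
def vvOp (a b : ℕ) : UqGen → Module.End Kq ((Fin 2 → Kq) ⊗[Kq] (Fin 2 → Kq))
  | UqGen.E => TensorProduct.map (vOp a .E) (vOp b (.qh (-1, -1))) +
      TensorProduct.map vSgn (vOp b .E)
  | UqGen.F => TensorProduct.map (vOp a .F) 1 +
      TensorProduct.map (vOp a (.qh (1, 1)) * vSgn) (vOp b .F)
  | UqGen.qh h => TensorProduct.map (vOp a (.qh h)) (vOp b (.qh h))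

theorem tensor_V_ρ (a b : ℕ+) (g : UqGen) :
    (SuperRep.tensor (V a) (V b)).ρ (Uq.of g) = vvOp a b g := by
  rw [SuperRep.tensor_ρ]
  cases g <;> simp only [SuperRep.tensorOp, SuperRep.opE, SuperRep.opF, SuperRep.opQ, V_ρ] <;>
    rfl

theorem phiMerge_comm {a b : ℕ} (ha : 0 < a) (hb : 0 < b) (g : UqGen) :
    phiMerge a b ∘ₗ vvOp a b g = vOp (a + b) g ∘ₗ phiMerge a b := by
  have hq := q_ne_zero
  have hab := qInt_ne_zero (k := a + b) (by omega)
  refine vv_ext fun i j => ?_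
  have e1 := qInt_add a b
  cases g <;> fin_cases i <;> fin_cases j <;>
    simp [vvOp, vOp, pairAlpha, TensorProduct.tmul_smul, ← TensorProduct.smul_tmul', smul_smul,
      TensorProduct.neg_tmul] <;>
    simp only [← add_smul, ← neg_smul, qBinom_pred_left a hb, qBinom_pred_right ha b,
      qBinom_add]
  all_goals first
    -- The case of E on v₁ ⊗ v₁: the two contributions have opposite signs by the sign rule, and
    -- [a][a+b-1 choose a] = [b][a+b-1 choose b].
    | rw [show ∀ x y z w : Kq, x * y * (z * w / qInt (a + b)) +
        -(w * (x * (z * y / qInt (a + b)))) = 0 from fun x y z w => by ring, zero_smul]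
    | congr 1
  all_goals first
    -- The case of F on v₀ ⊗ v₀, where two terms add up through `qInt_add`.
    | rw [zpow_neg, zpow_natCast, zpow_natCast] at e1
      rw [mul_div_assoc', mul_div_assoc', ← add_div, div_eq_iff hab, e1]
      ring
    | try simp only [add_mul, zpow_add₀ hq, zpow_sub₀ hq]
      field_simp

theorem phiSplit_comm (a b : ℕ) (g : UqGen) :
    phiSplit a ∘ₗ vOp (a + b) g = vvOp a b g ∘ₗ phiSplit a := by
  have hq := q_ne_zero
  have e1 := qInt_add a b
  refine vMap_ext ?_ ?_ <;> cases g <;>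
    simp [vvOp, vOp, pairAlpha, TensorProduct.tmul_smul, ← TensorProduct.smul_tmul', smul_smul,
      TensorProduct.neg_tmul]
  · rw [add_mul, zpow_add₀ hq, mul_comm]
  · rw [← add_smul, e1, zpow_neg, zpow_natCast, zpow_natCast]
  · congr 2 <;> simp only [add_mul, zpow_add₀ hq, zpow_sub₀ hq] <;> ring

theorem phiMerge_σ (a b : ℕ) :
    phiMerge a b ∘ₗ TensorProduct.map vSgn vSgn = vSgn ∘ₗ phiMerge a b := by
  refine vv_ext fun i j => ?_
  fin_cases i <;> fin_cases j <;> simp [TensorProduct.neg_tmul, TensorProduct.tmul_neg]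

theorem phiSplit_σ (a : ℕ) :
    phiSplit a ∘ₗ vSgn = TensorProduct.map vSgn vSgn ∘ₗ phiSplit a := by
  refine vMap_ext (by simp) ?_
  simp [TensorProduct.neg_tmul, TensorProduct.tmul_neg]
  abel

/-! ### The web relations for the maps Φ -/

theorem phiSplit_phiMerge {a b : ℕ} (ha : 0 < a) (hb : 0 < b) :
    phiMerge a b ∘ₗ phiSplit a = qBinom (a + b) a • LinearMap.id := by
  have e1 := qInt_add a b
  have hab := qInt_ne_zero (k := a + b) (by omega)
  refine vMap_ext (by simp) ?_
  simp [smul_smul, ← add_smul]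
  congr 1
  rw [zpow_neg, zpow_natCast, zpow_natCast] at e1
  rw [qBinom_pred_left a hb, qBinom_pred_right ha b, qBinom_add, mul_div_assoc', mul_div_assoc',
    ← add_div, div_eq_iff hab, e1]
  ring

/-- The associativity of the maps `Φ_{a,b}`. -/
theorem phiMerge_assoc {a b c : ℕ} (ha : 0 < a) (hb : 0 < b) (hc : 0 < c) :
    phiMerge (a + b) c ∘ₗ TensorProduct.map (phiMerge a b) LinearMap.id ∘ₗ
      (TensorProduct.assoc Kq _ _ _).symm.toLinearMap =
    phiMerge a (b + c) ∘ₗ TensorProduct.map LinearMap.id (phiMerge b c) := by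
  have hq := q_ne_zero
  have h1 := qInt_ne_zero (k := a + b) (by omega)
  have h2 := qInt_ne_zero (k := b + c) (by omega)
  have h3 := qInt_ne_zero (k := a + (b + c)) (by omega)
  have h4 := qFact_ne_zero (a + b)
  have h5 := qFact_ne_zero (b + c)
  have h6 := qFact_ne_zero a
  have h7 := qFact_ne_zero b
  have h8 := qFact_ne_zero c
  refine vvv_ext fun i j k => ?_
  fin_cases i <;> fin_cases j <;> fin_cases k <;>
    simp [TensorProduct.tmul_smul, ← TensorProduct.smul_tmul', smul_smul] <;>
    congr 1 <;>
    simp only [qBinom_pred_left _ hc, qBinom_pred_left _ hb, qBinom_pred_right ha,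
      qBinom_pred_right hb, qBinom_pred_right (show 0 < a + b by omega),
      qBinom_pred_left _ (show 0 < b + c by omega), qBinom_add] <;>
    simp only [add_assoc a b c, neg_add_rev, zpow_add₀ hq, zpow_neg, zpow_natCast] <;> field_simp

/-- The coassociativity of the maps `Φ^{a,b}`. -/
theorem phiSplit_assoc (a b : ℕ) :
    (TensorProduct.assoc Kq _ _ _).toLinearMap ∘ₗ
      TensorProduct.map (phiSplit a) LinearMap.id ∘ₗ phiSplit (a + b) =
    TensorProduct.map LinearMap.id (phiSplit b) ∘ₗ phiSplit a := by
  refine vMap_ext (by simp) ?_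
  simp [TensorProduct.tmul_add, TensorProduct.add_tmul, TensorProduct.tmul_smul,
    ← TensorProduct.smul_tmul', smul_smul, zpow_add₀ q_ne_zero, add_assoc]

/-- The endomorphism `Φ^{1,1} Φ_{1,1}` of `V(1) ⊗ V(1)`. -/
def phiDumbbell : Module.End Kq ((Fin 2 → Kq) ⊗[Kq] (Fin 2 → Kq)) := phiSplit 1 ∘ₗ phiMerge 1 1

theorem qBinom_two_one : qBinom 2 1 = q + q⁻¹ := by
  rw [qBinom, show 2 = 1 + 1 from rfl, qFact_succ, ← qInt_two]
  simp

@[simp] theorem phiDumbbell_zero_zero :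
    phiDumbbell (vBasis 0 ⊗ₜ vBasis 0) = (q + q⁻¹) • vBasis 0 ⊗ₜ vBasis 0 := by
  simp [phiDumbbell, qBinom_two_one]

@[simp] theorem phiDumbbell_one_zero : phiDumbbell (vBasis 1 ⊗ₜ vBasis 0) =
    q⁻¹ • vBasis 1 ⊗ₜ vBasis 0 + vBasis 0 ⊗ₜ vBasis 1 := by
  simp [phiDumbbell, qBinom, smul_smul, q_ne_zero]

@[simp] theorem phiDumbbell_zero_one : phiDumbbell (vBasis 0 ⊗ₜ vBasis 1) =
    vBasis 1 ⊗ₜ vBasis 0 + q • vBasis 0 ⊗ₜ vBasis 1 := by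
  simp [phiDumbbell, qBinom]

@[simp] theorem phiDumbbell_one_one : phiDumbbell (vBasis 1 ⊗ₜ vBasis 1) = 0 := by
  simp [phiDumbbell]

/-- `phiDumbbell` on the first two factors. -/
def phiDumbbell₁ : Module.End Kq ((Fin 2 → Kq) ⊗[Kq] ((Fin 2 → Kq) ⊗[Kq] (Fin 2 → Kq))) :=
  (TensorProduct.assoc Kq _ _ _).toLinearMap ∘ₗ TensorProduct.map phiDumbbell LinearMap.id ∘ₗ
    (TensorProduct.assoc Kq _ _ _).symm.toLinearMap

/-- `phiDumbbell` on the last two factors. -/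
def phiDumbbell₂ : Module.End Kq ((Fin 2 → Kq) ⊗[Kq] ((Fin 2 → Kq) ⊗[Kq] (Fin 2 → Kq))) :=
  TensorProduct.map LinearMap.id phiDumbbell

/-- The factor that the dumbbell does not touch is an arbitrary vector, so four rules for each
position cover all eight basis vectors in the braid relation. -/
theorem phiDumbbell₁_zero_zero (v : Fin 2 → Kq) :
    phiDumbbell₁ (vBasis 0 ⊗ₜ[Kq] (vBasis 0 ⊗ₜ[Kq] v)) =
      (q + q⁻¹) • vBasis 0 ⊗ₜ[Kq] (vBasis 0 ⊗ₜ[Kq] v) := by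
  simp [phiDumbbell₁, TensorProduct.tmul_add, TensorProduct.add_tmul, TensorProduct.tmul_smul,
    ← TensorProduct.smul_tmul']

theorem phiDumbbell₁_one_zero (v : Fin 2 → Kq) :
    phiDumbbell₁ (vBasis 1 ⊗ₜ[Kq] (vBasis 0 ⊗ₜ[Kq] v)) =
      q⁻¹ • vBasis 1 ⊗ₜ[Kq] (vBasis 0 ⊗ₜ[Kq] v) +
        (1 : Kq) • vBasis 0 ⊗ₜ[Kq] (vBasis 1 ⊗ₜ[Kq] v) := by
  simp [phiDumbbell₁, TensorProduct.tmul_add, TensorProduct.add_tmul, TensorProduct.tmul_smul,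
    ← TensorProduct.smul_tmul']

theorem phiDumbbell₁_zero_one (v : Fin 2 → Kq) :
    phiDumbbell₁ (vBasis 0 ⊗ₜ[Kq] (vBasis 1 ⊗ₜ[Kq] v)) =
      (1 : Kq) • vBasis 1 ⊗ₜ[Kq] (vBasis 0 ⊗ₜ[Kq] v) +
        q • vBasis 0 ⊗ₜ[Kq] (vBasis 1 ⊗ₜ[Kq] v) := by
  simp [phiDumbbell₁, TensorProduct.tmul_add, TensorProduct.add_tmul, TensorProduct.tmul_smul,
    ← TensorProduct.smul_tmul']

theorem phiDumbbell₁_one_one (v : Fin 2 → Kq) :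
    phiDumbbell₁ (vBasis 1 ⊗ₜ[Kq] (vBasis 1 ⊗ₜ[Kq] v)) =
      0 := by
  simp [phiDumbbell₁, TensorProduct.tmul_add, TensorProduct.add_tmul, TensorProduct.tmul_smul,
    ← TensorProduct.smul_tmul']

theorem phiDumbbell₂_zero_zero (v : Fin 2 → Kq) :
    phiDumbbell₂ (v ⊗ₜ[Kq] (vBasis 0 ⊗ₜ[Kq] vBasis 0)) =
      (q + q⁻¹) • v ⊗ₜ[Kq] (vBasis 0 ⊗ₜ[Kq] vBasis 0) := by
  simp [phiDumbbell₂, TensorProduct.tmul_add, TensorProduct.add_tmul, TensorProduct.tmul_smul,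
    ← TensorProduct.smul_tmul']

theorem phiDumbbell₂_one_zero (v : Fin 2 → Kq) :
    phiDumbbell₂ (v ⊗ₜ[Kq] (vBasis 1 ⊗ₜ[Kq] vBasis 0)) =
      q⁻¹ • v ⊗ₜ[Kq] (vBasis 1 ⊗ₜ[Kq] vBasis 0) +
        (1 : Kq) • v ⊗ₜ[Kq] (vBasis 0 ⊗ₜ[Kq] vBasis 1) := by
  simp [phiDumbbell₂, TensorProduct.tmul_add, TensorProduct.add_tmul, TensorProduct.tmul_smul,
    ← TensorProduct.smul_tmul']

theorem phiDumbbell₂_zero_one (v : Fin 2 → Kq) :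
    phiDumbbell₂ (v ⊗ₜ[Kq] (vBasis 0 ⊗ₜ[Kq] vBasis 1)) =
      (1 : Kq) • v ⊗ₜ[Kq] (vBasis 1 ⊗ₜ[Kq] vBasis 0) +
        q • v ⊗ₜ[Kq] (vBasis 0 ⊗ₜ[Kq] vBasis 1) := by
  simp [phiDumbbell₂, TensorProduct.tmul_add, TensorProduct.add_tmul, TensorProduct.tmul_smul,
    ← TensorProduct.smul_tmul']

theorem phiDumbbell₂_one_one (v : Fin 2 → Kq) :
    phiDumbbell₂ (v ⊗ₜ[Kq] (vBasis 1 ⊗ₜ[Kq] vBasis 1)) =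
      0 := by
  simp [phiDumbbell₂, TensorProduct.tmul_add, TensorProduct.add_tmul, TensorProduct.tmul_smul,
    ← TensorProduct.smul_tmul']

theorem phiDumbbell_braid :
    phiDumbbell₁ * phiDumbbell₂ * phiDumbbell₁ + phiDumbbell₂ =
      phiDumbbell₂ * phiDumbbell₁ * phiDumbbell₂ + phiDumbbell₁ := by
  have hq := q_ne_zero
  refine vvv_ext fun i j k => ?_
  let _ : Algebra ℕ Kq := Semiring.toNatAlgebra
  fin_cases i <;> fin_cases j <;> fin_cases k <;>
    simp only [Fin.zero_eta, Fin.mk_one, LinearMap.add_apply, Module.End.mul_apply, map_add,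
      map_smul, map_zero, phiDumbbell₁_zero_zero, phiDumbbell₁_one_zero, phiDumbbell₁_zero_one,
      phiDumbbell₁_one_one, phiDumbbell₂_zero_zero, phiDumbbell₂_one_zero, phiDumbbell₂_zero_one,
      phiDumbbell₂_one_one] <;>
    match_scalars <;> field_simp <;> ring

/-! ### Identities in monoidal categories -/

section Monoidal

variable {C : Type*} [Category C] [MonoidalCategory C]

/-- The induction step of `Rep.concatIso_nil_right`, with `A` the first label and `B` the rest of
the sequence. -/
theorem associator_comp_whiskerLeft_comp {A B B' : C} (f : B ⊗ 𝟙_ C ⟶ B') (k : B' ⟶ B)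
    (h : f ≫ k = (ρ_ B).hom) :
    ((α_ A B (𝟙_ C)).hom ≫ A ◁ f) ≫ A ◁ k = (ρ_ (A ⊗ B)).hom := by
  rw [Category.assoc, ← MonoidalCategory.whiskerLeft_comp, h]
  simp

/-- The induction step of `Rep.concatIso_assoc`: whiskering `h` by the first label and applying the
pentagon. -/
theorem associator_comp_whiskerLeft_assoc {A B M N X Y Z W : C} (f : B ⊗ M ⟶ X) (g : X ⊗ N ⟶ Y)
    (k : Y ⟶ Z) (u : M ⊗ N ⟶ W) (v : B ⊗ W ⟶ Z)
    (h : (f ▷ N ≫ g) ≫ k = (α_ B M N).hom ≫ B ◁ u ≫ v) :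
    (((α_ A B M).hom ≫ A ◁ f) ▷ N ≫ (α_ A X N).hom ≫ A ◁ g) ≫ A ◁ k =
      (α_ (A ⊗ B) M N).hom ≫ (A ⊗ B) ◁ u ≫ (α_ A B W).hom ≫ A ◁ v := by
  have h' := congrArg (A ◁ ·) h
  simp only [MonoidalCategory.whiskerLeft_comp, Category.assoc] at h'
  simp only [comp_whiskerRight, Category.assoc, tensor_whiskerLeft, Iso.inv_hom_id_assoc,
    associator_naturality_middle_assoc, h']
  simp

/-- The relation `tensor_assoc` after evaluation. The isomorphisms stand for instances of
`Rep.concatIso`, `e` and `e'` for the relabelling of concatenated sequences, and `w`, `w'` are their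
coherence. -/
theorem tensor_assoc_of_coherent {A B D A' B' D' AB BD X Y AB' BD' X' Y' : C}
    (f : A ⟶ A') (g : B ⟶ B') (h : D ⟶ D')
    (i₁ : A ⊗ B ≅ AB) (i₂ : B ⊗ D ≅ BD) (j₁ : AB ⊗ D ≅ X) (j₂ : A ⊗ BD ≅ Y) (e : X ⟶ Y)
    (i₁' : A' ⊗ B' ≅ AB') (i₂' : B' ⊗ D' ≅ BD') (j₁' : AB' ⊗ D' ≅ X') (j₂' : A' ⊗ BD' ≅ Y')
    (e' : X' ⟶ Y')
    (w : (i₁.hom ▷ D ≫ j₁.hom) ≫ e = (α_ A B D).hom ≫ A ◁ i₂.hom ≫ j₂.hom)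
    (w' : (i₁'.hom ▷ D' ≫ j₁'.hom) ≫ e' = (α_ A' B' D').hom ≫ A' ◁ i₂'.hom ≫ j₂'.hom) :
    (j₁.inv ≫ ((i₁.inv ≫ (f ⊗ₘ g) ≫ i₁'.hom) ⊗ₘ h) ≫ j₁'.hom) ≫ e' =
      e ≫ j₂.inv ≫ (f ⊗ₘ (i₂.inv ≫ (g ⊗ₘ h) ≫ i₂'.hom)) ≫ j₂'.hom := by
  rw [← cancel_epi (i₁.hom ▷ D ≫ j₁.hom), ← Category.assoc _ e, w]
  have h3 : (i₁.inv ≫ (f ⊗ₘ g) ≫ i₁'.hom) ⊗ₘ h =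
      i₁.inv ▷ _ ≫ ((f ⊗ₘ g) ⊗ₘ h) ≫ i₁'.hom ▷ _ := by
    rw [← tensorHom_id, ← tensorHom_id, tensorHom_comp_tensorHom, tensorHom_comp_tensorHom,
      Category.id_comp, Category.comp_id]
  have h4 : f ⊗ₘ (i₂.inv ≫ (g ⊗ₘ h) ≫ i₂'.hom) =
      _ ◁ i₂.inv ≫ (f ⊗ₘ (g ⊗ₘ h)) ≫ _ ◁ i₂'.hom := by
    rw [← id_tensorHom, ← id_tensorHom, tensorHom_comp_tensorHom, tensorHom_comp_tensorHom,
      Category.id_comp, Category.comp_id]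
  rw [h3, h4]
  simp only [Category.assoc, Iso.hom_inv_id_assoc, hom_inv_whiskerRight_assoc] at w' ⊢
  rw [w']
  simp

theorem tensor_interchange_of_iso {A B D A' B' D' X Y Z : C} (f : A ⟶ B) (g : B ⟶ D)
    (f' : A' ⟶ B') (g' : B' ⟶ D') (i : A ⊗ A' ≅ X) (j : B ⊗ B' ≅ Y) (k : D ⊗ D' ≅ Z) :
    i.inv ≫ ((f ≫ g) ⊗ₘ (f' ≫ g')) ≫ k.hom =
      (i.inv ≫ (f ⊗ₘ f') ≫ j.hom) ≫ j.inv ≫ (g ⊗ₘ g') ≫ k.hom := by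
  simp

theorem id_tensor_of_leftUnitor {A B : C} (f : A ⟶ B) :
    ((λ_ A).inv ≫ (𝟙 (𝟙_ C) ⊗ₘ f) ≫ (λ_ B).hom) ≫ 𝟙 _ = 𝟙 _ ≫ f := by
  simp

theorem tensor_id_of_rightUnitor {A B A' B' : C} (f : A ⟶ B) (i : A ⊗ 𝟙_ C ≅ A')
    (j : B ⊗ 𝟙_ C ≅ B') (e : A' ⟶ A) (e' : B' ⟶ B) (w : i.hom ≫ e = (ρ_ A).hom)
    (w' : j.hom ≫ e' = (ρ_ B).hom) :
    (i.inv ≫ (f ⊗ₘ 𝟙 (𝟙_ C)) ≫ j.hom) ≫ e' = e ≫ f := by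
  simp only [Category.assoc, w', Iso.inv_comp_eq]
  rw [← Category.assoc i.hom, w]
  simp

section Linear

variable [Preadditive C] [MonoidalPreadditive C]

theorem add_tensorHom {X Y Z W : C} (f f' : X ⟶ Y) (g : Z ⟶ W) :
    (f + f') ⊗ₘ g = (f ⊗ₘ g) + (f' ⊗ₘ g) := by
  simp [MonoidalCategory.tensorHom_def, MonoidalPreadditive.add_whiskerRight]

theorem tensorHom_add {X Y Z W : C} (f : X ⟶ Y) (g g' : Z ⟶ W) :
    f ⊗ₘ (g + g') = (f ⊗ₘ g) + (f ⊗ₘ g') := by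
  simp [MonoidalCategory.tensorHom_def, MonoidalPreadditive.whiskerLeft_add]

variable {R : Type*} [Semiring R] [Linear R C] [MonoidalLinear R C]

theorem smul_tensorHom {X Y Z W : C} (r : R) (f : X ⟶ Y) (g : Z ⟶ W) :
    (r • f) ⊗ₘ g = r • (f ⊗ₘ g) := by
  simp [MonoidalCategory.tensorHom_def]

theorem tensorHom_smul {X Y Z W : C} (r : R) (f : X ⟶ Y) (g : Z ⟶ W) :
    f ⊗ₘ (r • g) = r • (f ⊗ₘ g) := by
  simp [MonoidalCategory.tensorHom_def]

end Linear

end Monoidal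

/-! ### Linearity of the tensor product of supermodules -/

instance : MonoidalPreadditive SuperRep where
  whiskerLeft_zero {X _ _} := SuperRep.hom_ext
    (TensorProduct.map_zero_right (R := Kq) (LinearMap.id : X.carrier →ₗ[Kq] X.carrier))
  zero_whiskerRight {X _ _} := SuperRep.hom_ext
    (TensorProduct.map_zero_left (R := Kq) (LinearMap.id : X.carrier →ₗ[Kq] X.carrier))
  whiskerLeft_add {X _ _} f g := SuperRep.hom_ext
    (TensorProduct.map_add_right (R := Kq) (LinearMap.id : X.carrier →ₗ[Kq] X.carrier)
      (SuperRep.toLin f) (SuperRep.toLin g))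
  add_whiskerRight {X _ _} f g := SuperRep.hom_ext
    (TensorProduct.map_add_left (R := Kq) (SuperRep.toLin f) (SuperRep.toLin g)
      (LinearMap.id : X.carrier →ₗ[Kq] X.carrier))

instance : MonoidalLinear Kq SuperRep where
  whiskerLeft_smul X {_ _} r f := SuperRep.hom_ext
    (TensorProduct.map_smul_right (R := Kq) r (LinearMap.id : X.carrier →ₗ[Kq] X.carrier)
      (SuperRep.toLin f))
  smul_whiskerRight r {_ _} f X := SuperRep.hom_ext
    (TensorProduct.map_smul_left (R := Kq) r (SuperRep.toLin f)
      (LinearMap.id : X.carrier →ₗ[Kq] X.carrier))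

namespace Rep

theorem hom_ext {M N : Rep} {f g : M ⟶ N} (h : toLin f = toLin g) : f = g :=
  ObjectProperty.hom_ext _ (SuperRep.hom_ext h)

theorem toLin_comp {M N P : Rep} (f : M ⟶ N) (g : N ⟶ P) : toLin (f ≫ g) = toLin g ∘ₗ toLin f :=
  rfl

theorem toLin_id (M : Rep) : toLin (𝟙 M) = LinearMap.id := rfl

theorem toLin_add {M N : Rep} (f g : M ⟶ N) : toLin (f + g) = toLin f + toLin g := rfl

theorem toLin_smul {M N : Rep} (c : Kq) (f : M ⟶ N) : toLin (c • f) = c • toLin f := rfl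

/-! ### Coherence of the canonical identifications `V(𝐚) ⊗ V(𝐛) ≅ V(𝐚𝐛)` -/

/-- The remaining sequences are nonempty because `ofSeq` splits off a tensor factor only then;
separate variables on the two sides allow the equation to be eliminated. -/
theorem whiskerLeft_eqToHom_ofSeq (a b b' : ℕ+) {l l' : List ℕ+} (h : b :: l = b' :: l') :
    ofLabel a ◁ eqToHom (congrArg ofSeq h) =
      eqToHom (congrArg ofSeq (congrArg (a :: ·) h) :
        ofSeq (a :: b :: l) = ofSeq (a :: b' :: l')) := by
  cases h
  exact MonoidalCategory.whiskerLeft_id _ _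

theorem concatIso_nil_right : ∀ l : List ℕ+,
    (concatIso l []).hom ≫ eqToHom (congrArg ofSeq (List.append_nil l)) = (ρ_ (ofSeq l)).hom
  | [] => by
    change (λ_ (𝟙_ Rep)).hom ≫ 𝟙 _ = (ρ_ (𝟙_ Rep)).hom
    rw [Category.comp_id, unitors_equal]
  | [a] => Category.comp_id _
  | a :: b :: l => by
    have h := whiskerLeft_eqToHom_ofSeq a b b (List.append_nil (b :: l))
    refine Eq.trans (congrArg (fun z => (concatIso (a :: b :: l) []).hom ≫ z) h.symm) ?_
    exact associator_comp_whiskerLeft_comp (A := ofLabel a) _ _ (concatIso_nil_right (b :: l))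

theorem concatIso_assoc : ∀ l m n : List ℕ+,
    ((concatIso l m).hom ▷ ofSeq n ≫ (concatIso (l ++ m) n).hom) ≫
        eqToHom (congrArg ofSeq (List.append_assoc l m n)) =
      (α_ (ofSeq l) (ofSeq m) (ofSeq n)).hom ≫ ofSeq l ◁ (concatIso m n).hom ≫
        (concatIso l (m ++ n)).hom
  | [], m, n => by
    change ((λ_ (ofSeq m)).hom ▷ ofSeq n ≫ (concatIso m n).hom) ≫ 𝟙 _ =
      (α_ (𝟙_ Rep) (ofSeq m) (ofSeq n)).hom ≫ 𝟙_ Rep ◁ (concatIso m n).hom ≫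
        (λ_ (ofSeq (m ++ n))).hom
    rw [Category.comp_id, leftUnitor_naturality, leftUnitor_whiskerRight, Category.assoc]
  | [a], [], n => by
    refine (Category.comp_id _).trans ?_
    exact (congrArg (· ≫ (concatIso [a] n).hom) (triangle (ofLabel a) (ofSeq n)).symm).trans
      (Category.assoc _ _ _)
  | [a], b :: m, n => by
    -- `concatIso [a] (b :: m)` is an identity, so both sides reduce to an associator followed by
    -- one whiskered identification.
    refine (Category.comp_id _).trans ?_
    refine Eq.trans (congrArg (· ≫ (concatIso (a :: b :: m) n).hom)
      (id_whiskerRight (ofLabel a ⊗ ofSeq (b :: m)) (ofSeq n))) ?_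
    refine (Category.id_comp _).trans ?_
    exact congrArg ((α_ (ofLabel a) (ofSeq (b :: m)) (ofSeq n)).hom ≫ ·)
      (Category.comp_id (ofLabel a ◁ (concatIso (b :: m) n).hom)).symm
  | a :: b :: l, m, n => by
    have h := whiskerLeft_eqToHom_ofSeq a b b (List.append_assoc (b :: l) m n)
    refine Eq.trans (congrArg (fun z => ((concatIso (a :: b :: l) m).hom ▷ ofSeq n ≫
      (concatIso (a :: b :: l ++ m) n).hom) ≫ z) h.symm) ?_
    exact associator_comp_whiskerLeft_assoc (A := ofLabel a) _ _ _ _ _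
      (concatIso_assoc (b :: l) m n)

/-- The recursion produces the associator followed by a whiskered identity. Removing the latter
makes a web next to strands computable on underlying spaces. -/
theorem concatIso_pair (a b c : ℕ+) (l : List ℕ+) :
    concatIso [a, b] (c :: l) = α_ (ofLabel a) (ofLabel b) (ofSeq (c :: l)) :=
  Iso.ext ((congrArg ((α_ (ofLabel a) (ofLabel b) (ofSeq (c :: l))).hom ≫ ·)
    (MonoidalCategory.whiskerLeft_id (ofLabel a) (ofLabel b ⊗ ofSeq (c :: l)))).trans
      (Category.comp_id _))

end Rep

/-! ### The maps `Φ` as morphisms of `Rep` -/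

/-- `Φ_{a,b}` as a morphism of `Rep`. -/
def mergeHom (a b : ℕ+) : Rep.ofSeq [a, b] ⟶ Rep.ofSeq [a + b] :=
  ObjectProperty.homMk (SuperRep.Hom.mk (M := SuperRep.tensor (V a) (V b)) (N := V (a + b))
    (phiMerge a b) (phiMerge_σ a b)
    (SuperRep.comm_of_gens (M := SuperRep.tensor (V a) (V b)) (N := V (a + b)) _ fun g => by
      rw [tensor_V_ρ, V_ρ, PNat.add_coe]
      exact phiMerge_comm a.pos b.pos g))

/-- `Φ^{a,b}` as a morphism of `Rep`. -/
def splitHom (a b : ℕ+) : Rep.ofSeq [a + b] ⟶ Rep.ofSeq [a, b] :=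
  ObjectProperty.homMk (SuperRep.Hom.mk (M := V (a + b)) (N := SuperRep.tensor (V a) (V b))
    (phiSplit a) (phiSplit_σ a)
    (SuperRep.comm_of_gens (M := V (a + b)) (N := SuperRep.tensor (V a) (V b)) _ fun g => by
      rw [tensor_V_ρ, V_ρ, PNat.add_coe]
      exact phiSplit_comm a b g))

/-! ### The functor from webs to representations -/

namespace WebExpr

/-- The morphism of representations that corresponds to an expression for a web. -/
def eval : ∀ {a b : List ℕ+}, WebExpr a b → (Rep.ofSeq a ⟶ Rep.ofSeq b)
  | _, _, id _ => 𝟙 _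
  | _, _, comp f g => f.eval ≫ g.eval
  | _, _, tensor (a := a) (b := b) (c := c) (d := d) f g =>
      (Rep.concatIso a c).inv ≫ (f.eval ⊗ₘ g.eval) ≫ (Rep.concatIso b d).hom
  | _, _, merge x y => mergeHom x y
  | _, _, split x y => splitHom x y
  | _, _, zero _ _ => 0
  | _, _, add f g => f.eval + g.eval
  | _, _, smul r f => r • f.eval

theorem eval_strands {a b : List ℕ+} (h : a = b) :
    (strands h).eval = eqToHom (congrArg Rep.ofSeq h) := by
  subst h; rfl

/-- All V(a) have the same underlying space, so the relabelling of (x+y)+z as x+(y+z) becomes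
invisible there. -/
theorem toLin_eval_strands_singleton {x y : ℕ+} (h : [x] = [y]) :
    Rep.toLin (M := Rep.ofSeq [x]) (N := Rep.ofSeq [y]) (strands h).eval =
      (LinearMap.id : (Fin 2 → Kq) →ₗ[Kq] (Fin 2 → Kq)) := by
  cases h; rfl

theorem toLin_eval_splitLeft (x y z : ℕ+) :
    Rep.toLin (M := Rep.ofSeq [x + y, z]) (N := Rep.ofSeq [x, y, z]) (splitLeft x y z).eval =
      (TensorProduct.assoc Kq _ _ _).toLinearMap ∘ₗ
        TensorProduct.map (phiSplit x) (LinearMap.id : (Fin 2 → Kq) →ₗ[Kq] (Fin 2 → Kq)) := by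
  have h : (splitLeft x y z).eval = (Rep.concatIso [x + y] [z]).inv ≫
      (splitHom x y ⊗ₘ 𝟙 (Rep.ofSeq [z])) ≫ (Rep.concatIso [x, y] [z]).hom := rfl
  rw [h, Rep.concatIso_pair x y z []]
  rfl

theorem toLin_eval_mergeLeft (x y z : ℕ+) :
    Rep.toLin (M := Rep.ofSeq [x, y, z]) (N := Rep.ofSeq [x + y, z]) (mergeLeft x y z).eval =
      TensorProduct.map (phiMerge x y) (LinearMap.id : (Fin 2 → Kq) →ₗ[Kq] (Fin 2 → Kq)) ∘ₗ
        (TensorProduct.assoc Kq _ _ _).symm.toLinearMap := by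
  refine Eq.trans (congrArg (fun i => Rep.toLin (Iso.inv i ≫
    (mergeHom x y ⊗ₘ 𝟙 (Rep.ofSeq [z])) ≫ (Rep.concatIso [x + y] [z]).hom))
    (Rep.concatIso_pair x y z [])) ?_
  rfl

theorem toLin_eval_dumbbell₁ :
    Rep.toLin (M := Rep.ofSeq [1, 1, 1]) (N := Rep.ofSeq [1, 1, 1]) dumbbell₁.eval =
      phiDumbbell₁ := by
  refine Eq.trans (congrArg (fun i => Rep.toLin (Iso.inv i ≫
    (dumbbell.eval ⊗ₘ 𝟙 (Rep.ofSeq [1])) ≫ i.hom)) (Rep.concatIso_pair 1 1 1 [])) ?_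
  rfl

theorem toLin_eval_dumbbell₂ :
    Rep.toLin (M := Rep.ofSeq [1, 1, 1]) (N := Rep.ofSeq [1, 1, 1]) dumbbell₂.eval =
      phiDumbbell₂ := by
  rfl

theorem eval_digon (x y : ℕ+) : (comp (split x y) (merge x y)).eval =
    (smul (qBinom (x + y) x) (id [x + y])).eval := by
  refine Rep.hom_ext ?_
  simp only [eval, Rep.toLin_comp, Rep.toLin_smul, Rep.toLin_id]
  generalize hc : qBinom (x + y) x = c
  have h := phiSplit_phiMerge x.pos y.pos
  rw [hc] at h
  exact h

theorem eval_merge_assoc (x y z : ℕ+) :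
    (comp (comp (mergeLeft x y z) (merge (x + y) z)) (strands (assoc_label x y z))).eval =
      (comp (mergeRight x y z) (merge x (y + z))).eval := by
  have h := phiMerge_assoc x.pos y.pos z.pos
  rw [← PNat.add_coe, ← PNat.add_coe] at h
  refine Rep.hom_ext ?_
  refine Eq.trans (congrArg₂
    (fun (u : (Fin 2 → Kq) →ₗ[Kq] (Fin 2 → Kq))
      (v : (Fin 2 → Kq) ⊗[Kq] ((Fin 2 → Kq) ⊗[Kq] (Fin 2 → Kq)) →ₗ[Kq]
        (Fin 2 → Kq) ⊗[Kq] (Fin 2 → Kq)) => u ∘ₗ phiMerge (x + y : ℕ+) z ∘ₗ v)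
    (toLin_eval_strands_singleton (assoc_label x y z)) (toLin_eval_mergeLeft x y z)) ?_
  rw [LinearMap.id_comp]
  exact h

theorem eval_split_assoc (x y z : ℕ+) :
    (comp (split (x + y) z) (splitLeft x y z)).eval =
      (comp (strands (assoc_label x y z)) (comp (split x (y + z)) (splitRight x y z))).eval := by
  have h := phiSplit_assoc x y
  rw [← PNat.add_coe] at h
  refine Rep.hom_ext ?_
  refine Eq.trans (congrArg
      (fun (v : (Fin 2 → Kq) ⊗[Kq] (Fin 2 → Kq) →ₗ[Kq]
        (Fin 2 → Kq) ⊗[Kq] ((Fin 2 → Kq) ⊗[Kq] (Fin 2 → Kq))) => v ∘ₗ phiSplit (x + y : ℕ+))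
    (toLin_eval_splitLeft x y z)) ?_
  refine h.trans ?_
  refine Eq.trans ?_ (congrArg
    (fun (u : (Fin 2 → Kq) →ₗ[Kq] (Fin 2 → Kq)) => (TensorProduct.map
      (LinearMap.id : (Fin 2 → Kq) →ₗ[Kq] (Fin 2 → Kq)) (phiSplit y) ∘ₗ phiSplit x) ∘ₗ u)
    (toLin_eval_strands_singleton (assoc_label x y z))).symm
  rfl

theorem eval_braid : (add (comp (comp dumbbell₁ dumbbell₂) dumbbell₁) dumbbell₂).eval =
    (add (comp (comp dumbbell₂ dumbbell₁) dumbbell₂) dumbbell₁).eval := by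
  refine Rep.hom_ext ?_
  simp only [eval, Rep.toLin_comp, Rep.toLin_add]
  erw [toLin_eval_dumbbell₁, toLin_eval_dumbbell₂]
  exact phiDumbbell_braid

/-- The relations of linearity and isotopy hold in any linear monoidal category, given coherence of
`Rep.concatIso`; only the last four cases depend on the maps Φ. -/
theorem eval_eq_of_rel {a b : List ℕ+} {f g : WebExpr a b} (h : Rel f g) : f.eval = g.eval := by
  induction h with
  | refl f => rfl
  | symm _ ih => exact ih.symm
  | trans _ _ ih ih' => exact ih.trans ih'
  | comp_congr _ _ ih ih' => exact congrArg₂ (· ≫ ·) ih ih'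
  | tensor_congr _ _ ih ih' => simp only [eval, ih, ih']
  | add_congr _ _ ih ih' => exact congrArg₂ (· + ·) ih ih'
  | smul_congr r _ ih => exact congrArg (r • ·) ih
  | add_assoc f g h => exact _root_.add_assoc _ _ _
  | add_comm f g => exact _root_.add_comm _ _
  | zero_add f => exact _root_.zero_add _
  | zero_smul f => exact _root_.zero_smul _ _
  | one_smul f => exact _root_.one_smul _ _
  | mul_smul r s f => exact SemigroupAction.mul_smul _ _ _
  | add_smul r s f => exact _root_.add_smul _ _ _
  | smul_add r f g => exact _root_.smul_add _ _ _
  | add_comp f f' g => exact Preadditive.add_comp _ _ _ _ _ _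
  | comp_add f g g' => exact Preadditive.comp_add _ _ _ _ _ _
  | smul_comp r f g => exact Linear.smul_comp _ _ _ _ _ _
  | comp_smul r f g => exact Linear.comp_smul _ _ _ _ _ _
  | add_tensor f f' g =>
    simp only [eval, add_tensorHom, Preadditive.add_comp, Preadditive.comp_add]
  | tensor_add f g g' =>
    simp only [eval, tensorHom_add, Preadditive.add_comp, Preadditive.comp_add]
  | smul_tensor r f g =>
    simp only [eval, smul_tensorHom, Linear.smul_comp, Linear.comp_smul]
  | tensor_smul r f g =>
    simp only [eval, tensorHom_smul, Linear.smul_comp, Linear.comp_smul]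
  | id_comp f => exact Category.id_comp _
  | comp_id f => exact Category.comp_id _
  | comp_assoc f g h => exact Category.assoc _ _ _
  | id_tensor_id a b =>
    simp only [eval, id_tensorHom_id, Category.id_comp, Iso.inv_hom_id]
  | interchange f g f' g' => exact tensor_interchange_of_iso _ _ _ _ _ _ _
  | tensor_assoc f g h =>
    simp only [eval, eval_strands]
    exact tensor_assoc_of_coherent _ _ _ _ _ _ _ _ _ _ _ _ _
      (Rep.concatIso_assoc _ _ _) (Rep.concatIso_assoc _ _ _)
  | nil_tensor f => exact id_tensor_of_leftUnitor f.eval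
  | tensor_nil f =>
    simp only [eval, eval_strands]
    exact tensor_id_of_rightUnitor _ _ _ _ _ (Rep.concatIso_nil_right _)
      (Rep.concatIso_nil_right _)
  | digon x y => exact eval_digon x y
  | merge_assoc x y z => exact eval_merge_assoc x y z
  | split_assoc x y z => exact eval_split_assoc x y z
  | braid => exact eval_braid

end WebExpr

/-- The functor `𝐚 ↦ V(𝐚)`, `merge x y ↦ Φ_{x,y}`, `split x y ↦ Φ^{x,y}`. -/
def webFunctor : Web ⥤ Rep where
  obj a := Rep.ofSeq a.labels
  map {a b} f := Quotient.lift (s := WebExpr.setoid a.labels b.labels) WebExpr.eval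
    (fun _ _ h => WebExpr.eval_eq_of_rel h) f
  map_id _ := rfl
  map_comp f g := by
    obtain ⟨f, rfl⟩ := Web.ofExpr_surjective f
    obtain ⟨g, rfl⟩ := Web.ofExpr_surjective g
    rfl

theorem webFunctor_map_tensor {a b c d : Web} (f : a ⟶ b) (g : c ⟶ d) :
    (Rep.concatIso a.labels c.labels).hom ≫ webFunctor.map (f ⊗ₘ g) =
      (webFunctor.map f ⊗ₘ webFunctor.map g) ≫ (Rep.concatIso b.labels d.labels).hom := by
  obtain ⟨f, rfl⟩ := Web.ofExpr_surjective f
  obtain ⟨g, rfl⟩ := Web.ofExpr_surjective g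
  exact Iso.hom_inv_id_assoc (Rep.concatIso a.labels c.labels) _

/-- The monoidal structure of `webFunctor` through the canonical identifications. -/
def webFunctorCore : webFunctor.CoreMonoidal where
  εIso := Iso.refl _
  μIso a b := Rep.concatIso a.labels b.labels
  μIso_hom_natural_left f X := by
    have h := webFunctor_map_tensor f (𝟙 X)
    rw [CategoryTheory.Functor.map_id, tensorHom_id, tensorHom_id] at h
    exact h.symm
  μIso_hom_natural_right X f := by
    have h := webFunctor_map_tensor (𝟙 X) f
    rw [CategoryTheory.Functor.map_id, id_tensorHom, id_tensorHom] at h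
    exact h.symm
  associativity a b c := by
    have h := Rep.concatIso_assoc a.labels b.labels c.labels
    rw [← WebExpr.eval_strands, Category.assoc] at h
    exact h
  left_unitality a := by
    change _ = 𝟙 (𝟙_ Rep) ▷ Rep.ofSeq a.labels ≫ (λ_ (Rep.ofSeq a.labels)).hom ≫ 𝟙 _
    rw [id_whiskerRight, Category.id_comp, Category.comp_id]
    rfl
  right_unitality a := by
    have h := Rep.concatIso_nil_right a.labels
    rw [← WebExpr.eval_strands (List.append_nil a.labels)] at h
    refine h.symm.trans ((Category.id_comp _).symm.trans ?_)
    exact congrArg (· ≫ (Rep.concatIso a.labels []).hom ≫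
      (WebExpr.strands (List.append_nil a.labels)).eval)
        (MonoidalCategory.whiskerLeft_id (Rep.ofSeq a.labels) (𝟙_ Rep)).symm

instance : webFunctor.Monoidal := webFunctorCore.toMonoidal

theorem webFunctor_extendsAssignment : ExtendsAssignment webFunctor where
  map_add f g := by
    obtain ⟨f, rfl⟩ := Web.ofExpr_surjective f
    obtain ⟨g, rfl⟩ := Web.ofExpr_surjective g
    rfl
  map_smul r f := by
    obtain ⟨f, rfl⟩ := Web.ofExpr_surjective f
    rfl
  obj_eq _ := rfl
  ε_eq := Category.comp_id _
  μ_eq a b := by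
    refine (Category.comp_id (Rep.concatIso a.labels b.labels).hom).trans ?_
    refine Eq.trans ?_ (congrArg (· ≫ (Rep.concatIso a.labels b.labels).hom)
      (id_tensorHom_id (Rep.ofSeq a.labels) (Rep.ofSeq b.labels)).symm)
    exact (Category.id_comp _).symm
  map_merge x y := rfl
  map_split x y := rfl

/-! ### Density -/

theorem exists_iso_ofSeq {M : SuperRep} (h : IsRepObj M) :
    ∃ l : List ℕ+, Nonempty (Rep.ofSeq l ≅ (⟨M, h⟩ : Rep)) := by
  induction h with
  | unit => exact ⟨[], ⟨Iso.refl _⟩⟩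
  | V a => exact ⟨[a], ⟨Iso.refl _⟩⟩
  | tensor M N hM hN ihM ihN =>
    obtain ⟨l, ⟨e⟩⟩ := ihM
    obtain ⟨m, ⟨f⟩⟩ := ihN
    exact ⟨l ++ m, ⟨(Rep.concatIso l m).symm ≪≫ (e ⊗ᵢ f)⟩⟩

instance : webFunctor.EssSurj where
  mem_essImage M := by
    obtain ⟨l, h⟩ := exists_iso_ofSeq M.property
    exact ⟨⟨l⟩, h⟩

/-! ### Uniqueness -/

section

variable {C : Type*} [Category C] [MonoidalCategory C]

/-- The tensor case of uniqueness. Naturality of the tensorator (`hF`) and its prescribed form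
(`hm`, `hn`) determine the value `F` on a juxtaposition from the values `f`, `g` on its parts. -/
theorem conj_tensor {A B D E A' B' D' E' X Y X' Y' : C} (f : A ⟶ B) (g : D ⟶ E)
    (f' : A' ⟶ B') (g' : D' ⟶ E') (a : A ≅ A') (b : B ≅ B') (d : D ≅ D') (e : E ≅ E')
    (x : X ≅ X') (y : Y ≅ Y') (m : A ⊗ D ⟶ X) (n : B ⊗ E ≅ Y) (i : A' ⊗ D' ≅ X')
    (j : B' ⊗ E' ≅ Y') (F : X ⟶ Y)
    (hf : a.inv ≫ f ≫ b.hom = f') (hg : d.inv ≫ g ≫ e.hom = g')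
    (hm : m ≫ x.hom = (a.hom ⊗ₘ d.hom) ≫ i.hom)
    (hn : n.hom ≫ y.hom = (b.hom ⊗ₘ e.hom) ≫ j.hom) (hF : (f ⊗ₘ g) ≫ n.hom = m ≫ F) :
    x.inv ≫ F ≫ y.hom = i.inv ≫ (f' ⊗ₘ g') ≫ j.hom := by
  have hm' : m = (a.hom ⊗ₘ d.hom) ≫ i.hom ≫ x.inv := by
    rw [← Category.assoc, ← hm, Category.assoc, Iso.hom_inv_id, Category.comp_id]
  have h1 : i.hom ≫ x.inv = (a.inv ⊗ₘ d.inv) ≫ m := by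
    rw [hm', tensorHom_comp_tensorHom_assoc]
    simp
  rw [Iso.eq_inv_comp, ← Category.assoc, h1, Category.assoc, ← Category.assoc m, ← hF,
    Category.assoc, hn, tensorHom_comp_tensorHom_assoc, tensorHom_comp_tensorHom_assoc, Category.assoc,
    Category.assoc, hf, hg]

end

/-- Every morphism of `Web` is represented by an expression, so agreement with `eval` on expressions
leaves no freedom for `T`. -/
theorem ExtendsAssignment.map_ofExpr {T : Web ⥤ Rep} [T.Monoidal] (hT : ExtendsAssignment T)
    {a b : List ℕ+} (f : WebExpr a b) :
    (eqToIso (hT.obj_eq ⟨a⟩)).inv ≫ T.map (Web.ofExpr f) ≫ (eqToIso (hT.obj_eq ⟨b⟩)).hom =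
      f.eval := by
  induction f with
  | id a =>
    erw [show Web.ofExpr (WebExpr.id a) = 𝟙 (⟨a⟩ : Web) from rfl, T.map_id, Category.id_comp,
      Iso.inv_hom_id]
    rfl
  | comp f g ihf ihg =>
    rw [show Web.ofExpr (WebExpr.comp f g) = Web.ofExpr f ≫ Web.ofExpr g from rfl, T.map_comp,
      WebExpr.eval, ← ihf, ← ihg]
    simp only [Category.assoc, Iso.hom_inv_id_assoc]
  | @tensor a b c d f g ihf ihg =>
    rw [show Web.ofExpr (WebExpr.tensor f g) = Web.ofExpr f ⊗ₘ Web.ofExpr g from rfl]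
    exact conj_tensor (T.map (Web.ofExpr f)) (T.map (Web.ofExpr g)) f.eval g.eval _ _ _ _
      (eqToIso (hT.obj_eq (⟨a⟩ ⊗ ⟨c⟩))) (eqToIso (hT.obj_eq (⟨b⟩ ⊗ ⟨d⟩))) 
      (Functor.LaxMonoidal.μ T ⟨a⟩ ⟨c⟩) (Functor.Monoidal.μIso T ⟨b⟩ ⟨d⟩) _ _ _ ihf ihg
      (hT.μ_eq _ _) (hT.μ_eq _ _) (Functor.LaxMonoidal.μ_natural T _ _)
  | merge x y => exact Rep.hom_ext (hT.map_merge x y)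
  | split x y => exact Rep.hom_ext (hT.map_split x y)
  | zero a b =>
    -- Preservation of zero is extracted from homogeneity at the scalar 0.
    have h := hT.map_smul (0 : Kq) (0 : (⟨a⟩ : Web) ⟶ ⟨b⟩)
    rw [zero_smul, zero_smul] at h
    rw [show Web.ofExpr (WebExpr.zero a b) = 0 from rfl, h, Limits.zero_comp, Limits.comp_zero]
    rfl
  | add f g ihf ihg =>
    rw [show Web.ofExpr (WebExpr.add f g) = Web.ofExpr f + Web.ofExpr g from rfl, hT.map_add,
      WebExpr.eval, ← ihf, ← ihg, Preadditive.add_comp, Preadditive.comp_add]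
  | smul r f ih =>
    rw [show Web.ofExpr (WebExpr.smul r f) = r • Web.ofExpr f from rfl, hT.map_smul,
      WebExpr.eval, ← ih, Linear.smul_comp, Linear.comp_smul]

theorem ExtendsAssignment.unique {T T' : Web ⥤ Rep} [T.Monoidal] [T'.Monoidal]
    (hT : ExtendsAssignment T) (hT' : ExtendsAssignment T') : T = T' := by
  refine CategoryTheory.Functor.ext (fun a => (hT.obj_eq a).trans (hT'.obj_eq a).symm) fun a b f => ?_
  obtain ⟨f, rfl⟩ := Web.ofExpr_surjective f
  have h := (hT.map_ofExpr f).trans (hT'.map_ofExpr f).symm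
  rw [Iso.inv_comp_eq, ← Iso.eq_comp_inv] at h
  simpa using h

/-! ### Commutants in Clifford algebras -/

section Clifford

variable {k A : Type*} [Field k] [Ring A] [Algebra k A]

/-- The elements whose left multiplication maps `S` into itself form a subalgebra; apply such an
element to 1. -/
theorem adjoin_le_of_mul_mem {s : Set A} (S : Submodule k A) (h1 : (1 : A) ∈ S)
    (h : ∀ g ∈ s, ∀ x ∈ S, g * x ∈ S) {a : A} (ha : a ∈ Algebra.adjoin k s) : a ∈ S := by
  have key : ∀ x ∈ S, a * x ∈ S := by
    induction ha using Algebra.adjoin_induction with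
    | mem g hg => exact h g hg
    | algebraMap r =>
      intro x hx
      rw [← Algebra.smul_def]
      exact S.smul_mem r hx
    | add a b _ _ iha ihb =>
      intro x hx
      rw [add_mul]
      exact S.add_mem (iha x hx) (ihb x hx)
    | mul a b _ _ iha ihb =>
      intro x hx
      rw [mul_assoc]
      exact iha _ (ihb x hx)
  simpa using key 1 h1

/-- The elements that commute with `L` up to the scalar `μ`. -/
def quasiCommutant (k : Type*) [Field k] [Algebra k A] (L : A) (μ : k) : Submodule k A where
  carrier := {x | L * x = μ • (x * L)}
  add_mem' {x y} hx hy := by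
    simp only [Set.mem_ofPred_eq] at *
    rw [mul_add, add_mul, smul_add, hx, hy]
  zero_mem' := by simp
  smul_mem' r x hx := by
    simp only [Set.mem_ofPred_eq] at *
    rw [mul_smul_comm, hx, smul_mul_assoc, smul_comm]

theorem mem_quasiCommutant {L x : A} {μ : k} :
    x ∈ quasiCommutant k L μ ↔ L * x = μ • (x * L) := Iff.rfl

theorem mul_mem_quasiCommutant {L x y : A} {μ ν : k} (hx : x ∈ quasiCommutant k L μ)
    (hy : y ∈ quasiCommutant k L ν) : x * y ∈ quasiCommutant k L (μ * ν) := by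
  rw [mem_quasiCommutant] at *
  rw [← mul_assoc, hx, smul_mul_assoc, mul_assoc, hy, mul_smul_comm, smul_smul, mul_assoc]

theorem pow_le_quasiCommutant {L : A} {μ : k} {S : Submodule k A}
    (h : S ≤ quasiCommutant k L μ) (n : ℕ) : S ^ n ≤ quasiCommutant k L (μ ^ n) := by
  induction n with
  | zero =>
    rw [pow_zero, pow_zero, Submodule.one_le, mem_quasiCommutant]
    simp
  | succ n ih =>
    rw [pow_succ, pow_succ, Submodule.mul_le]
    exact fun x hx y hy => mul_mem_quasiCommutant (ih hx) (h hy)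

/-- The quasi-commutants are the eigenspaces of conjugation x ↦ L x L⁻¹, and eigenspaces are
independent. This plays the role of the decomposition by degree. -/
theorem disjoint_quasiCommutant {L L' : A} (h : L * L' = 1) (h' : L' * L = 1) :
    Disjoint (quasiCommutant k L (1 : k)) (⨆ μ ≠ (1 : k), quasiCommutant k L μ) := by
  have key : ∀ μ : k, quasiCommutant k L μ =
      Module.End.eigenspace (LinearMap.mulLeft k L ∘ₗ LinearMap.mulRight k L') μ := by
    intro μ
    ext x
    rw [mem_quasiCommutant, Module.End.mem_eigenspace_iff, LinearMap.comp_apply,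
      LinearMap.mulLeft_apply, LinearMap.mulRight_apply]
    constructor
    · intro hx
      rw [← mul_assoc, hx, smul_mul_assoc, mul_assoc, h, mul_one]
    · intro hx
      rw [← smul_mul_assoc, ← hx, mul_assoc, mul_assoc, h', mul_one]
  simp only [key]
  exact Module.End.eigenspaces_iSupIndep _ 1

/-- The submodule product `S * T` when moved past: `S * adjoin s ≤ adjoin s * S`. -/
theorem mul_adjoin_le {s : Set A} (S : Submodule k A)
    (h : ∀ g ∈ s, ∀ x ∈ S, x * g ∈ Subalgebra.toSubmodule (Algebra.adjoin k s) * S) :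
    S * Subalgebra.toSubmodule (Algebra.adjoin k s) ≤
      Subalgebra.toSubmodule (Algebra.adjoin k s) * S := by
  rw [Submodule.mul_le]
  intro x hx a ha
  rw [Subalgebra.mem_toSubmodule] at ha
  induction ha using Algebra.adjoin_induction generalizing x with
  | mem g hg => exact h g hg x hx
  | algebraMap r =>
    rw [← Algebra.commutes]
    exact Submodule.mul_mem_mul (Subalgebra.algebraMap_mem _ r) hx
  | add a b _ _ iha ihb =>
    rw [mul_add]
    exact Submodule.add_mem _ (iha x hx) (ihb x hx)
  | mul a b _ _ iha ihb =>
    -- After moving `a`, the element x a lies only in `adjoin s * S`, so `b` has to be moved past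
    -- this product.
    have h1 : Subalgebra.toSubmodule (Algebra.adjoin k s) * S * Submodule.span k {b} ≤
        Subalgebra.toSubmodule (Algebra.adjoin k s) * S := by
      rw [mul_assoc]
      have h2 : S * Submodule.span k {b} ≤ Subalgebra.toSubmodule (Algebra.adjoin k s) * S := by
        rw [Submodule.mul_le]
        intro y hy z hz
        obtain ⟨r, rfl⟩ := Submodule.mem_span_singleton.1 hz
        rw [mul_smul_comm]
        exact Submodule.smul_mem _ r (ihb y hy)
      calc _ ≤ Subalgebra.toSubmodule (Algebra.adjoin k s) *
            (Subalgebra.toSubmodule (Algebra.adjoin k s) * S) := mul_le_mul_right h2 _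
        _ = _ := by rw [← mul_assoc, (Subalgebra.isIdempotentElem_toSubmodule _).eq]
    rw [← mul_assoc]
    exact h1 (Submodule.mul_mem_mul (iha x hx) (Submodule.mem_span_singleton_self b))

variable {ι : Type*} {X Y : ι → A} {g : ι → ι → k}

/-- The algebra generated by the products `X i * Y j`. -/
abbrev bilinears (k : Type*) [Field k] [Algebra k A] (X Y : ι → A) : Subalgebra k A :=
  Algebra.adjoin k (Set.range fun p : ι × ι => X p.1 * Y p.2)

/-- A normal form by degree. The spans of X and of Y can be moved past the algebra A₀ of bilinears,
and the products XY and YX fall into A₀. So left multiplication by X raises A₀ X^n and lowers A₀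
Y^n, symmetrically for Y, and the sum of all these spaces is stable. -/
theorem adjoin_le_bilinears
    (hXX : ∀ i j, X i * X j = -(X j * X i)) (hYY : ∀ i j, Y i * Y j = -(Y j * Y i))
    (hYX : ∀ i j, Y j * X i = algebraMap k A (g i j) - X i * Y j) :
    Subalgebra.toSubmodule (Algebra.adjoin k (Set.range X ∪ Set.range Y)) ≤
      (⨆ n : ℕ, Subalgebra.toSubmodule (bilinears k X Y) * Submodule.span k (Set.range X) ^ n) ⊔
      ⨆ n : ℕ, Subalgebra.toSubmodule (bilinears k X Y) * Submodule.span k (Set.range Y) ^ n := by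
  set A₀ := Subalgebra.toSubmodule (bilinears k X Y) with hA₀
  set SX := Submodule.span k (Set.range X)
  set SY := Submodule.span k (Set.range Y)
  have hX : ∀ i, X i ∈ SX := fun i => Submodule.subset_span ⟨i, rfl⟩
  have hY : ∀ i, Y i ∈ SY := fun i => Submodule.subset_span ⟨i, rfl⟩
  have hXY0 : ∀ i j, X i * Y j ∈ A₀ := fun i j => Algebra.subset_adjoin ⟨(i, j), rfl⟩
  have hsc : ∀ r, algebraMap k A r ∈ A₀ := fun r => Subalgebra.algebraMap_mem _ r
  have h1A : (1 : A) ∈ A₀ := Subalgebra.one_mem _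
  have hAA : A₀ * A₀ = A₀ := Subalgebra.isIdempotentElem_toSubmodule _
  have hXA : SX * A₀ ≤ A₀ * SX := by
    refine mul_adjoin_le SX ?_
    rintro _ ⟨⟨j, l⟩, rfl⟩ x hx
    induction hx using Submodule.span_induction with
    | mem x hx =>
      obtain ⟨i, rfl⟩ := hx
      have : X i * (X j * Y l) = (X j * Y l) * X i - algebraMap k A (g i l) * X j := by
        rw [mul_assoc (X j), hYX, mul_sub, ← mul_assoc, hXX i j, Algebra.commutes]
        noncomm_ring
      rw [this]
      exact Submodule.sub_mem _ (Submodule.mul_mem_mul (hXY0 j l) (hX i))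
        (Submodule.mul_mem_mul (hsc _) (hX j))
    | zero => simp
    | add x y _ _ hx hy => rw [add_mul]; exact Submodule.add_mem _ hx hy
    | smul r x _ hx => rw [smul_mul_assoc]; exact Submodule.smul_mem _ r hx
  have hYA : SY * A₀ ≤ A₀ * SY := by
    refine mul_adjoin_le SY ?_
    rintro _ ⟨⟨j, l⟩, rfl⟩ x hx
    induction hx using Submodule.span_induction with
    | mem x hx =>
      obtain ⟨i, rfl⟩ := hx
      have : Y i * (X j * Y l) = algebraMap k A (g j i) * Y l + (X j * Y l) * Y i := by
        rw [← mul_assoc, hYX, sub_mul, mul_assoc (X j), mul_assoc (X j), hYY i l]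
        noncomm_ring
      rw [this]
      exact Submodule.add_mem _ (Submodule.mul_mem_mul (hsc _) (hY l))
        (Submodule.mul_mem_mul (hXY0 j l) (hY i))
    | zero => simp
    | add x y _ _ hx hy => rw [add_mul]; exact Submodule.add_mem _ hx hy
    | smul r x _ hx => rw [smul_mul_assoc]; exact Submodule.smul_mem _ r hx
  have hXY : SX * SY ≤ A₀ := by
    rw [Submodule.span_mul_span, Submodule.span_le]
    rintro _ ⟨_, ⟨i, rfl⟩, _, ⟨j, rfl⟩, rfl⟩
    exact hXY0 i j
  have hYX' : SY * SX ≤ A₀ := by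
    rw [Submodule.span_mul_span, Submodule.span_le]
    rintro _ ⟨_, ⟨i, rfl⟩, _, ⟨j, rfl⟩, rfl⟩
    simp only [hYX]
    exact Submodule.sub_mem _ (hsc _) (hXY0 _ _)
  have step : ∀ {P Q : Submodule k A}, P * A₀ ≤ A₀ * P → P * Q ≤ A₀ → ∀ n : ℕ,
      P * (A₀ * Q ^ (n + 1)) ≤ A₀ * Q ^ n := by
    intro P Q h h' n
    calc P * (A₀ * Q ^ (n + 1)) = (P * A₀) * (Q * Q ^ n) := by rw [pow_succ', mul_assoc]
      _ ≤ (A₀ * P) * (Q * Q ^ n) := mul_le_mul_left h _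
      _ = A₀ * (P * Q) * Q ^ n := by simp only [mul_assoc]
      _ ≤ A₀ * A₀ * Q ^ n := mul_le_mul_left (mul_le_mul_right h' _) _
      _ = _ := by rw [hAA]
  have step' : ∀ {P : Submodule k A}, P * A₀ ≤ A₀ * P → ∀ n : ℕ,
      P * (A₀ * P ^ n) ≤ A₀ * P ^ (n + 1) := by
    intro P h n
    calc P * (A₀ * P ^ n) = (P * A₀) * P ^ n := by rw [mul_assoc]
      _ ≤ (A₀ * P) * P ^ n := mul_le_mul_left h _
      _ = _ := by rw [pow_succ', mul_assoc]
  have lX : ∀ n : ℕ, A₀ * SX ^ n ≤ (⨆ n : ℕ, A₀ * SX ^ n) ⊔ ⨆ n : ℕ, A₀ * SY ^ n := fun n =>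
    (le_iSup (fun n : ℕ => A₀ * SX ^ n) n).trans le_sup_left
  have lY : ∀ n : ℕ, A₀ * SY ^ n ≤ (⨆ n : ℕ, A₀ * SX ^ n) ⊔ ⨆ n : ℕ, A₀ * SY ^ n := fun n =>
    (le_iSup (fun n : ℕ => A₀ * SY ^ n) n).trans le_sup_right
  have closeX : SX * ((⨆ n : ℕ, A₀ * SX ^ n) ⊔ ⨆ n : ℕ, A₀ * SY ^ n) ≤
      (⨆ n : ℕ, A₀ * SX ^ n) ⊔ ⨆ n : ℕ, A₀ * SY ^ n := by
    rw [Submodule.mul_sup, Submodule.mul_iSup, Submodule.mul_iSup]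
    refine sup_le (iSup_le fun n => (step' hXA n).trans (lX _)) (iSup_le fun n => ?_)
    cases n with
    -- There is no Y left to cancel, so X A₀ moves over to the X side in degree one.
    | zero =>
      refine le_trans ?_ (lX 1)
      simpa using hXA
    | succ n => exact (step hXA hXY n).trans (lY _)
  have closeY : SY * ((⨆ n : ℕ, A₀ * SX ^ n) ⊔ ⨆ n : ℕ, A₀ * SY ^ n) ≤
      (⨆ n : ℕ, A₀ * SX ^ n) ⊔ ⨆ n : ℕ, A₀ * SY ^ n := by
    rw [Submodule.mul_sup, Submodule.mul_iSup, Submodule.mul_iSup]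
    refine sup_le (iSup_le fun n => ?_) (iSup_le fun n => (step' hYA n).trans (lY _))
    cases n with
    | zero =>
      refine le_trans ?_ (lY 1)
      simpa using hYA
    | succ n => exact (step hYA hYX' n).trans (lX _)
  intro a ha
  refine adjoin_le_of_mul_mem _ (lX 0 (by simpa using h1A)) ?_ ha
  rintro _ (⟨i, rfl⟩ | ⟨i, rfl⟩) x hx
  · exact closeX (Submodule.mul_mem_mul (hX i) hx)
  · exact closeY (Submodule.mul_mem_mul (hY i) hx)

/-- In an algebra that is generated by `E`, `F` and by elements `X i`, `Y j` which anticommute with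
`E` and `F`, with Clifford relations, an element of degree zero that commutes with `E` and `F`
is a polynomial in the products `X i * Y j`. -/
theorem mem_bilinears_of_commute {E F L L' : A} {s t : k} (hs : s ≠ 0) (ht0 : t ≠ 0)
    (ht : ∀ n : ℕ, n ≠ 0 → t ^ n ≠ 1)
    (hXX : ∀ i j, X i * X j = -(X j * X i)) (hYY : ∀ i j, Y i * Y j = -(Y j * Y i))
    (hYX : ∀ i j, Y j * X i = algebraMap k A (g i j) - X i * Y j)
    (hXE : ∀ i, E * X i = -(X i * E)) (hXF : ∀ i, F * X i = -(X i * F))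
    (hYE : ∀ i, E * Y i = -(Y i * E)) (hYF : ∀ i, F * Y i = -(Y i * F))
    (hE : E * E = 0) (hF : F * F = 0) (hEF : E * F + F * E = algebraMap k A s)
    (hL : L * L' = 1) (hL' : L' * L = 1)
    (hLX : ∀ i, L * X i = t • (X i * L)) (hLY : ∀ i, L * Y i = t⁻¹ • (Y i * L))
    (hLE : L * E = t⁻¹ • (E * L)) (hLF : L * F = t • (F * L))
    (hgen : Algebra.adjoin k ({E, F} ∪ (Set.range X ∪ Set.range Y)) = ⊤)
    {T : A} (hTE : T * E = E * T) (hTF : T * F = F * T) (hTL : T * L = L * T) :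
    T ∈ bilinears k X Y := by
  set B := Algebra.adjoin k (Set.range X ∪ Set.range Y) with hB
  -- p² = s p, so s⁻¹p is an idempotent; p commutes with the algebra B generated by X and Y, and pE
  -- = 0.
  obtain ⟨p, hp⟩ : ∃ p, p = F * E := ⟨_, rfl⟩
  have hFp : F * p = 0 := by rw [hp, ← mul_assoc, hF, zero_mul]
  have hpE : p * E = 0 := by rw [hp, mul_assoc, hE, mul_zero]
  have hFE : F * E = algebraMap k A s - E * F := by rw [← hEF]; abel
  have hpp : p * p = s • p := by
    have : p * p = F * (E * F) * E := by rw [hp]; noncomm_ring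
    rw [this, show E * F = algebraMap k A s - F * E by rw [← hEF]; abel, mul_sub, ← mul_assoc F F,
      hF, zero_mul, sub_zero, ← Algebra.commutes, mul_assoc, Algebra.smul_def, hp]
  have hanti : ∀ z ∈ Set.range X ∪ Set.range Y, E * z = -(z * E) ∧ F * z = -(z * F) := by
    rintro _ (⟨i, rfl⟩ | ⟨i, rfl⟩)
    · exact ⟨hXE i, hXF i⟩
    · exact ⟨hYE i, hYF i⟩
  have hFb : ∀ b ∈ B, F * b * p = 0 := by
    intro b hb
    let S : Submodule k A := LinearMap.ker (LinearMap.mulRight k p ∘ₗ LinearMap.mulLeft k F)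
    refine adjoin_le_of_mul_mem S (s := Set.range X ∪ Set.range Y) ?_ ?_ hb
    · change F * 1 * p = 0
      rw [mul_one, hFp]
    · intro z hz x hx
      change F * (z * x) * p = 0
      have hx' : F * x * p = 0 := hx
      rw [← mul_assoc, (hanti z hz).2, neg_mul, neg_mul, mul_assoc z, mul_assoc z, hx', mul_zero,
        neg_zero]
  have hpb : ∀ b ∈ B, p * b = b * p := by
    intro b hb
    have : B ≤ Subalgebra.centralizer k {p} := by
      refine Algebra.adjoin_le fun z hz => ?_
      rw [SetLike.mem_coe, Subalgebra.mem_centralizer_iff]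
      rintro _ rfl
      obtain ⟨h1, h2⟩ := hanti z hz
      rw [hp, mul_assoc, h1, mul_neg, ← mul_assoc, h2, neg_mul, neg_neg, mul_assoc]
    exact Subalgebra.mem_centralizer_iff k |>.1 (this hb) p rfl
  -- Elements x for which xp has the normal form bp + Eb'p. They are stable under left
  -- multiplication by E since E² = 0, by F since F b p = 0 and FE = s - EF, and by X and Y since
  -- these anticommute with E.
  let M : Submodule k A :=
    { carrier := {x | ∃ b ∈ B, ∃ b' ∈ B, x * p = b * p + E * (b' * p)}
      add_mem' := by
        rintro x y ⟨b, hb, b', hb', h⟩ ⟨c, hc, c', hc', h'⟩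
        refine ⟨b + c, B.add_mem hb hc, b' + c', B.add_mem hb' hc', ?_⟩
        rw [add_mul, h, h']
        noncomm_ring
      zero_mem' := ⟨0, B.zero_mem, 0, B.zero_mem, by simp⟩
      smul_mem' := by
        rintro r x ⟨b, hb, b', hb', h⟩
        refine ⟨r • b, B.smul_mem hb r, r • b', B.smul_mem hb' r, ?_⟩
        rw [smul_mul_assoc, h, smul_add, smul_mul_assoc, smul_mul_assoc, mul_smul_comm] }
  have hM : T ∈ M := by
    have hT : T ∈ Algebra.adjoin k ({E, F} ∪ (Set.range X ∪ Set.range Y)) := by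
      rw [hgen]; trivial
    refine adjoin_le_of_mul_mem M ⟨1, B.one_mem, 0, B.zero_mem, by simp⟩ ?_ hT
    rintro z hz x ⟨b, hb, b', hb', h⟩
    rcases hz with (rfl | rfl) | hz
    · refine ⟨0, B.zero_mem, b, hb, ?_⟩
      rw [mul_assoc, h, mul_add, ← mul_assoc z z, hE]
      simp
    · refine ⟨s • b', B.smul_mem hb' s, 0, B.zero_mem, ?_⟩
      rw [mul_assoc, h, mul_add, ← mul_assoc z b, hFb b hb, ← mul_assoc z E, hFE, sub_mul,
        mul_assoc E z, ← mul_assoc z b', hFb b' hb', Algebra.smul_def]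
      simp [mul_assoc]
    · refine ⟨z * b, B.mul_mem (Algebra.subset_adjoin hz) hb, -(z * b'),
        B.neg_mem (B.mul_mem (Algebra.subset_adjoin hz) hb'), ?_⟩
      have := (hanti z hz).1
      rw [mul_assoc, h, mul_add, ← mul_assoc z E, ← neg_eq_iff_eq_neg.2 this]
      noncomm_ring
  obtain ⟨b, hb, b', hb', h⟩ := hM
  -- T commutes with p, so pTp = s Tp, while multiplying the normal form by p on the left kills Eb'p
  -- and gives s bp.
  have hTp : T * p = b * p := by
    have h1 : p * (T * p) = s • (T * p) := by
      rw [← mul_assoc, hp, mul_assoc F E T, ← hTE, ← mul_assoc F T, ← hTF, mul_assoc T F, ← hp,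
        mul_assoc, hpp, mul_smul_comm]
    have h2 : p * (T * p) = s • (b * p) := by
      rw [h, mul_add, ← mul_assoc p E, hpE, zero_mul, add_zero, ← mul_assoc, hpb b hb, mul_assoc,
        hpp, mul_smul_comm]
    exact smul_right_injective A hs (h1.symm.trans h2)
  -- the degree zero part of `b`
  have hWX : Submodule.span k (Set.range X) ≤ quasiCommutant k L t := by
    rw [Submodule.span_le]; rintro _ ⟨i, rfl⟩; exact hLX i
  have hWY : Submodule.span k (Set.range Y) ≤ quasiCommutant k L t⁻¹ := by
    rw [Submodule.span_le]; rintro _ ⟨i, rfl⟩; exact hLY i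
  have hA1 : ∀ a ∈ bilinears k X Y, a ∈ quasiCommutant k L (1 : k) := by
    intro a ha
    have : bilinears k X Y ≤ Subalgebra.centralizer k {L} := by
      refine Algebra.adjoin_le ?_
      rintro _ ⟨⟨i, j⟩, rfl⟩
      rw [SetLike.mem_coe, Subalgebra.mem_centralizer_iff]
      rintro _ rfl
      have := mul_mem_quasiCommutant (hLX i) (hLY j)
      rwa [mul_inv_cancel₀ ht0, mem_quasiCommutant, one_smul] at this
    rw [mem_quasiCommutant, one_smul]
    exact Subalgebra.mem_centralizer_iff k |>.1 (this ha) L rfl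
  have hp1 : p ∈ quasiCommutant k L (1 : k) := by
    have := mul_mem_quasiCommutant hLF hLE
    rwa [mul_inv_cancel₀ ht0, ← hp] at this
  -- On A₀ X^n and A₀ Y^n conjugation by L has the eigenvalues t^n and t^{-n}; these differ from 1
  -- for n > 0 since t is not a root of unity.
  have hsum : Subalgebra.toSubmodule B ≤ Subalgebra.toSubmodule (bilinears k X Y) ⊔
      ⨆ μ ≠ (1 : k), quasiCommutant k L μ := by
    refine (adjoin_le_bilinears hXX hYY hYX).trans ?_
    refine sup_le (iSup_le fun n => ?_) (iSup_le fun n => ?_)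
    · rcases Nat.eq_zero_or_pos n with rfl | hn
      · simp
      · refine le_trans ?_ le_sup_right
        refine le_trans ?_ (le_iSup₂ (f := fun (μ : k) (_ : μ ≠ 1) => quasiCommutant k L μ) (t ^ n)
          (ht n hn.ne'))
        rw [Submodule.mul_le]
        intro a ha x hx
        simpa using mul_mem_quasiCommutant (hA1 a ha) (pow_le_quasiCommutant hWX n hx)
    · rcases Nat.eq_zero_or_pos n with rfl | hn
      · simp
      · refine le_trans ?_ le_sup_right
        refine le_trans ?_ (le_iSup₂ (f := fun (μ : k) (_ : μ ≠ 1) => quasiCommutant k L μ) (t⁻¹ ^ n)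
          (by rw [inv_pow]; exact inv_ne_one.2 (ht n hn.ne')))
        rw [Submodule.mul_le]
        intro a ha x hx
        simpa using mul_mem_quasiCommutant (hA1 a ha) (pow_le_quasiCommutant hWY n hx)
  obtain ⟨a, ha, r, hr, rfl⟩ := Submodule.mem_sup.1 (hsum hb)
  have hrp : r * p ∈ ⨆ μ ≠ (1 : k), quasiCommutant k L μ := by
    have : (⨆ μ ≠ (1 : k), quasiCommutant k L μ) ≤
        (⨆ μ ≠ (1 : k), quasiCommutant k L μ).comap (LinearMap.mulRight k p) := by
      refine iSup₂_le fun μ hμ x hx => ?_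
      refine le_iSup₂ (f := fun (μ : k) (_ : μ ≠ 1) => quasiCommutant k L μ) μ hμ ?_
      simpa using mul_mem_quasiCommutant hx hp1
    exact this hr
  -- The error term rp equals Tp - ap, which has degree zero, and it is also a sum of terms of
  -- nonzero degree; hence it vanishes.
  have hTap : T * p = a * p := by
    rw [add_mul, ← sub_eq_iff_eq_add'] at hTp
    have h1 : r * p ∈ quasiCommutant k L (1 : k) := by
      rw [← hTp]
      refine Submodule.sub_mem _ ?_ ?_
      · have : T ∈ quasiCommutant k L (1 : k) := by
          rw [mem_quasiCommutant, one_smul, hTL]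
        simpa using mul_mem_quasiCommutant this hp1
      · simpa using mul_mem_quasiCommutant (hA1 a ha) hp1
    have h0 := (Submodule.disjoint_def.1 (disjoint_quasiCommutant (k := k) hL hL')) _ h1 hrp
    rwa [h0, sub_eq_zero] at hTp
  -- `T` and `a` agree on the image of `p`, and commute with `E` and `F`
  have hpF : p * F = s • F := by
    rw [hp, mul_assoc, show E * F = algebraMap k A s - F * E by rw [← hEF]; abel, mul_sub,
      ← mul_assoc, hF, zero_mul, sub_zero, ← Algebra.commutes, Algebra.smul_def]
  have hTaF : T * F = a * F := by
    have h1 : s • (T * F) = s • (a * F) := by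
      rw [← mul_smul_comm, ← mul_smul_comm, ← hpF, ← mul_assoc T, ← mul_assoc a, hTap]
    exact smul_right_injective A hs h1
  have haE : a * E = E * a := by
    have : bilinears k X Y ≤ Subalgebra.centralizer k {E} := by
      refine Algebra.adjoin_le ?_
      rintro _ ⟨⟨i, j⟩, rfl⟩
      rw [SetLike.mem_coe, Subalgebra.mem_centralizer_iff]
      rintro _ rfl
      dsimp only
      rw [← mul_assoc, hXE, neg_mul, mul_assoc, hYE, mul_neg, neg_neg, mul_assoc]
    exact (Subalgebra.mem_centralizer_iff k |>.1 (this ha) E rfl).symm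
  -- Write s = EF + FE: then TEF = ETF = EaF = aEF, and TFE = Tp = ap.
  have hTa : T = a := by
    have h1 : s • T = s • a := by
      rw [Algebra.smul_def, Algebra.smul_def, Algebra.commutes, Algebra.commutes, ← hEF, mul_add,
        mul_add, ← mul_assoc T E, ← mul_assoc a E, hTE, haE, mul_assoc E T, mul_assoc E a, hTaF, ← hp,
        hTap]
    exact smul_right_injective A hs h1
  rw [hTa]
  exact ha

end Clifford

/-! ### Canonical anticommutation relations and weighted differences -/

section Fermions

variable {k A : Type*} [Field k] [Ring A] [Algebra k A]

/-- The anticommutator. -/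
def anti (k A : Type*) [Field k] [Ring A] [Algebra k A] : A →ₗ[k] A →ₗ[k] A :=
  LinearMap.mul k A + (LinearMap.mul k A).flip

theorem anti_apply (x y : A) : anti k A x y = x * y + y * x := rfl

theorem anti_comm (x y : A) : anti k A x y = anti k A y x := add_comm _ _

theorem mul_eq_neg_of_anti {x y : A} (h : anti k A x y = 0) : x * y = -(y * x) :=
  eq_neg_of_add_eq_zero_left h

/-- The canonical anticommutation relations for the operators `c i`, `d i`, `i ≤ n`. -/
structure CAR (k : Type*) [Field k] [Algebra k A] (n : ℕ) (c d : ℕ → A) : Prop where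
  cc : ∀ i j, i ≤ n → j ≤ n → anti k A (c i) (c j) = 0
  dd : ∀ i j, i ≤ n → j ≤ n → anti k A (d i) (d j) = 0
  cd : ∀ i j, i ≤ n → j ≤ n → anti k A (c i) (d j) = if i = j then 1 else 0

theorem CAR.symm {n : ℕ} {c d : ℕ → A} (h : CAR k n c d) : CAR k n d c :=
  ⟨h.dd, h.cc, fun i j hi hj => by rw [anti_comm, h.cd j i hj hi]; simp only [eq_comm]⟩

/-- The sum `∑ t ^ i c i`, `i ≤ n`. -/
def weightedSum (n : ℕ) (t : k) (c : ℕ → A) : A := ∑ i ∈ Finset.range (n + 1), t ^ i • c i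

/-- The differences `t c i - c (i + 1)`. -/
def weightedDiff (t : k) (c : ℕ → A) (i : ℕ) : A := t • c i - c (i + 1)

namespace CAR

variable {n : ℕ} {c d : ℕ → A} (h : CAR k n c d) (t : k)
include h

theorem anti_sum_c {i : ℕ} (hi : i ≤ n) : anti k A (weightedSum n t c) (c i) = 0 := by
  rw [weightedSum, map_sum, LinearMap.sum_apply]
  refine Finset.sum_eq_zero fun j hj => ?_
  rw [map_smul, LinearMap.smul_apply, h.cc j i (by simpa [Nat.lt_succ_iff] using hj) hi, smul_zero]

theorem anti_sum_d {i : ℕ} (hi : i ≤ n) :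
    anti k A (weightedSum n t c) (d i) = algebraMap k A (t ^ i) := by
  rw [weightedSum, map_sum, LinearMap.sum_apply]
  rw [Finset.sum_eq_single i]
  · rw [map_smul, LinearMap.smul_apply, h.cd i i hi hi, if_pos rfl, Algebra.algebraMap_eq_smul_one]
  · intro j hj hji
    rw [map_smul, LinearMap.smul_apply, h.cd j i (by simpa [Nat.lt_succ_iff] using hj) hi,
      if_neg hji, smul_zero]
  · intro hi'
    exact absurd (Finset.mem_range.2 (Nat.lt_succ_iff.2 hi)) hi'

theorem anti_sum_diff_c {i : ℕ} (hi : i < n) :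
    anti k A (weightedSum n t c) (weightedDiff t c i) = 0 := by
  rw [weightedDiff, map_sub, map_smul, h.anti_sum_c t hi.le, h.anti_sum_c t hi]
  simp

/-- The weights of the differences are chosen for this cancellation: t · t^i - t^{i+1} = 0. -/
theorem anti_sum_diff_d {i : ℕ} (hi : i < n) :
    anti k A (weightedSum n t c) (weightedDiff t d i) = 0 := by
  rw [weightedDiff, map_sub, map_smul, h.anti_sum_d t hi.le, h.anti_sum_d t hi, pow_succ',
    map_mul, Algebra.smul_def, sub_self]

theorem anti_sum_sum : anti k A (weightedSum n t c) (weightedSum n t d) =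
    algebraMap k A (∑ i ∈ Finset.range (n + 1), (t ^ 2) ^ i) := by
  rw [show weightedSum n t d = ∑ i ∈ Finset.range (n + 1), t ^ i • d i from rfl, map_sum, map_sum]
  refine Finset.sum_congr rfl fun i hi => ?_
  rw [map_smul, h.anti_sum_d t (by simpa [Nat.lt_succ_iff] using hi), Algebra.smul_def, ← map_mul]
  ring_nf

theorem anti_diff_diff {i j : ℕ} (hi : i < n) (hj : j < n) :
    anti k A (weightedDiff t c i) (weightedDiff t c j) = 0 := by
  simp [weightedDiff, h.cc _ _ hi.le hj.le, h.cc _ _ hi hj.le, h.cc _ _ hi.le hj,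
    h.cc _ _ hi hj]

/-- The matrix of anticommutators of the differences. -/
def gram (t : k) (i j : ℕ) : k :=
  (if i = j then t ^ 2 + 1 else 0) - (if i = j + 1 then t else 0) - if i + 1 = j then t else 0

theorem anti_diff_diff' {i j : ℕ} (hi : i < n) (hj : j < n) :
    anti k A (weightedDiff t c i) (weightedDiff t d j) = algebraMap k A (gram t i j) := by
  simp only [weightedDiff, map_sub, map_smul, LinearMap.sub_apply, LinearMap.smul_apply,
    h.cd _ _ hi.le hj.le, h.cd _ _ hi hj.le, h.cd _ _ hi.le hj, h.cd _ _ hi hj, gram,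
    Algebra.algebraMap_eq_smul_one]
  split_ifs <;> first | omega | skip
  all_goals simp [add_smul, smul_smul, sq]

omit h in
-- Modulo the differences c_i is t^i c_0, so the weighted sum becomes (∑ t^{2i}) c_0, and this
-- coefficient is invertible by `ht`.
theorem mem_of_sum_diff {S : Subalgebra k A} {c : ℕ → A}
    (ht : ∑ i ∈ Finset.range (n + 1), (t ^ 2) ^ i ≠ 0) (hs : weightedSum n t c ∈ S)
    (hd : ∀ i < n, weightedDiff t c i ∈ S) {i : ℕ} (hi : i ≤ n) : c i ∈ S := by
  have h1 : ∀ i ≤ n, t ^ i • c 0 - c i ∈ S := by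
    intro i hi
    induction i with
    | zero => simp
    | succ i ih =>
      have : t ^ (i + 1) • c 0 - c (i + 1) = t • (t ^ i • c 0 - c i) + weightedDiff t c i := by
        rw [weightedDiff, smul_sub, smul_smul, ← pow_succ']
        abel
      rw [this]
      exact S.add_mem (S.smul_mem (ih (by omega)) t) (hd i (by omega))
  have h2 : (∑ i ∈ Finset.range (n + 1), (t ^ 2) ^ i) • c 0 ∈ S := by
    have : (∑ i ∈ Finset.range (n + 1), (t ^ 2) ^ i) • c 0 =
        ∑ i ∈ Finset.range (n + 1), t ^ i • (t ^ i • c 0 - c i) + weightedSum n t c := by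
      rw [weightedSum, ← Finset.sum_add_distrib, Finset.sum_smul]
      refine Finset.sum_congr rfl fun i _ => ?_
      rw [smul_sub, sub_add_cancel, smul_smul, ← pow_mul, ← pow_add]
      ring_nf
    rw [this]
    exact S.add_mem (S.sum_mem fun i hi => S.smul_mem (h1 i (by simpa [Nat.lt_succ_iff] using hi)) _)
      hs
  have h3 : c 0 ∈ S := by
    have := S.smul_mem h2 (∑ i ∈ Finset.range (n + 1), (t ^ 2) ^ i)⁻¹
    rwa [smul_smul, inv_mul_cancel₀ ht, one_smul] at this
  have := S.sub_mem (S.smul_mem h3 (t ^ i)) (h1 i hi)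
  simpa using this

/-- Moving the inner y past the inner x splits each product into a quadratic and a quartic term. The
quartic terms agree because two sign changes cancel. The result is the bracket of matrix units
twisted by `gram`. -/
theorem commutator_bilinear {i j l m : ℕ} (hi : i < n) (hj : j < n) (hl : l < n) (hm : m < n) :
    weightedDiff t c i * weightedDiff t d j * (weightedDiff t c l * weightedDiff t d m) -
      weightedDiff t c l * weightedDiff t d m * (weightedDiff t c i * weightedDiff t d j) =
    gram t l j • (weightedDiff t c i * weightedDiff t d m) -
      gram t i m • (weightedDiff t c l * weightedDiff t d j) := by
  have h1 := h.anti_diff_diff' t hl hj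
  have h2 := h.anti_diff_diff' t hi hm
  have h3 := mul_eq_neg_of_anti (h.anti_diff_diff t hi hl)
  have h4 := mul_eq_neg_of_anti (h.symm.anti_diff_diff t hj hm)
  rw [anti_apply] at h1 h2
  generalize weightedDiff t c i = xi at *
  generalize weightedDiff t c l = xl at *
  generalize weightedDiff t d j = yj at *
  generalize weightedDiff t d m = ym at *
  have h1' := eq_sub_of_add_eq' h1
  have h2' := eq_sub_of_add_eq' h2
  have e1 : xi * yj * (xl * ym) = gram t l j • (xi * ym) - xi * xl * (yj * ym) := by
    rw [show xi * yj * (xl * ym) = xi * (yj * xl) * ym by noncomm_ring, h1', mul_sub, sub_mul,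
      ← Algebra.commutes, Algebra.smul_def]
    noncomm_ring
  have e2 : xl * ym * (xi * yj) = gram t i m • (xl * yj) - xl * xi * (ym * yj) := by
    rw [show xl * ym * (xi * yj) = xl * (ym * xi) * yj by noncomm_ring, h2', mul_sub, sub_mul,
      ← Algebra.commutes, Algebra.smul_def]
    noncomm_ring
  rw [e1, e2, h3, h4]
  noncomm_ring

/-- Induction on the distance `m` from the diagonal. At distance one, [x_i y_i, x_{i+1} y_{i+1}]
yields only the difference of the two products; a second bracket with x_i y_i yields their sum, and
2 is inverted to separate them. Beyond that, a bracket with one further diagonal product has a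
single surviving term, because `gram` is tridiagonal. -/
theorem bilinear_mem_adjoin (ht0 : t ≠ 0) (h2 : (2 : k) ≠ 0) (ht2 : t ^ 2 + 1 ≠ 0) (m : ℕ) :
    ∀ i, i + m < n →
      weightedDiff t c i * weightedDiff t d (i + m) ∈ Algebra.adjoin k
        {x | ∃ i < n, x = weightedDiff t c i * weightedDiff t d i} ∧
      weightedDiff t c (i + m) * weightedDiff t d i ∈ Algebra.adjoin k
        {x | ∃ i < n, x = weightedDiff t c i * weightedDiff t d i} := by
  set S := Algebra.adjoin k {x | ∃ i < n, x = weightedDiff t c i * weightedDiff t d i}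
  have h0 : ∀ i < n, weightedDiff t c i * weightedDiff t d i ∈ S := fun i hi =>
    Algebra.subset_adjoin ⟨i, hi, rfl⟩
  have hcomm : ∀ {x y : A}, x ∈ S → y ∈ S → x * y - y * x ∈ S := fun hx hy =>
    S.sub_mem (S.mul_mem hx hy) (S.mul_mem hy hx)
  have hsm : ∀ {r : k} {x : A}, r ≠ 0 → r • x ∈ S → x ∈ S := fun {r x} hr hx => by
    have := S.smul_mem hx r⁻¹
    rwa [smul_smul, inv_mul_cancel₀ hr, one_smul] at this
  have g0 : ∀ i, gram t i i = t ^ 2 + 1 := fun i => by simp [gram]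
  have g1 : ∀ i, gram t i (i + 1) = -t := fun i => by simp [gram]; omega
  have g2 : ∀ i, gram t (i + 1) i = -t := fun i => by simp [gram]; omega
  induction m with
  | zero => exact fun i hi => ⟨h0 i hi, h0 i hi⟩
  | succ m ih =>
    intro i hi
    rcases Nat.eq_zero_or_pos m with rfl | hm
    · have hi' : i < n := by omega
      simp only [zero_add] at *
      have a1 := hcomm (h0 i hi') (h0 (i + 1) hi)
      rw [h.commutator_bilinear t hi' hi' hi hi, g1, g2, ← smul_sub] at a1
      have a2 := hsm (neg_ne_zero.2 ht0) a1
      have a3 := hcomm (h0 i hi') a2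
      have e1 := h.commutator_bilinear t hi' hi' hi' hi
      have e2 := h.commutator_bilinear t hi' hi' hi hi'
      have a4 : (t ^ 2 + 1) • (weightedDiff t c i * weightedDiff t d (i + 1) +
          weightedDiff t c (i + 1) * weightedDiff t d i) ∈ S := by
        rw [mul_sub, sub_mul, sub_sub_sub_comm, e1, e2, g0, g1, g2] at a3
        -- The second bracket equals t² + 1 times the sum, plus 2t x_i y_i; the last term is removed
        -- here.
        have a5 := S.add_mem a3 (S.smul_mem (h0 i hi') (-(t + t)))
        convert a5 using 1
        module
      have a5 := hsm ht2 a4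
      constructor
      · refine hsm h2 ?_
        convert S.add_mem a5 a2 using 1
        module
      · refine hsm h2 ?_
        convert S.sub_mem a5 a2 using 1
        module
    · obtain ⟨b1, b2⟩ := ih i (by omega)
      replace hi : i + m + 1 < n := hi
      have z : gram t i (i + m + 1) = 0 := by
        rw [gram, if_neg (by omega), if_neg (by omega), if_neg (by omega), sub_zero, sub_zero]
      have z' : gram t (i + m + 1) i = 0 := by
        rw [gram, if_neg (by omega), if_neg (by omega), if_neg (by omega), sub_zero, sub_zero]
      constructor
      · have a := hcomm b1 (h0 (i + m + 1) hi)
        rw [h.commutator_bilinear t (by omega) (by omega) hi hi, g2, z, zero_smul, sub_zero] at a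
        exact hsm (neg_ne_zero.2 ht0) a
      · have a := hcomm (h0 (i + m + 1) hi) b2
        rw [h.commutator_bilinear t hi hi (by omega) (by omega), g1, z', zero_smul, sub_zero] at a
        exact hsm (neg_ne_zero.2 ht0) a

theorem bilinear_mem_adjoin' (ht0 : t ≠ 0) (h2 : (2 : k) ≠ 0) (ht2 : t ^ 2 + 1 ≠ 0) {i j : ℕ}
    (hi : i < n) (hj : j < n) : weightedDiff t c i * weightedDiff t d j ∈ Algebra.adjoin k
        {x | ∃ i < n, x = weightedDiff t c i * weightedDiff t d i} := by
  rcases le_total i j with hij | hij <;> obtain ⟨m, rfl⟩ := Nat.exists_eq_add_of_le hij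
  · exact (h.bilinear_mem_adjoin t ht0 h2 ht2 m i hj).1
  · exact (h.bilinear_mem_adjoin t ht0 h2 ht2 m j hi).2

/-- An element of degree zero of the Clifford algebra that commutes with `∑ t ^ i c i` and
`∑ t ^ i d i` is a polynomial in the products of corresponding differences. -/
theorem mem_adjoin_of_commute {L L' : A} (ht0 : t ≠ 0) (h2 : (2 : k) ≠ 0)
    (ht : ∀ n : ℕ, n ≠ 0 → t ^ n ≠ 1) (hL : L * L' = 1) (hL' : L' * L = 1)
    (hLc : ∀ i ≤ n, L * c i = t • (c i * L)) (hLd : ∀ i ≤ n, L * d i = t⁻¹ • (d i * L))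
    (hgen : Algebra.adjoin k {x | ∃ i ≤ n, x = c i ∨ x = d i} = ⊤) {T : A}
    (hTc : T * weightedSum n t c = weightedSum n t c * T)
    (hTd : T * weightedSum n t d = weightedSum n t d * T) (hTL : T * L = L * T) :
    T ∈ Algebra.adjoin k {x | ∃ i < n, x = weightedDiff t c i * weightedDiff t d i} := by
  -- Otherwise t would be a fourth root of unity.
  have ht2 : t ^ 2 + 1 ≠ 0 := by
    intro h0
    refine ht 4 (by norm_num) ?_
    linear_combination (t ^ 2 - 1) * h0
  have hs : ∑ i ∈ Finset.range (n + 1), (t ^ 2) ^ i ≠ 0 := by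
    intro h0
    have := geom_sum_mul (t ^ 2) (n + 1)
    rw [h0, zero_mul, eq_comm, sub_eq_zero, ← pow_mul] at this
    exact ht _ (by omega) this
  have hLsum : ∀ {u : k} {e : ℕ → A}, (∀ i ≤ n, L * e i = u • (e i * L)) →
      L * weightedSum n t e = u • (weightedSum n t e * L) := by
    intro u e he
    rw [weightedSum, Finset.mul_sum, Finset.sum_mul, Finset.smul_sum]
    refine Finset.sum_congr rfl fun i hi => ?_
    rw [mul_smul_comm, he i (by simpa [Nat.lt_succ_iff] using hi), smul_mul_assoc, smul_comm]
  have hLdiff : ∀ {u : k} {e : ℕ → A}, (∀ i ≤ n, L * e i = u • (e i * L)) → ∀ i < n,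
      L * weightedDiff t e i = u • (weightedDiff t e i * L) := by
    intro u e he i hi
    rw [weightedDiff, mul_sub, sub_mul, mul_smul_comm, he i hi.le, he (i + 1) hi, smul_sub,
      smul_mul_assoc, smul_comm]
  have hsq : ∀ {e e' : ℕ → A}, CAR k n e e' → weightedSum n t e * weightedSum n t e = 0 := by
    intro e e' he
    have : anti k A (weightedSum n t e) (weightedSum n t e) = 0 := by
      nth_rewrite 2 [weightedSum]
      rw [map_sum]
      refine Finset.sum_eq_zero fun i hi => ?_
      rw [map_smul, he.anti_sum_c t (by simpa [Nat.lt_succ_iff] using hi), smul_zero]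
    rw [anti_apply, ← two_smul k] at this
    exact (smul_eq_zero.1 this).resolve_left h2
  -- The sums of the c_i and of the d_i play the roles of F and E; their anticommutator is the
  -- scalar s = ∑ t^{2i}.
  have key := mem_bilinears_of_commute (k := k) (ι := {i : ℕ // i < n})
    (X := fun i => weightedDiff t c i) (Y := fun i => weightedDiff t d i)
    (g := fun i j => gram t i j) (E := weightedSum n t d) (F := weightedSum n t c) (L := L)
    (L' := L') (s := ∑ i ∈ Finset.range (n + 1), (t ^ 2) ^ i) (t := t) hs ht0 ht
    (fun i j => mul_eq_neg_of_anti (h.anti_diff_diff t i.2 j.2))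
    (fun i j => mul_eq_neg_of_anti (h.symm.anti_diff_diff t i.2 j.2))
    (fun i j => eq_sub_of_add_eq' (h.anti_diff_diff' t i.2 j.2))
    (fun i => mul_eq_neg_of_anti (h.symm.anti_sum_diff_d t i.2))
    (fun i => mul_eq_neg_of_anti (h.anti_sum_diff_c t i.2))
    (fun i => mul_eq_neg_of_anti (h.symm.anti_sum_diff_c t i.2))
    (fun i => mul_eq_neg_of_anti (h.anti_sum_diff_d t i.2))
    (hsq h.symm) (hsq h) (h.symm.anti_sum_sum t) hL hL'
    (fun i => hLdiff hLc i i.2) (fun i => hLdiff hLd i i.2) (hLsum hLd) (hLsum hLc) ?_ hTd hTc hTL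
  · refine Algebra.adjoin_le ?_ key
    rintro _ ⟨⟨i, j⟩, rfl⟩
    exact h.bilinear_mem_adjoin' t ht0 h2 ht2 i.2 j.2
  · have hr : ∀ (e : ℕ → A), ∀ j < n,
        weightedDiff t e j ∈ Set.range fun i : {i : ℕ // i < n} => weightedDiff t e i :=
      fun e j hj => ⟨⟨j, hj⟩, rfl⟩
    rw [← top_le_iff, ← hgen]
    refine Algebra.adjoin_le ?_
    rintro _ ⟨i, hi, rfl | rfl⟩
    · exact mem_of_sum_diff t hs (Algebra.subset_adjoin (Set.mem_union_left _ (by simp)))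
        (fun j hj => Algebra.subset_adjoin
          (Set.mem_union_right _ (Set.mem_union_left _ (hr c j hj)))) hi
    · exact mem_of_sum_diff t hs (Algebra.subset_adjoin (Set.mem_union_left _ (by simp)))
        (fun j hj => Algebra.subset_adjoin
          (Set.mem_union_right _ (Set.mem_union_right _ (hr d j hj)))) hi

end CAR

end Fermions

/-! ### The supermodule `V(1)^{⊗ n}` as a Fock space -/

/-- The operators `F` and `E` on `V(1)`. -/
abbrev vF : Module.End Kq (Fin 2 → Kq) := vOp 1 .F
abbrev vE : Module.End Kq (Fin 2 → Kq) := vOp 1 .E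

theorem vSgn_mul_vSgn : vSgn * vSgn = 1 := vMap_ext (by simp) (by simp)

theorem vF_mul_vSgn : vF * vSgn = -(vSgn * vF) := vMap_ext (by simp [vOp]) (by simp [vOp])

theorem vE_mul_vSgn : vE * vSgn = -(vSgn * vE) := vMap_ext (by simp [vOp]) (by simp [vOp])

theorem vF_mul_vF : vF * vF = 0 := vMap_ext (by simp [vOp]) (by simp [vOp])

theorem vE_mul_vE : vE * vE = 0 := vMap_ext (by simp [vOp]) (by simp [vOp])

theorem vF_vE_anti : vF * vE + vE * vF = 1 := vMap_ext (by simp [vOp]) (by simp [vOp])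

theorem vOp_K : vOp 1 (.qh (1, 1)) = q • 1 :=
  vMap_ext (by simp [vOp, pairAlpha]) (by simp [vOp, pairAlpha])

theorem vOp_K_inv : vOp 1 (.qh (-1, -1)) = q⁻¹ • 1 :=
  vMap_ext (by simp [vOp, pairAlpha]) (by simp [vOp, pairAlpha])

theorem vec_eq (v : Fin 2 → Kq) : v = v 0 • vBasis 0 + v 1 • vBasis 1 := by
  have := vBasis.sum_repr v
  rw [Fin.sum_univ_two] at this
  exact this.symm

/-- EF, F, E and FE are the four matrix units of V(1). -/
theorem adjoin_vF_vE : Algebra.adjoin Kq {vF, vE} = ⊤ := by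
  rw [← top_le_iff]
  intro f _
  have hF : vF ∈ Algebra.adjoin Kq {vF, vE} := Algebra.subset_adjoin (by simp)
  have hE : vE ∈ Algebra.adjoin Kq {vF, vE} := Algebra.subset_adjoin (by simp)
  have : f = (f (vBasis 0) 0 • (vE * vF) + f (vBasis 0) 1 • vF) +
      (f (vBasis 1) 0 • vE + f (vBasis 1) 1 • (vF * vE)) := by
    refine vMap_ext ?_ ?_
    · simpa [vOp] using vec_eq (f (vBasis 0))
    · simpa [vOp] using vec_eq (f (vBasis 1))
  rw [this]
  exact add_mem (add_mem (Subalgebra.smul_mem _ (mul_mem hE hF) _) (Subalgebra.smul_mem _ hF _))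
    (add_mem (Subalgebra.smul_mem _ hE _) (Subalgebra.smul_mem _ (mul_mem hF hE) _))

/-- The operators on `V ⊗ M` that are `x ⊗ 1` and the `σ ⊗ c i`. -/
def consOp {M : Type} [AddCommGroup M] [Module Kq M] (x : Module.End Kq (Fin 2 → Kq))
    (c : ℕ → Module.End Kq M) : ℕ → Module.End Kq ((Fin 2 → Kq) ⊗[Kq] M)
  | 0 => TensorProduct.map x 1
  | i + 1 => TensorProduct.map vSgn (c i)

section consOp

variable {M : Type} [AddCommGroup M] [Module Kq M]

theorem anti_map_one_map_vSgn {x : Module.End Kq (Fin 2 → Kq)} (hx : x * vSgn = -(vSgn * x))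
    (y : Module.End Kq M) :
    anti Kq _ (TensorProduct.map x (1 : Module.End Kq M)) (TensorProduct.map vSgn y) = 0 := by
  rw [anti_apply, ← TensorProduct.map_mul, ← TensorProduct.map_mul, one_mul, mul_one, hx,
    SuperRep.map_neg_left]
  exact neg_add_cancel (TensorProduct.map (vSgn * x) y)

theorem anti_map_vSgn_map_vSgn (y y' : Module.End Kq M) :
    anti Kq _ (TensorProduct.map vSgn y) (TensorProduct.map vSgn y') =
      TensorProduct.map 1 (anti Kq _ y y') := by
  rw [anti_apply, ← TensorProduct.map_mul, ← TensorProduct.map_mul, vSgn_mul_vSgn,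
    ← TensorProduct.map_add_right, anti_apply]

theorem anti_map_one_map_one (x x' : Module.End Kq (Fin 2 → Kq)) :
    anti Kq _ (TensorProduct.map x (1 : Module.End Kq M)) (TensorProduct.map x' 1) =
      TensorProduct.map (anti Kq _ x x') 1 := by
  rw [anti_apply, ← TensorProduct.map_mul, ← TensorProduct.map_mul, one_mul,
    ← TensorProduct.map_add_left, anti_apply]

/-- The matrix `r` of prescribed scalars lets the three families of relations be treated at once:
zero for cc and dd, the identity matrix for cd. -/
theorem anti_consOp {n : ℕ} {x x' : Module.End Kq (Fin 2 → Kq)} {c c' : ℕ → Module.End Kq M}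
    {r : ℕ → ℕ → Kq} (hx : x * vSgn = -(vSgn * x)) (hx' : x' * vSgn = -(vSgn * x'))
    (h0 : anti Kq _ x x' = r 0 0 • 1) (h1 : ∀ i, r 0 (i + 1) = 0) (h2 : ∀ i, r (i + 1) 0 = 0)
    (h : ∀ i j, i ≤ n → j ≤ n → anti Kq _ (c i) (c' j) = r (i + 1) (j + 1) • 1) :
    ∀ i j, i ≤ n + 1 → j ≤ n + 1 → anti Kq _ (consOp x c i) (consOp x' c' j) = r i j • 1
  | 0, 0, _, _ => by
    rw [consOp, consOp, anti_map_one_map_one, h0, TensorProduct.map_smul_left, TensorProduct.map_one]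
  | 0, j + 1, _, _ => by
    rw [consOp, consOp, anti_map_one_map_vSgn hx, h1, zero_smul]
  | i + 1, 0, _, _ => by
    rw [consOp, consOp, anti_comm, anti_map_one_map_vSgn hx', h2, zero_smul]
  | i + 1, j + 1, hi, hj => by
    rw [consOp, consOp, anti_map_vSgn_map_vSgn, h i j (by omega) (by omega),
      TensorProduct.map_smul_right, TensorProduct.map_one]

/-- The Jordan–Wigner construction: the sign operator on the new first factor makes the old fermions
anticommute with the new ones. -/
theorem CAR.consOp {n : ℕ} {c d : ℕ → Module.End Kq M} (h : CAR Kq n c d) :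
    CAR Kq (n + 1) (consOp vF c) (consOp vE d) where
  cc i j hi hj := by
    rw [anti_consOp (r := fun _ _ => 0) vF_mul_vSgn vF_mul_vSgn
      (by rw [anti_apply, vF_mul_vF]; simp) (fun _ => rfl) (fun _ => rfl)
      (fun i j hi hj => by rw [h.cc i j hi hj, zero_smul]) i j hi hj, zero_smul]
  dd i j hi hj := by
    rw [anti_consOp (r := fun _ _ => 0) vE_mul_vSgn vE_mul_vSgn
      (by rw [anti_apply, vE_mul_vE]; simp) (fun _ => rfl) (fun _ => rfl)
      (fun i j hi hj => by rw [h.dd i j hi hj, zero_smul]) i j hi hj, zero_smul]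
  cd i j hi hj := by
    rw [anti_consOp (r := fun i j => if i = j then 1 else 0) vF_mul_vSgn vE_mul_vSgn
      (by rw [anti_apply, vF_vE_anti]; simp) (fun _ => rfl) (fun _ => rfl)
      (fun i j hi hj => by rw [h.cd i j hi hj]; simp) i j hi hj]
    simp

/-- Old operators move up by one index and so gain a factor t. For t = q this is the eigenvalue of K
on V(1), as in ΔF = F ⊗ 1 + K ⊗ F. -/
theorem weightedSum_consOp (n : ℕ) (t : Kq) (x : Module.End Kq (Fin 2 → Kq))
    (c : ℕ → Module.End Kq M) : weightedSum (n + 1) t (consOp x c) =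
      TensorProduct.map x 1 + t • TensorProduct.map vSgn (weightedSum n t c) := by
  rw [weightedSum, Finset.sum_range_succ', add_comm, pow_zero, one_smul, consOp, weightedSum]
  congr 1
  have : TensorProduct.map vSgn (∑ i ∈ Finset.range (n + 1), t ^ i • c i) =
      ∑ i ∈ Finset.range (n + 1), t ^ i • TensorProduct.map vSgn (c i) := by
    rw [← TensorProduct.mapBilinear_apply, map_sum]
    simp
  rw [this, Finset.smul_sum]
  refine Finset.sum_congr rfl fun i _ => ?_
  rw [smul_smul, ← pow_succ', consOp]

/-- The first pair generates all f ⊗ 1, in particular the sign operator, which then strips the signs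
from the others and gives all 1 ⊗ g. In finite dimension the f ⊗ g span. -/
theorem adjoin_consOp [Module.Finite Kq M] {n : ℕ} {c d : ℕ → Module.End Kq M}
    (h : Algebra.adjoin Kq {x | ∃ i ≤ n, x = c i ∨ x = d i} = ⊤) :
    Algebra.adjoin Kq {x | ∃ i ≤ n + 1, x = consOp vF c i ∨ x = consOp vE d i} = ⊤ := by
  set S := Algebra.adjoin Kq {x | ∃ i ≤ n + 1, x = consOp vF c i ∨ x = consOp vE d i}
  have hc : ∀ i ≤ n + 1, consOp vF c i ∈ S := fun i hi =>
    Algebra.subset_adjoin ⟨i, hi, Or.inl rfl⟩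
  have hd : ∀ i ≤ n + 1, consOp vE d i ∈ S := fun i hi =>
    Algebra.subset_adjoin ⟨i, hi, Or.inr rfl⟩
  have hleft : ∀ f : Module.End Kq (Fin 2 → Kq),
      TensorProduct.map f (1 : Module.End Kq M) ∈ S := by
    intro f
    have hf : f ∈ Algebra.adjoin Kq {vF, vE} := by rw [adjoin_vF_vE]; trivial
    induction hf using Algebra.adjoin_induction with
    | mem x hx =>
      rcases hx with rfl | rfl
      · exact hc 0 (by omega)
      · exact hd 0 (by omega)
    | algebraMap r =>
      rw [Algebra.algebraMap_eq_smul_one, TensorProduct.map_smul_left, TensorProduct.map_one]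
      exact S.smul_mem S.one_mem r
    | add x y _ _ hx hy => rw [TensorProduct.map_add_left]; exact S.add_mem hx hy
    | mul x y _ _ hx hy =>
      rw [← one_mul (1 : Module.End Kq M), TensorProduct.map_mul]
      exact S.mul_mem hx hy
  have hright : ∀ g : Module.End Kq M,
      TensorProduct.map (1 : Module.End Kq (Fin 2 → Kq)) g ∈ S := by
    intro g
    have hg : g ∈ Algebra.adjoin Kq {x | ∃ i ≤ n, x = c i ∨ x = d i} := by rw [h]; trivial
    induction hg using Algebra.adjoin_induction with
    | mem x hx =>
      have : TensorProduct.map (1 : Module.End Kq (Fin 2 → Kq)) x =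
          TensorProduct.map vSgn 1 * TensorProduct.map vSgn x := by
        rw [← TensorProduct.map_mul, vSgn_mul_vSgn, one_mul]
      rw [this]
      refine S.mul_mem (hleft _) ?_
      obtain ⟨i, hi, rfl | rfl⟩ := hx
      · exact hc (i + 1) (by omega)
      · exact hd (i + 1) (by omega)
    | algebraMap r =>
      rw [Algebra.algebraMap_eq_smul_one, TensorProduct.map_smul_right, TensorProduct.map_one]
      exact S.smul_mem S.one_mem r
    | add x y _ _ hx hy => rw [TensorProduct.map_add_right]; exact S.add_mem hx hy
    | mul x y _ _ hx hy =>
      rw [← one_mul (1 : Module.End Kq (Fin 2 → Kq)), TensorProduct.map_mul]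
      exact S.mul_mem hx hy
  rw [← top_le_iff]
  intro T _
  obtain ⟨u, rfl⟩ := (homTensorHomEquiv Kq (Fin 2 → Kq) M (Fin 2 → Kq) M).surjective T
  induction u with
  | zero => rw [map_zero]; exact S.zero_mem
  | tmul f g =>
    rw [homTensorHomEquiv_apply, TensorProduct.homTensorHomMap_apply]
    have : TensorProduct.map f g = TensorProduct.map f (1 : Module.End Kq M) *
        TensorProduct.map (1 : Module.End Kq (Fin 2 → Kq)) g := by
      rw [← TensorProduct.map_mul, mul_one, one_mul]
    rw [this]
    exact S.mul_mem (hleft f) (hright g)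
  | add x y hx hy => rw [map_add]; exact S.add_mem (hx trivial) (hy trivial)

theorem quasi_consOp {n : ℕ} {x : Module.End Kq (Fin 2 → Kq)} {c : ℕ → Module.End Kq M}
    {l : Module.End Kq (Fin 2 → Kq)} {L : Module.End Kq M} {μ : Kq}
    (hs : l * vSgn = vSgn * l) (hx : l * x = μ • (x * l))
    (h : ∀ i ≤ n, L * c i = μ • (c i * L)) : ∀ i ≤ n + 1,
      TensorProduct.map l L * consOp x c i = μ • (consOp x c i * TensorProduct.map l L)
  | 0, _ => by
    rw [consOp, ← TensorProduct.map_mul, ← TensorProduct.map_mul, hx, mul_one, one_mul,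
      TensorProduct.map_smul_left]
  | i + 1, hi => by
    rw [consOp, ← TensorProduct.map_mul, ← TensorProduct.map_mul, hs, h i (by omega),
      TensorProduct.map_smul_right]

end consOp

/-- An action of the generators in which `F` and `E` are sums of fermionic operators. -/
structure IsFock {M : Type} [AddCommGroup M] [Module Kq M] (act : UqGen → Module.End Kq M) (n : ℕ)
    (c d : ℕ → Module.End Kq M) : Prop where
  finite : Module.Finite Kq M
  car : CAR Kq n c d
  act_F : act .F = weightedSum n q c
  act_E : act .E = (q ^ n)⁻¹ • weightedSum n q d
  act_K : act (.qh (1, 1)) = q ^ (n + 1) • 1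
  act_K_inv : act (.qh (-1, -1)) = (q ^ (n + 1))⁻¹ • 1
  act_c : ∀ i ≤ n, act (.qh (0, 1)) * c i = q • (c i * act (.qh (0, 1)))
  act_d : ∀ i ≤ n, act (.qh (0, 1)) * d i = q⁻¹ • (d i * act (.qh (0, 1)))
  gen : Algebra.adjoin Kq {x | ∃ i ≤ n, x = c i ∨ x = d i} = ⊤

/-- The action of the generators on `V(1) ⊗ M`. -/
def consAct {M : Type} [AddCommGroup M] [Module Kq M] (act : UqGen → Module.End Kq M) :
    UqGen → Module.End Kq ((Fin 2 → Kq) ⊗[Kq] M)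
  | .E => TensorProduct.map vE (act (.qh (-1, -1))) + TensorProduct.map vSgn (act .E)
  | .F => TensorProduct.map vF 1 + TensorProduct.map (vOp 1 (.qh (1, 1)) * vSgn) (act .F)
  | .qh h => TensorProduct.map (vOp 1 (.qh h)) (act (.qh h))

theorem tensor_V_one_ρ (M : SuperRep) :
    (fun g => (SuperRep.tensor (V 1) M).ρ (Uq.of g)) = consAct fun g => M.ρ (Uq.of g) := by
  funext g
  rw [SuperRep.tensor_ρ]
  cases g <;> simp only [SuperRep.tensorOp, SuperRep.opE, SuperRep.opF, SuperRep.opQ, V_ρ] <;>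
    rfl

theorem vOp_L_mul_vSgn : vOp 1 (.qh (0, 1)) * vSgn = vSgn * vOp 1 (.qh (0, 1)) :=
  vMap_ext (by simp [vOp]) (by simp [vOp])

theorem vOp_L_mul_vF : vOp 1 (.qh (0, 1)) * vF = q • (vF * vOp 1 (.qh (0, 1))) :=
  vMap_ext (by simp [vOp, pairAlpha]) (by simp [vOp])

theorem vOp_L_mul_vE : vOp 1 (.qh (0, 1)) * vE = q⁻¹ • (vE * vOp 1 (.qh (0, 1))) :=
  vMap_ext (by simp [vOp]) (by simp [vOp, pairAlpha, smul_smul, q_ne_zero])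

theorem isFock_vOp : IsFock (vOp 1) 0 (fun _ => vF) (fun _ => vE) where
  finite := inferInstance
  car := ⟨fun _ _ _ _ => by rw [anti_apply, vF_mul_vF, add_zero],
    fun _ _ _ _ => by rw [anti_apply, vE_mul_vE, add_zero], fun i j hi hj => by
      obtain rfl : i = 0 := by omega
      obtain rfl : j = 0 := by omega
      rw [anti_apply, vF_vE_anti, if_pos rfl]⟩
  act_F := by simp [weightedSum]
  act_E := by simp [weightedSum]
  act_K := by simpa using vOp_K
  act_K_inv := by simpa using vOp_K_inv
  act_c _ _ := vOp_L_mul_vF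
  act_d _ _ := vOp_L_mul_vE
  gen := by
    rw [← adjoin_vF_vE]
    congr 1
    ext x
    simp

theorem IsFock.cons {M : Type} [AddCommGroup M] [Module Kq M] {act : UqGen → Module.End Kq M}
    {n : ℕ} {c d : ℕ → Module.End Kq M} (h : IsFock act n c d) :
    IsFock (consAct act) (n + 1) (consOp vF c) (consOp vE d) where
  finite := by
    have := h.finite
    infer_instance
  car := h.car.consOp
  act_F := by
    rw [weightedSum_consOp, consAct, h.act_F, vOp_K, smul_mul_assoc, one_mul,
      TensorProduct.map_smul_left]
  -- Factoring the eigenvalue q^{-(n+1)} of K⁻¹ out of E ⊗ K⁻¹ + σ ⊗ E leaves the weight q on the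
  -- old sum.
  act_E := by
    rw [weightedSum_consOp, consAct, h.act_E, h.act_K_inv, TensorProduct.map_smul_right,
      TensorProduct.map_smul_right, smul_add, smul_smul, pow_succ, mul_inv, mul_assoc,
      inv_mul_cancel₀ q_ne_zero, mul_one]
  act_K := by
    rw [consAct, h.act_K, vOp_K, TensorProduct.map_smul_right, TensorProduct.map_smul_left,
      smul_smul, ← pow_succ, TensorProduct.map_one]
  act_K_inv := by
    rw [consAct, h.act_K_inv, vOp_K_inv, TensorProduct.map_smul_right, TensorProduct.map_smul_left,
      smul_smul, ← mul_inv, ← pow_succ, TensorProduct.map_one]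
  act_c := quasi_consOp vOp_L_mul_vSgn vOp_L_mul_vF h.act_c
  act_d := quasi_consOp vOp_L_mul_vSgn vOp_L_mul_vE h.act_d
  gen := by
    have := h.finite
    exact adjoin_consOp h.gen

/-- The endomorphisms of `V(1)^{⊗ n}` are polynomials in products of fermionic operators. -/
theorem IsFock.mem_adjoin {M : SuperRep} {n : ℕ} {c d : ℕ → Module.End Kq M.carrier}
    (h : IsFock (fun g => M.ρ (Uq.of g)) n c d) (f : M ⟶ M) : SuperRep.toLin f ∈
      Algebra.adjoin Kq {x | ∃ i < n, x = weightedDiff q c i * weightedDiff q d i} := by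
  have hc : ∀ x, SuperRep.toLin f * M.ρ x = M.ρ x * SuperRep.toLin f := fun x =>
    SuperRep.Hom.comm_ρ f x
  have hE := hc (Uq.of .E)
  have hF := hc (Uq.of .F)
  rw [show M.ρ (Uq.of .F) = _ from h.act_F] at hF
  rw [show M.ρ (Uq.of .E) = _ from h.act_E, mul_smul_comm, smul_mul_assoc] at hE
  -- The degree is measured by 𝐪^{h₂}, which the operators c_i and d_i shift by q and q⁻¹.
  refine h.car.mem_adjoin_of_commute q (L := M.opQ (0, 1)) (L' := M.opQ (0, -1)) q_ne_zero
    two_ne_zero (fun n hn => q_pow_ne_one hn) ?_ ?_ h.act_c h.act_d h.gen hF ?_ (hc _)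
  · rw [SuperRep.opQ_mul]
    exact SuperRep.op_zero M
  · rw [SuperRep.opQ_mul]
    exact SuperRep.op_zero M
  · exact smul_right_injective _ (inv_ne_zero (pow_ne_zero n q_ne_zero)) hE

/-! ### The endomorphisms that come from webs -/

/-- The endomorphisms of `V(𝐚)` that are images of webs. -/
def webImage (l : List ℕ+) : Subalgebra Kq (Module.End Kq (Rep.ofSeq l).obj.carrier) where
  carrier := {f | ∃ e : WebExpr l l, Rep.toLin e.eval = f}
  mul_mem' := by
    rintro _ _ ⟨e, rfl⟩ ⟨e', rfl⟩
    exact ⟨.comp e' e, rfl⟩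
  add_mem' := by
    rintro _ _ ⟨e, rfl⟩ ⟨e', rfl⟩
    exact ⟨.add e e', rfl⟩
  algebraMap_mem' r := ⟨.smul r (.id l), rfl⟩

theorem webImage_smul_one_sub_smul {l : List ℕ+}
    {x : Module.End Kq (Rep.ofSeq l).obj.carrier} (hx : x ∈ webImage l) (r s : Kq) :
    r • 1 - s • x ∈ webImage l :=
  sub_mem (Subalgebra.smul_mem _ (one_mem _) r) (Subalgebra.smul_mem _ hx s)

theorem map_one_mem_webImage (a b : ℕ+) (m : List ℕ+)
    {f : Module.End Kq (Rep.ofSeq (b :: m)).obj.carrier} (hf : f ∈ webImage (b :: m)) :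
    (TensorProduct.map (1 : Module.End Kq (Fin 2 → Kq)) f :
      Module.End Kq ((Fin 2 → Kq) ⊗[Kq] (Rep.ofSeq (b :: m)).obj.carrier)) ∈
        webImage (a :: b :: m) := by
  obtain ⟨e, rfl⟩ := hf
  exact ⟨.tensor (.id [a]) e, rfl⟩

theorem phiDumbbell_mem_webImage : phiDumbbell ∈ webImage [1, 1] := ⟨WebExpr.dumbbell, rfl⟩

/-- `phiDumbbell` on the first two factors of `V ⊗ (V ⊗ M)`. -/
def phiDumbbellLeft (M : Type) [AddCommGroup M] [Module Kq M] :
    Module.End Kq ((Fin 2 → Kq) ⊗[Kq] ((Fin 2 → Kq) ⊗[Kq] M)) :=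
  (TensorProduct.assoc Kq _ _ _).toLinearMap ∘ₗ TensorProduct.map phiDumbbell LinearMap.id ∘ₗ
    (TensorProduct.assoc Kq _ _ _).symm.toLinearMap

theorem phiDumbbellLeft_mem_webImage (c : ℕ+) (m : List ℕ+) :
    phiDumbbellLeft (Rep.ofSeq (c :: m)).obj.carrier ∈ webImage (1 :: 1 :: c :: m) := by
  refine ⟨WebExpr.tensor WebExpr.dumbbell (.id (c :: m)), ?_⟩
  refine Eq.trans (congrArg (fun i => Rep.toLin (Iso.inv i ≫
    (WebExpr.dumbbell.eval ⊗ₘ 𝟙 (Rep.ofSeq (c :: m))) ≫ i.hom)) (Rep.concatIso_pair 1 1 c m)) ?_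
  rfl

/-- The bridge between fermions and webs: a diagonal product of differences is, up to scalars, a
dumbbell. -/
theorem weightedDiff_mul_eq_phiDumbbell :
    weightedDiff q (consOp vF fun _ => vF) 0 * weightedDiff q (consOp vE fun _ => vE) 0 =
      (q ^ 2 + 1) • 1 - q • phiDumbbell := by
  have hq := q_ne_zero
  refine vv_ext fun i j => ?_
  let _ : Algebra ℕ Kq := Semiring.toNatAlgebra
  let _ : Algebra ℤ Kq := Ring.toIntAlgebra _
  fin_cases i <;> fin_cases j <;>
    simp [weightedDiff, consOp, vOp, TensorProduct.neg_tmul, smul_sub, smul_smul, hq] <;>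
    match_scalars <;> field_simp <;> ring

/-- The differences of index 0 involve only the first two factors, so the families `c` and `d` play
no role and the case of two factors applies. -/
theorem weightedDiff_mul_eq_phiDumbbellLeft {M : Type} [AddCommGroup M] [Module Kq M]
    (c d : ℕ → Module.End Kq M) :
    weightedDiff q (consOp vF (consOp vF c)) 0 * weightedDiff q (consOp vE (consOp vE d)) 0 =
      (q ^ 2 + 1) • 1 - q • phiDumbbellLeft M := by
  have h := weightedDiff_mul_eq_phiDumbbell
  have h1 : ∀ x : Module.End Kq (Fin 2 → Kq), ∀ c : ℕ → Module.End Kq M,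
      weightedDiff q (consOp x (consOp x c)) 0 =
      (TensorProduct.assoc Kq _ _ _).toLinearMap ∘ₗ
        TensorProduct.map (weightedDiff q (consOp x fun _ => x) 0) LinearMap.id ∘ₗ
        (TensorProduct.assoc Kq _ _ _).symm.toLinearMap := by
    intro x c
    refine vw_ext fun i w => ?_
    induction w with
    | zero => simp
    | tmul y z => simp [weightedDiff, consOp, TensorProduct.sub_tmul, ← TensorProduct.smul_tmul']
    | add y z hy hz => rw [TensorProduct.tmul_add, map_add, map_add, hy, hz]
  rw [h1, h1]
  refine vw_ext fun i w => ?_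
  induction w with
  | zero => simp
  | tmul y z =>
    have := congrArg (fun u => TensorProduct.assoc Kq _ _ _ (u ⊗ₜ[Kq] z))
      (LinearMap.congr_fun h (vBasis i ⊗ₜ y))
    simpa [phiDumbbellLeft, TensorProduct.sub_tmul, ← TensorProduct.smul_tmul'] using this
  | add y z hy hz => rw [TensorProduct.tmul_add, map_add, map_add, hy, hz]

/-- Products of two fermions carry the sign operator twice, so on the first factor it disappears and
the web there is a plain strand. -/
theorem weightedDiff_consOp_succ_mul {M : Type} [AddCommGroup M] [Module Kq M]
    (x y : Module.End Kq (Fin 2 → Kq)) (c d : ℕ → Module.End Kq M) (i : ℕ) :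
    weightedDiff q (consOp x c) (i + 1) * weightedDiff q (consOp y d) (i + 1) =
      TensorProduct.map 1 (weightedDiff q c i * weightedDiff q d i) := by
  have h : ∀ x : Module.End Kq (Fin 2 → Kq), ∀ c : ℕ → Module.End Kq M,
      weightedDiff q (consOp x c) (i + 1) = TensorProduct.map vSgn (weightedDiff q c i) := by
    intro x c
    refine vw_ext fun i w => ?_
    simp [weightedDiff, consOp, TensorProduct.tmul_sub]
  rw [h, h, ← TensorProduct.map_mul, vSgn_mul_vSgn]

/-- The last clause looks one factor ahead: it is the product joining a new first factor to the
present one. It is carried through the induction because its proof needs the concrete form of `c`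
and `d`. -/
theorem exists_isFock (n : ℕ) :
    ∃ c d : ℕ → Module.End Kq (Rep.ofSeq (List.replicate (n + 1) 1)).obj.carrier,
      IsFock (fun g => (Rep.ofSeq (List.replicate (n + 1) 1)).obj.ρ (Uq.of g)) n c d ∧
      (∀ i < n, weightedDiff q c i * weightedDiff q d i ∈ webImage (List.replicate (n + 1) 1)) ∧
      weightedDiff q (consOp vF c) 0 * weightedDiff q (consOp vE d) 0 ∈
        webImage (1 :: 1 :: List.replicate n 1) := by
  induction n with
  | zero =>
    refine ⟨fun _ => vF, fun _ => vE, ?_, fun i hi => absurd hi (Nat.not_lt_zero i), ?_⟩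
    · have h : (fun g => (V 1).ρ (Uq.of g)) = vOp 1 := funext fun g => V_ρ 1 g
      exact h.symm ▸ isFock_vOp
    · have h := webImage_smul_one_sub_smul phiDumbbell_mem_webImage (q ^ 2 + 1) q
      exact Eq.mpr (congrArg (fun x => x ∈ webImage [1, 1]) weightedDiff_mul_eq_phiDumbbell) h
  | succ n ih =>
    obtain ⟨c, d, h, hm, h0⟩ := ih
    refine ⟨consOp vF c, consOp vE d, ?_, ?_, ?_⟩
    · have := h.cons
      rw [← tensor_V_one_ρ] at this
      exact this
    · intro i hi
      cases i with
      | zero => exact h0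
      | succ i =>
        have h1 := map_one_mem_webImage 1 1 (List.replicate n 1) (hm i (by omega))
        rw [← weightedDiff_consOp_succ_mul vF vE] at h1
        exact h1
    · have h := webImage_smul_one_sub_smul (phiDumbbellLeft_mem_webImage 1 (List.replicate n 1))
        (q ^ 2 + 1) q
      have e := weightedDiff_mul_eq_phiDumbbellLeft c d
      exact Eq.mpr (congrArg (fun x => x ∈ webImage (1 :: 1 :: 1 :: List.replicate n 1)) e) h

/-! ### Fullness on sequences of ones -/

theorem opQ_one_one_replicate (n : ℕ) :
    (Rep.ofSeq (List.replicate n 1)).obj.opQ (1, 1) = q ^ n • 1 := by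
  cases n with
  | zero =>
    rw [pow_zero, one_smul]
    exact SuperRep.unit_ρ (UqGen.qh (1, 1))
  | succ n =>
    obtain ⟨c, d, h, -⟩ := exists_isFock n
    exact h.act_K

/-- A morphism intertwines the scalars q^n and q^m by which K acts on the two sides. -/
theorem eq_zero_of_replicate_ne {n m : ℕ} (hnm : n ≠ m)
    (f : Rep.ofSeq (List.replicate n 1) ⟶ Rep.ofSeq (List.replicate m 1)) : Rep.toLin f = 0 := by
  have h := SuperRep.Hom.comm_ρ f.hom (Uq.of (.qh (1, 1)))
  have h' : q ^ n • Rep.toLin f = q ^ m • Rep.toLin f := by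
    have e1 := opQ_one_one_replicate n
    have e2 := opQ_one_one_replicate m
    rw [show (Rep.ofSeq (List.replicate n 1)).obj.ρ (Uq.of (.qh (1, 1))) = _ from e1,
      show (Rep.ofSeq (List.replicate m 1)).obj.ρ (Uq.of (.qh (1, 1))) = _ from e2,
      LinearMap.comp_smul, LinearMap.smul_comp] at h
    exact h
  rw [← sub_eq_zero, ← sub_smul] at h'
  exact (smul_eq_zero.mp h').resolve_left (sub_ne_zero.mpr fun h => hnm (q_pow_injective h))

theorem exists_eval_eq_of_replicate {n m : ℕ}
    (f : Rep.ofSeq (List.replicate n 1) ⟶ Rep.ofSeq (List.replicate m 1)) :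
    ∃ e : WebExpr (List.replicate n 1) (List.replicate m 1), e.eval = f := by
  by_cases hnm : n = m
  · subst hnm
    cases n with
    | zero =>
      refine ⟨.smul (Rep.toLin f (1 : Kq)) (.id []), Rep.hom_ext ?_⟩
      have h : ∀ g : Kq →ₗ[Kq] Kq, g 1 • (LinearMap.id : Kq →ₗ[Kq] Kq) = g := fun g =>
        LinearMap.ext_ring (by simp)
      exact h (Rep.toLin f)
    | succ n =>
      obtain ⟨c, d, h, hm, -⟩ := exists_isFock n
      have h1 := h.mem_adjoin f.hom
      have h2 : Algebra.adjoin Kq {x | ∃ i < n, x = weightedDiff q c i * weightedDiff q d i} ≤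
          webImage (List.replicate (n + 1) 1) :=
        Algebra.adjoin_le (by rintro _ ⟨i, hi, rfl⟩; exact hm i hi)
      obtain ⟨e, he⟩ := h2 h1
      exact ⟨e, Rep.hom_ext he⟩
  · exact ⟨.zero _ _, Rep.hom_ext (eq_zero_of_replicate_ne hnm f).symm⟩

/-! ### Fullness -/

/-- Up to a non-zero scalar, `a` is a retract of a sequence of ones. -/
def IsRetractOfOnes (a : Web) : Prop :=
  ∃ (w : Web) (s : a ⟶ w) (m : w ⟶ a) (c : Kq), (∀ x ∈ w.labels, x = 1) ∧ c ≠ 0 ∧ s ≫ m = c • 𝟙 a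

theorem IsRetractOfOnes.of_ones {a : Web} (h : ∀ x ∈ a.labels, x = 1) : IsRetractOfOnes a :=
  ⟨a, 𝟙 a, 𝟙 a, 1, h, one_ne_zero, by simp⟩

theorem Web.smul_tensorHom {a b c d : Web} (r : Kq) (f : a ⟶ b) (g : c ⟶ d) :
    (r • f) ⊗ₘ g = r • (f ⊗ₘ g) := by
  obtain ⟨f, rfl⟩ := Web.ofExpr_surjective f
  obtain ⟨g, rfl⟩ := Web.ofExpr_surjective g
  exact Web.ofExpr_eq (.smul_tensor r f g)

theorem Web.tensorHom_smul {a b c d : Web} (r : Kq) (f : a ⟶ b) (g : c ⟶ d) :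
    f ⊗ₘ (r • g) = r • (f ⊗ₘ g) := by
  obtain ⟨f, rfl⟩ := Web.ofExpr_surjective f
  obtain ⟨g, rfl⟩ := Web.ofExpr_surjective g
  exact Web.ofExpr_eq (.tensor_smul r f g)

theorem IsRetractOfOnes.tensor {a b : Web} (ha : IsRetractOfOnes a) (hb : IsRetractOfOnes b) :
    IsRetractOfOnes (a ⊗ b) := by
  obtain ⟨w, s, m, c, hw, hc, h⟩ := ha
  obtain ⟨w', s', m', c', hw', hc', h'⟩ := hb
  refine ⟨w ⊗ w', s ⊗ₘ s', m ⊗ₘ m', c * c', fun x hx => ?_, mul_ne_zero hc hc', ?_⟩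
  · exact (List.mem_append.mp hx).elim (hw x) (hw' x)
  · rw [MonoidalCategory.tensorHom_comp_tensorHom, h, h', Web.smul_tensorHom, Web.tensorHom_smul,
      MonoidalCategory.id_tensorHom_id, smul_smul]

theorem IsRetractOfOnes.of_retract {a b : Web} (hb : IsRetractOfOnes b) (s : a ⟶ b) (m : b ⟶ a)
    {c : Kq} (hc : c ≠ 0) (h : s ≫ m = c • 𝟙 a) : IsRetractOfOnes a := by
  obtain ⟨w, s', m', c', hw, hc', h'⟩ := hb
  refine ⟨w, s ≫ s', m' ≫ m, c' * c, hw, mul_ne_zero hc' hc, ?_⟩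
  rw [Category.assoc, reassoc_of% h', Linear.smul_comp, Category.id_comp, Linear.comp_smul, h,
    smul_smul]

/-- One strand labelled 1 is split off at a time; the digon relation contributes a quantum binomial,
nonzero because q is not a root of unity. -/
theorem isRetractOfOnes_singleton (x : ℕ+) : IsRetractOfOnes ⟨[x]⟩ := by
  induction x using PNat.recOn with
  | one => exact .of_ones (by simp)
  | succ x ih =>
    have h1 : IsRetractOfOnes ⟨[1]⟩ := .of_ones (by simp)
    exact (ih.tensor h1).of_retract (Web.split x 1) (Web.merge x 1) (qBinom_ne_zero _ _)
      (Web.ofExpr_eq (.digon x 1))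

theorem isRetractOfOnes (a : Web) : IsRetractOfOnes a := by
  obtain ⟨l⟩ := a
  induction l with
  | nil => exact .of_ones (by simp)
  | cons x l ih => exact (isRetractOfOnes_singleton x).tensor ih

theorem exists_map_eq_of_ones {w w' : Web} (hw : ∀ x ∈ w.labels, x = 1)
    (hw' : ∀ x ∈ w'.labels, x = 1) (f : webFunctor.obj w ⟶ webFunctor.obj w') :
    ∃ g, webFunctor.map g = f := by
  obtain ⟨l⟩ := w
  obtain ⟨l'⟩ := w'
  obtain ⟨n, rfl⟩ : ∃ n, l = List.replicate n 1 := ⟨_, List.eq_replicate_of_mem hw⟩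
  obtain ⟨n', rfl⟩ : ∃ n, l' = List.replicate n 1 := ⟨_, List.eq_replicate_of_mem hw'⟩
  obtain ⟨e, he⟩ := exists_eval_eq_of_replicate f
  exact ⟨Web.ofExpr e, he⟩

instance : webFunctor.Full where
  map_surjective {a b} f := by
    obtain ⟨w, s, m, c, hw, hc, h⟩ := isRetractOfOnes a
    obtain ⟨w', s', m', c', hw', hc', h'⟩ := isRetractOfOnes b
    obtain ⟨g, hg⟩ := exists_map_eq_of_ones hw hw' (webFunctor.map m ≫ f ≫ webFunctor.map s')
    have map_smul_id : ∀ (r : Kq) (x : Web), webFunctor.map (r • 𝟙 x) = r • 𝟙 _ := fun r x => by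
      rw [webFunctor_extendsAssignment.map_smul, CategoryTheory.Functor.map_id]
    -- Surrounding the lift of m f s' by s and m' produces (s m) f (s' m') = c c' f, whence the
    -- scalar.
    refine ⟨(c * c')⁻¹ • (s ≫ g ≫ m'), ?_⟩
    rw [webFunctor_extendsAssignment.map_smul, Functor.map_comp, Functor.map_comp, hg]
    simp only [Category.assoc]
    rw [← Functor.map_comp, h', ← Functor.map_comp_assoc, h, map_smul_id, map_smul_id,
      Linear.comp_smul, Linear.smul_comp, Linear.comp_smul, Category.comp_id, Category.id_comp,
      smul_smul, smul_smul, mul_assoc, inv_mul_cancel₀, one_smul]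
    exact mul_ne_zero hc hc'

end

end GL11

theorem mainTheorem8 :
    (∃ (T : CategoryTheory.Functor GL11.Web GL11.Rep) (_ : T.Monoidal),
      GL11.ExtendsAssignment T ∧ T.EssSurj ∧ T.Full) ∧
    (∀ (T T' : CategoryTheory.Functor GL11.Web GL11.Rep) [T.Monoidal] [T'.Monoidal],
      GL11.ExtendsAssignment T → GL11.ExtendsAssignment T' → T = T') :=
  ⟨⟨GL11.webFunctor, inferInstance, GL11.webFunctor_extendsAssignment, inferInstance,
    inferInstance⟩, fun _ _ _ _ h h' => h.unique h'⟩
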